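/- Let $G$ be a group, $V$ a unitary representation of $G$ on a complex Hilbert space $\mathcal K$, and $\Gamma$ a conjugation (antiunitary involution) on $\mathcal K$. Let $F$ be the tensor flip of $\mathcal K\otimes\mathcal K$. Let $R$ be an invariant Yang--Baxter function, i.e. a strongly measurable, essentially bounded function $R:\mathbb R\to\mathcal B(\mathcal K\otimes\mathcal K)$ such that for almost all $\theta,\theta'\in\mathbb R$: $R(\theta)$ is unitary; $R(\theta)$ commutes with $V(g)\otimes V(g)$ for all $g\in G$; $(\Gamma\otimes\Gamma)F R(-\theta)F(\Gamma\otimes\Gamma)=R(\theta)$; $(R(\theta)\otimes1)(1\otimes R(\theta+\theta'))(R(\theta')\otimes1)=(1\otimes R(\theta'))(R(\theta+\theta')\otimes1)(1\otimes R(\theta))$; and $R(-\theta)=R(\theta)^{-1}$. Assume that $R$ is crossing-symmetric: $R$ is the boundary value (weakly, almost everywhere) of a bounded analytic function on the strip $0<\operatorname{Im}\theta<\pi$, also denoted $R$, whose boundary values on the upper edge satisfy, for all $\xi,\psi,\varphi,\xi'\in\mathcal K$ and almost all $\theta\in\mathbb R$, $$\langle\xi\otimes\psi,R(i\pi-\theta)(\varphi\otimes\xi')\rangle=\langle\psi\otimes\Gamma\xi',R(\theta)(\Gamma\xi\otimes\varphi)\rangle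 .$$ Let $\mathcal H_1=L^2(\mathbb R\to\mathcal K,d\theta)$ and let $\boldsymbol R$ be the operator on $\mathcal H_1\otimes\mathcal H_1\cong L^2(\mathbb R^2\to\mathcal K\otimes\mathcal K)$ given by $(\boldsymbol R\Psi)(\theta_1,\theta_2)=R(\theta_1-\theta_2)\Psi(\theta_2,\theta_1)$. The $\boldsymbol R$-symmetric Fock space is $\mathcal H^R=\bigoplus_{n\ge0}\mathcal H^R_n$, where $\mathcal H^R_n\subset\mathcal H_1^{\otimes n}$ is the subspace of vectors invariant under all operators $1^{\otimes j}\otimes\boldsymbol R\otimes1^{\otimes(n-j-2)}$, with orthogonal projection $P^R_n$. On vectors of finite particle number let $z_R^\dagger(\boldsymbol\xi)\boldsymbol\Psi_n=\sqrt{n+1}\,P^R_{n+1}(\boldsymbol\xi\otimes\boldsymbol\Psi_n)$ and $z_R(\boldsymbol\xi)=z_R^\dagger(\boldsymbol\xi)^*$, and let $\Theta$ be the antiunitary involution of $\mathcal H^R$ that acts on $\mathcal H_n^R$ as the restriction of $\boldsymbol\xi_1\otimes\cdots\otimes\boldsymbol\xi_n\mapsto\Theta_1\boldsymbol\xi_n\otimes\cdots\otimes\Theta_1\boldsymbol\xi_1$,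 where $(\Theta_1\boldsymbol\xi)(\theta)=\Gamma\,\boldsymbol\xi(\theta)$. For $f\in\mathscr S(\mathbb R)$ put $f^\pm(\theta)=\pm ie^\theta\int_{\mathbb R}e^{\pm iue^\theta}f(u)\,du$ and, for $k\in\mathcal K$, $$\phi_{R,k}(f)=z_R^\dagger(f^+\otimes k)+z_R(\overline{f^-}\otimes\Gamma k),\qquad \phi'_{R,k}(f)=\Theta\,\phi_{R,\Gamma k}(\overline{f_-})\,\Theta,\qquad \overline{f_-}(u)=\overline{f(-u)} .$$ Then for all $k,k'\in\mathcal K$, $[\phi_{R,k}(u),\phi'_{R,k'}(u')]=0$ for $u<u'$ in the sense of distributions on the space of vectors of finite particle number. That is, for all $f,g\in\mathscr S(\mathbb R)$ such that $u<u'$ whenever $f(u)\neq0$ and $g(u')\neq0$, and all vectors $\Psi\in\mathcal H^R$ of finite particle number, $$\phi_{R,k}(f)\,\phi'_{R,k'}(g)\,\Psi=\phi'_{R,k'}(g)\,\phi_{R,k}(f)\,\Psi .$$ -/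

import Mathlib

open MeasureTheory Filter Topology
open scoped TensorProduct SchwartzMap InnerProductSpace ComplexConjugate ENNReal

universe u v

noncomputable section

namespace YangBaxterQFT

section HilbertTensor

variable {E F G E' F' : Type*}
  [NormedAddCommGroup E] [InnerProductSpace ℂ E] [NormedAddCommGroup F] [InnerProductSpace ℂ F]
  [NormedAddCommGroup G] [InnerProductSpace ℂ G]
  [NormedAddCommGroup E'] [InnerProductSpace ℂ E'] [NormedAddCommGroup F'] [InnerProductSpace ℂ F']

/-- The Hilbert space tensor product: the completion of the algebraic tensor product with respect
to `⟪a ⊗ b, c ⊗ d⟫ = ⟪a, c⟫ * ⟪b, d⟫`. -/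
def HTensor (E F : Type*) [NormedAddCommGroup E] [InnerProductSpace ℂ E]
    [NormedAddCommGroup F] [InnerProductSpace ℂ F] : Type _ :=
  UniformSpace.Completion (E ⊗[ℂ] F)

instance : NormedAddCommGroup (HTensor E F) :=
  inferInstanceAs (NormedAddCommGroup (UniformSpace.Completion (E ⊗[ℂ] F)))

instance : InnerProductSpace ℂ (HTensor E F) :=
  inferInstanceAs (InnerProductSpace ℂ (UniformSpace.Completion (E ⊗[ℂ] F)))

instance : CompleteSpace (HTensor E F) :=
  inferInstanceAs (CompleteSpace (UniformSpace.Completion (E ⊗[ℂ] F)))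

/-- The inclusion of the algebraic tensor product. -/
def ofAlg (E F : Type*) [NormedAddCommGroup E] [InnerProductSpace ℂ E]
    [NormedAddCommGroup F] [InnerProductSpace ℂ F] : E ⊗[ℂ] F →ₗᵢ[ℂ] HTensor E F :=
  (UniformSpace.Completion.toComplₗᵢ : E ⊗[ℂ] F →ₗᵢ[ℂ] UniformSpace.Completion (E ⊗[ℂ] F))

theorem denseRange_ofAlg (E F : Type*) [NormedAddCommGroup E] [InnerProductSpace ℂ E]
    [NormedAddCommGroup F] [InnerProductSpace ℂ F] : DenseRange (ofAlg E F) :=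
  UniformSpace.Completion.denseRange_coe

/-- The extension by continuity of a bounded (anti)linear map on the algebraic tensor product. -/
def extendT {σ : ℂ →+* ℂ} [CompleteSpace G]
    (A : E ⊗[ℂ] F →SL[σ] G) : HTensor E F →SL[σ] G :=
  A.extend (ofAlg E F).toContinuousLinearMap

theorem extendT_ofAlg {σ : ℂ →+* ℂ} [CompleteSpace G] (A : E ⊗[ℂ] F →SL[σ] G) (x : E ⊗[ℂ] F) : extendT A (ofAlg E F x) = A x :=
  ContinuousLinearMap.extend_eq A (e := (ofAlg E F).toContinuousLinearMap)
    (denseRange_ofAlg E F) (ofAlg E F).isometry.isUniformInducing x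

/-- The pure tensor `x ⊗ y`, as a continuous bilinear map. -/
def tmulL (E F : Type*) [NormedAddCommGroup E] [InnerProductSpace ℂ E]
    [NormedAddCommGroup F] [InnerProductSpace ℂ F] : E →L[ℂ] F →L[ℂ] HTensor E F :=
  (ContinuousLinearMap.compL ℂ F (E ⊗[ℂ] F) (HTensor E F) (ofAlg E F).toContinuousLinearMap) ∘L
    TensorProduct.mkL ℂ E F

/-- The pure tensor `x ⊗ y` in the Hilbert space tensor product. -/
def tmul (x : E) (y : F) : HTensor E F := ofAlg E F (x ⊗ₜ[ℂ] y)

/-- The tensor product `A ⊗ B` of bounded operators. -/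
def mapT (A : E →L[ℂ] E') (B : F →L[ℂ] F') : HTensor E F →L[ℂ] HTensor E' F' :=
  extendT ((ofAlg E' F').toContinuousLinearMap ∘L TensorProduct.mapL A B)

/-- The tensor flip `x ⊗ y ↦ y ⊗ x`. -/
def flipT (E F : Type*) [NormedAddCommGroup E] [InnerProductSpace ℂ E]
    [NormedAddCommGroup F] [InnerProductSpace ℂ F] : HTensor E F →L[ℂ] HTensor F E :=
  extendT ((ofAlg F E).comp
    (TensorProduct.commIsometry ℂ E F).toLinearIsometry).toContinuousLinearMap

theorem mapT_tmul (A : E →L[ℂ] E') (B : F →L[ℂ] F') (x : E) (y : F) :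
    mapT A B (tmul x y) = tmul (A x) (B y) := by
  rw [mapT, tmul, extendT_ofAlg]; rfl

theorem flipT_tmul (x : E) (y : F) : flipT E F (tmul x y) = tmul y x := by
  rw [flipT, tmul, extendT_ofAlg]; rfl

theorem inner_conj_conj (A : E →ₗᵢ⋆[ℂ] E') (a b : E) : inner ℂ (A a) (A b) = inner ℂ b a := by
  have hI : ∀ z : E, A (Complex.I • z) = -(Complex.I • A z) := by
    intro z; rw [map_smulₛₗ]; simp
  rw [inner_eq_sum_norm_sq_div_four, inner_eq_sum_norm_sq_div_four]
  have e1 : ‖A a + A b‖ = ‖b + a‖ := by rw [← map_add, A.norm_map, add_comm]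
  have e2 : ‖A a - A b‖ = ‖b - a‖ := by rw [← map_sub, A.norm_map, norm_sub_rev]
  have e3 : ‖A a - Complex.I • A b‖ = ‖b - Complex.I • a‖ := by
    have : A a - Complex.I • A b = A (a + Complex.I • b) := by rw [map_add, hI]; abel
    rw [this, A.norm_map]
    have : b - Complex.I • a = (-Complex.I) • (a + Complex.I • b) := by
      rw [smul_add, smul_smul]; simp [sub_eq_add_neg, add_comm]
    rw [this, norm_smul]; simp
  have e4 : ‖A a + Complex.I • A b‖ = ‖b + Complex.I • a‖ := by
    have : A a + Complex.I • A b = A (a - Complex.I • b) := by rw [map_sub, hI]; abel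
    rw [this, A.norm_map]
    have : b + Complex.I • a = Complex.I • (a - Complex.I • b) := by
      rw [smul_sub, smul_smul]; simp [sub_eq_add_neg, add_comm]
    rw [this, norm_smul]; simp
  simp only [RCLike.I_to_complex] at *
  rw [e1, e2, e3, e4]

theorem inner_map_conj (A : E →ₗᵢ⋆[ℂ] E') (B : F →ₗᵢ⋆[ℂ] F') (x y : E ⊗[ℂ] F) :
    inner ℂ (TensorProduct.map A.toLinearMap B.toLinearMap x)
      (TensorProduct.map A.toLinearMap B.toLinearMap y) = inner ℂ y x := by
  induction x using TensorProduct.induction_on with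
  | zero => simp
  | add a b ha hb => simp only [map_add, inner_add_left, inner_add_right, ha, hb]
  | tmul a b =>
    induction y using TensorProduct.induction_on with
    | zero => simp
    | add c d hc hd => simp only [map_add, inner_add_left, inner_add_right, hc, hd]
    | tmul c d =>
      simp only [TensorProduct.map_tmul, TensorProduct.inner_tmul]
      exact congrArg₂ _ (inner_conj_conj A a c) (inner_conj_conj B b d)

/-- The tensor product `A ⊗ B` of antilinear isometries, on the algebraic tensor product. -/
def algMapConj (A : E →ₗᵢ⋆[ℂ] E') (B : F →ₗᵢ⋆[ℂ] F') : E ⊗[ℂ] F →ₗᵢ⋆[ℂ] E' ⊗[ℂ] F' where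
  toLinearMap := TensorProduct.map A.toLinearMap B.toLinearMap
  norm_map' x := by
    rw [@norm_eq_sqrt_re_inner ℂ, @norm_eq_sqrt_re_inner ℂ, inner_map_conj]

/-- The tensor product `A ⊗ B` of antilinear isometries: the antilinear isometry with
`x ⊗ y ↦ A x ⊗ B y`. -/
def mapConjT (A : E →ₗᵢ⋆[ℂ] E') (B : F →ₗᵢ⋆[ℂ] F') : HTensor E F →ₗᵢ⋆[ℂ] HTensor E' F' where
  toLinearMap := (extendT ((ofAlg E' F').toContinuousLinearMap.comp
    (algMapConj A B).toContinuousLinearMap)).toLinearMap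
  norm_map' x := by
    refine (denseRange_ofAlg E F).induction_on x (isClosed_eq
      (ContinuousLinearMap.continuous _).norm continuous_norm) fun a => ?_
    rw [ContinuousLinearMap.coe_coe, extendT_ofAlg]
    simp

theorem mapConjT_tmul (A : E →ₗᵢ⋆[ℂ] E') (B : F →ₗᵢ⋆[ℂ] F') (x : E) (y : F) :
    mapConjT A B (tmul x y) = tmul (A x) (B y) :=
  extendT_ofAlg ((ofAlg E' F').toContinuousLinearMap.comp
    (algMapConj A B).toContinuousLinearMap) (x ⊗ₜ[ℂ] y)

theorem denseRange_tensor {A : E →ₗ[ℂ] E'} {B : F →ₗ[ℂ] F'} (hA : DenseRange A)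
    (hB : DenseRange B) :
    DenseRange (TensorProduct.map A B) := by
  have h : (LinearMap.range (TensorProduct.map A B)).topologicalClosure = ⊤ := by
    rw [eq_top_iff]
    rintro x -
    induction x using TensorProduct.induction_on with
    | zero => exact zero_mem _
    | add a b ha hb => exact add_mem ha hb
    | tmul a b =>
      have hc : IsClosed {p : E' × F' | p.1 ⊗ₜ[ℂ] p.2 ∈
          (LinearMap.range (TensorProduct.map A B)).topologicalClosure} :=
        (Submodule.isClosed_topologicalClosure _).preimage TensorProduct.continuous_tmul
      have := (hA.prodMap hB).induction_on (p := fun p : E' × F' => p.1 ⊗ₜ[ℂ] p.2 ∈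
          (LinearMap.range (TensorProduct.map A B)).topologicalClosure) (a, b) hc (by
        rintro ⟨x, y⟩
        exact Submodule.le_topologicalClosure _ ⟨x ⊗ₜ y, rfl⟩)
      exact this
  intro x
  have : x ∈ (LinearMap.range (TensorProduct.map A B)).topologicalClosure := h ▸ trivial
  rw [← SetLike.mem_coe, Submodule.topologicalClosure_coe, LinearMap.coe_range] at this
  exact this

/-- The associator `(x ⊗ y) ⊗ z ↦ x ⊗ (y ⊗ z)`. -/
def assocT (E F G : Type*) [NormedAddCommGroup E] [InnerProductSpace ℂ E]
    [NormedAddCommGroup F] [InnerProductSpace ℂ F] [NormedAddCommGroup G] [InnerProductSpace ℂ G] :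
    HTensor (HTensor E F) G ≃ₗᵢ[ℂ] HTensor E (HTensor F G) :=
  (TensorProduct.assoc ℂ E F G).extendOfIsometry
    ((ofAlg (HTensor E F) G).toLinearMap ∘ₗ
      TensorProduct.map (ofAlg E F).toLinearMap (LinearIsometry.id (R := ℂ) (E := G)).toLinearMap)
    ((ofAlg E (HTensor F G)).toLinearMap ∘ₗ
      TensorProduct.map (LinearIsometry.id (R := ℂ) (E := E)).toLinearMap (ofAlg F G).toLinearMap)
    ((denseRange_ofAlg _ _).comp
      (denseRange_tensor (denseRange_ofAlg E F) Function.surjective_id.denseRange)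
      (ofAlg _ _).continuous)
    ((denseRange_ofAlg _ _).comp
      (denseRange_tensor Function.surjective_id.denseRange (denseRange_ofAlg F G))
      (ofAlg _ _).continuous)
    (by
      intro x
      simp only [LinearMap.comp_apply, LinearIsometry.coe_toLinearMap, LinearIsometry.norm_map,
        TensorProduct.norm_map]
      exact (TensorProduct.assocIsometry ℂ E F G).norm_map x)

theorem assocT_tmul (x : E) (y : F) (z : G) :
    assocT E F G (tmul (tmul x y) z) = tmul x (tmul y z) :=
  LinearEquiv.extendOfIsometry_eq _ _ _ _ _ _ ((x ⊗ₜ[ℂ] y) ⊗ₜ[ℂ] z)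

/-- `T ⊗ 1` acting on the first two factors of `E ⊗ (E ⊗ G)`. -/
def leftAmp (G : Type*) [NormedAddCommGroup G] [InnerProductSpace ℂ G]
    (T : HTensor E E →L[ℂ] HTensor E E) :
    HTensor E (HTensor E G) →L[ℂ] HTensor E (HTensor E G) :=
  (assocT E E G).toContinuousLinearEquiv.toContinuousLinearMap ∘L
    mapT T (ContinuousLinearMap.id ℂ G) ∘L
    (assocT E E G).symm.toContinuousLinearEquiv.toContinuousLinearMap

end HilbertTensor

section Power

/-- A bundled Hilbert space, used to define tensor powers by recursion. -/
structure HilbertSp where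
  carrier : Type u
  [grp : NormedAddCommGroup carrier]
  [ips : InnerProductSpace ℂ carrier]
  [cpl : CompleteSpace carrier]

variable (H : Type u) [NormedAddCommGroup H] [InnerProductSpace ℂ H]

attribute [local instance] HilbertSp.grp HilbertSp.ips HilbertSp.cpl

/-- `H^{⊗0} = ℂ` (as the one-dimensional Euclidean space in the universe of `H`) and
`H^{⊗(n+1)} = H ⊗ H^{⊗n}`. -/
def powBundle : ℕ → HilbertSp.{u}
  | 0 => ⟨EuclideanSpace ℂ PUnit.{u + 1}⟩
  | n + 1 => ⟨HTensor H (powBundle n).carrier⟩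

/-- The `n`-th Hilbert space tensor power `H^{⊗n}`. -/
def Pow (n : ℕ) : Type u := (powBundle H n).carrier

instance (n : ℕ) : NormedAddCommGroup (Pow H n) := (powBundle H n).grp
instance (n : ℕ) : InnerProductSpace ℂ (Pow H n) := (powBundle H n).ips
instance (n : ℕ) : CompleteSpace (Pow H n) := (powBundle H n).cpl

/-- The identity `H ⊗ H^{⊗n} = H^{⊗(n+1)}`. -/
def powCons (n : ℕ) : HTensor H (Pow H n) ≃ₗᵢ[ℂ] Pow H (n + 1) :=
  LinearIsometryEquiv.refl ℂ (HTensor H (Pow H n))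

/-- The identity `H^{⊗0} = ℂ`. -/
def powZero : EuclideanSpace ℂ PUnit.{u + 1} ≃ₗᵢ[ℂ] Pow H 0 :=
  LinearIsometryEquiv.refl ℂ (EuclideanSpace ℂ PUnit.{u + 1})

variable {H}

/-- For `T` on `H ⊗ H`, the operator `1^{⊗j} ⊗ T ⊗ 1^{⊗(n-j-2)}` on `H^{⊗n}`, which represents the
transposition of the factors `j` and `j + 1` (factors are counted from `0`). It is the identity if
`n ≤ j + 1`. -/
def leg (T : HTensor H H →L[ℂ] HTensor H H) : (n : ℕ) → ℕ → (Pow H n →L[ℂ] Pow H n)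
  | 0, _ => ContinuousLinearMap.id ℂ _
  | 1, _ => ContinuousLinearMap.id ℂ _
  | n + 2, 0 =>
    let e : HTensor H (HTensor H (Pow H n)) ≃L[ℂ] Pow H (n + 2) :=
      (powCons H (n + 1)).toContinuousLinearEquiv
    e.toContinuousLinearMap ∘L leftAmp (Pow H n) T ∘L e.symm.toContinuousLinearMap
  | n + 2, j + 1 =>
    let e := (powCons H (n + 1)).toContinuousLinearEquiv
    e.toContinuousLinearMap ∘L mapT (ContinuousLinearMap.id ℂ H) (leg T (n + 1) j) ∘L
      e.symm.toContinuousLinearMap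

/-- Appending a factor on the right: `(x₁ ⊗ ⋯ ⊗ xₙ) ⊗ y ↦ x₁ ⊗ ⋯ ⊗ xₙ ⊗ y`. -/
def powSnoc (H : Type u) [NormedAddCommGroup H] [InnerProductSpace ℂ H] :
    (n : ℕ) → (HTensor (Pow H n) H →L[ℂ] Pow H (n + 1))
  | 0 => (powCons H 0).toContinuousLinearEquiv.toContinuousLinearMap ∘L flipT (Pow H 0) H
  | n + 1 => (powCons H (n + 1)).toContinuousLinearEquiv.toContinuousLinearMap ∘L
      mapT (ContinuousLinearMap.id ℂ H) (powSnoc H n) ∘L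
      (assocT H (Pow H n) H).toContinuousLinearEquiv.toContinuousLinearMap ∘L
      mapT (powCons H n).symm.toContinuousLinearEquiv.toContinuousLinearMap
        (ContinuousLinearMap.id ℂ H)

/-- The total reversal `x₁ ⊗ ⋯ ⊗ xₙ ↦ xₙ ⊗ ⋯ ⊗ x₁`. -/
def powRev (H : Type u) [NormedAddCommGroup H] [InnerProductSpace ℂ H] :
    (n : ℕ) → (Pow H n →L[ℂ] Pow H n)
  | 0 => ContinuousLinearMap.id ℂ _
  | n + 1 => powSnoc H n ∘L mapT (powRev H n) (ContinuousLinearMap.id ℂ H) ∘L flipT H (Pow H n) ∘L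
      (powCons H n).symm.toContinuousLinearEquiv.toContinuousLinearMap

/-- Complex conjugation on the one-dimensional space `H^{⊗0} = ℂ`. -/
def euclConj : EuclideanSpace ℂ PUnit.{u + 1} →ₗᵢ⋆[ℂ] EuclideanSpace ℂ PUnit.{u + 1} where
  toFun x := WithLp.toLp 2 fun i => conj (x i)
  map_add' x y := by ext i; simp
  map_smul' c x := by ext i; simp
  norm_map' x := by simp [EuclideanSpace.norm_eq]

/-- The antilinear map `A^{⊗n}`, for an antilinear isometry `A`. -/
def powConj (A : H →ₗᵢ⋆[ℂ] H) : (n : ℕ) → (Pow H n →ₗᵢ⋆[ℂ] Pow H n)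
  | 0 => (powZero H).toLinearIsometry.comp (euclConj.comp (powZero H).symm.toLinearIsometry)
  | n + 1 => (powCons H n).toLinearIsometry.comp
      ((mapConjT A (powConj A n)).comp (powCons H n).symm.toLinearIsometry)

end Power

section Fock

variable {H : Type u} [NormedAddCommGroup H] [InnerProductSpace ℂ H]
  (T : HTensor H H →L[ℂ] HTensor H H)

/-- The `T`-symmetric `n`-particle space `H_n^T ⊆ H^{⊗n}`: the vectors that are invariant under the
representatives of all elementary transpositions, hence, when these generate a representation of
the symmetric group, the vectors on which that representation acts trivially. -/
def symSpace (n : ℕ) : Submodule ℂ (Pow H n) where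
  carrier := {Ψ | ∀ j, leg T n j Ψ = Ψ}
  add_mem' ha hb j := by rw [map_add, ha j, hb j]
  zero_mem' j := map_zero _
  smul_mem' c x hx j := by rw [map_smul, hx j]

instance (n : ℕ) : CompleteSpace (symSpace T n) := by
  refine IsComplete.completeSpace_coe (s := (symSpace T n : Set (Pow H n)))
    (IsClosed.isComplete ?_)
  have : (symSpace T n : Set (Pow H n)) = ⋂ j, {Ψ | leg T n j Ψ = Ψ} := by
    ext; simp [symSpace]
  rw [this]
  exact isClosed_iInter fun j => isClosed_eq (leg T n j).continuous continuous_id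

/-- The orthogonal projection `P_n^T` of `H^{⊗n}` onto `H_n^T`. For a unitary representation of the
symmetric group this is the mean over the group. -/
def symProj (n : ℕ) : Pow H n →L[ℂ] symSpace T n := (symSpace T n).orthogonalProjectionOnto

/-- The `T`-symmetric Fock space, the Hilbert space direct sum of the spaces `H_n^T`. -/
abbrev Fock : Type u := lp (fun n : ℕ => symSpace T n) 2

/-- The vectors of finite particle number. -/
def finPart : Submodule ℂ (Fock T) where
  carrier := {Ψ | {n : ℕ | Ψ n ≠ 0}.Finite}
  add_mem' {a b} ha hb := (ha.union hb).subset fun n hn => by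
    by_contra h
    simp only [Set.mem_union, Set.mem_ofPred_eq, not_or, not_not] at h
    exact hn (by rw [lp.coeFn_add, Pi.add_apply, h.1, h.2, add_zero])
  zero_mem' := by simp
  smul_mem' c x hx := hx.subset fun n hn h => hn (by rw [lp.coeFn_smul, Pi.smul_apply, h, smul_zero])

variable {T}

/-- The vector of finite particle number with given `n`-particle components. -/
def mkFin (Ψ : ∀ n, symSpace T n) (h : {n : ℕ | Ψ n ≠ 0}.Finite) : finPart T :=
  ⟨⟨Ψ, (memℓp_zero h).of_exponent_ge (zero_le)⟩, h⟩

variable (T)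

/-- The operator on vectors of finite particle number with
`(a Ψ)_{n+1} = A_n Ψ_n` and `(a Ψ)_0 = 0`. -/
def raiseOp (A : ∀ n, symSpace T n →L[ℂ] symSpace T (n + 1)) : finPart T →ₗ[ℂ] finPart T where
  toFun Ψ := mkFin (fun m => match m with
      | 0 => 0
      | n + 1 => A n ((Ψ : Fock T) n))
    ((Ψ.2.image Nat.succ).subset fun m hm => by
      cases m with
      | zero => exact absurd rfl hm
      | succ n => exact ⟨n, fun h => hm (by simp only [h, map_zero]), rfl⟩)
  map_add' Ψ Φ := by
    ext m
    cases m with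
    | zero => exact congrArg Subtype.val (add_zero (0 : symSpace T 0)).symm
    | succ n => exact congrArg Subtype.val (map_add (A n) _ _)
  map_smul' c Ψ := by
    ext m
    cases m <;> simp [mkFin]

/-- The operator on vectors of finite particle number with `(b Ψ)_n = B_n Ψ_{n+1}`. -/
def lowerOp (B : ∀ n, symSpace T (n + 1) →L[ℂ] symSpace T n) : finPart T →ₗ[ℂ] finPart T where
  toFun Ψ := mkFin (fun n => B n ((Ψ : Fock T) (n + 1)))
    ((Ψ.2.image Nat.pred).subset fun n hn =>
      ⟨n + 1, fun h => hn (by simp only [h, map_zero]), rfl⟩)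
  map_add' Ψ Φ := by
    ext m
    exact congrArg Subtype.val (map_add (B m) _ _)
  map_smul' c Ψ := by
    ext m
    simp [mkFin]

/-- The antilinear operator on vectors of finite particle number with `(J Ψ)_n = J_n Ψ_n`. -/
def diagConjOp (J : ∀ n, symSpace T n →L⋆[ℂ] symSpace T n) : finPart T →ₗ⋆[ℂ] finPart T where
  toFun Ψ := mkFin (fun n => J n ((Ψ : Fock T) n))
    (Ψ.2.subset fun n hn h => hn (by simp only [h, map_zero]))
  map_add' Ψ Φ := by
    ext m
    exact congrArg Subtype.val (map_add (J m) _ _)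
  map_smul' c Ψ := by
    ext m
    simp [mkFin]

/-- `Ψ_n ↦ √(n+1) P_{n+1} (ξ ⊗ Ψ_n)`. -/
def createN (ξ : H) (n : ℕ) : symSpace T n →L[ℂ] symSpace T (n + 1) :=
  ((Real.sqrt (n + 1) : ℝ) : ℂ) •
    (symProj T (n + 1) ∘L (powCons H n).toContinuousLinearEquiv.toContinuousLinearMap ∘L
      tmulL H (Pow H n) ξ ∘L (symSpace T n).subtypeL)

/-- The creation operator `z†(ξ)` on vectors of finite particle number. -/
def create (ξ : H) : finPart T →ₗ[ℂ] finPart T := raiseOp T (createN T ξ)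

/-- The annihilation operator `z(ξ) = z†(ξ)^*` on vectors of finite particle number. -/
def annihilate (ξ : H) : finPart T →ₗ[ℂ] finPart T :=
  lowerOp T fun n => ContinuousLinearMap.adjoint (createN T ξ n)

theorem inner_annihilate (ξ : H) (Ψ Φ : finPart T) :
    inner ℂ (annihilate T ξ Ψ) Φ = inner ℂ Ψ (create T ξ Φ) := by
  change inner ℂ (annihilate T ξ Ψ : Fock T) (Φ : Fock T) =
    inner ℂ (Ψ : Fock T) (create T ξ Φ : Fock T)
  rw [lp.inner_eq_tsum, lp.inner_eq_tsum]
  rw [(lp.summable_inner (𝕜 := ℂ) (Ψ : Fock T) (create T ξ Φ : Fock T)).tsum_eq_zero_add]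
  have h0 : (create T ξ Φ : Fock T) 0 = 0 := rfl
  rw [h0, inner_zero_right, zero_add]
  exact tsum_congr fun n => ContinuousLinearMap.adjoint_inner_left _ _ _

/-- The second quantization `Θ` of an antilinear isometry `J` of `H` (on vectors of finite particle
number), given on `H_n^T` by `P_n^T J^{⊗n} F_n` with `F_n` the total reversal. When `T` commutes
with `(J ⊗ J) F_2`, the operator `J^{⊗n} F_n` commutes with the projection `P_n^T`, and this is the
restriction of `J^{⊗n} F_n` to `H_n^T`. -/
def secondQuantConj (J : H →ₗᵢ⋆[ℂ] H) : finPart T →ₗ⋆[ℂ] finPart T :=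
  diagConjOp T fun n => (symProj T n).comp ((powConj J n).toContinuousLinearMap.comp
    (powRev H n ∘L (symSpace T n).subtypeL))

end Fock


section OneParticle

variable (K : Type u) [NormedAddCommGroup K] [InnerProductSpace ℂ K]

/-- The one-particle space `L²(ℝ → K, dθ)`. -/
abbrev OneP : Type u := Lp K 2 (volume : Measure ℝ)

/-- The space `L²(ℝ² → K ⊗ K, dθ₁ dθ₂)`. -/
abbrev TwoP : Type u := Lp (HTensor K K) 2 (volume : Measure (ℝ × ℝ))

variable {K}

theorem norm_tmul (x y : K) : ‖tmul x y‖ = ‖x‖ * ‖y‖ := by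
  rw [tmul, LinearIsometry.norm_map, TensorProduct.norm_tmul]

theorem inner_tmul (x y x' y' : K) :
    inner ℂ (tmul x y) (tmul x' y') = inner ℂ x x' * inner ℂ y y' := by
  rw [tmul, tmul, LinearIsometry.inner_map_map, TensorProduct.inner_tmul]

theorem memLp_prodTensor (ξ η : OneP K) :
    MemLp (fun p : ℝ × ℝ => tmul (ξ p.1) (η p.2)) 2 volume := by
  have h1 : AEStronglyMeasurable (fun p : ℝ × ℝ => ξ p.1) volume :=
    (Lp.aestronglyMeasurable ξ).comp_quasiMeasurePreserving Measure.quasiMeasurePreserving_fst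
  have h2 : AEStronglyMeasurable (fun p : ℝ × ℝ => η p.2) volume :=
    (Lp.aestronglyMeasurable η).comp_quasiMeasurePreserving Measure.quasiMeasurePreserving_snd
  have hm : AEStronglyMeasurable (fun p : ℝ × ℝ => tmul (ξ p.1) (η p.2)) volume :=
    (tmulL K K).aestronglyMeasurable_comp₂ h1 h2
  rw [memLp_two_iff_integrable_sq_norm hm]
  simp only [norm_tmul, mul_pow]
  exact Integrable.mul_prod ((memLp_two_iff_integrable_sq_norm (Lp.aestronglyMeasurable ξ)).1
    (Lp.memLp ξ)) ((memLp_two_iff_integrable_sq_norm (Lp.aestronglyMeasurable η)).1 (Lp.memLp η))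

theorem ae_fst {p : ℝ → Prop} (h : ∀ᵐ x, p x) : ∀ᵐ z : ℝ × ℝ, p z.1 :=
  Measure.quasiMeasurePreserving_fst.ae h

theorem ae_snd {p : ℝ → Prop} (h : ∀ᵐ x, p x) : ∀ᵐ z : ℝ × ℝ, p z.2 :=
  Measure.quasiMeasurePreserving_snd.ae h

/-- The bilinear map that sends `ξ, η` to the function `(θ₁, θ₂) ↦ ξ(θ₁) ⊗ η(θ₂)`. -/
def prodTensor : OneP K →ₗ[ℂ] OneP K →ₗ[ℂ] TwoP K :=
  LinearMap.mk₂ ℂ (fun ξ η => (memLp_prodTensor ξ η).toLp _)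
    (fun ξ ξ' η => by
      ext1
      filter_upwards [(memLp_prodTensor (ξ + ξ') η).coeFn_toLp, (memLp_prodTensor ξ η).coeFn_toLp,
        (memLp_prodTensor ξ' η).coeFn_toLp, ae_fst (Lp.coeFn_add ξ ξ'),
        Lp.coeFn_add ((memLp_prodTensor ξ η).toLp _) ((memLp_prodTensor ξ' η).toLp _)]
        with p h1 h2 h3 h4 h5
      rw [h1, h5, Pi.add_apply, h2, h3, h4]
      exact (tmulL K K).map_add₂ _ _ _)
    (fun c ξ η => by
      ext1
      filter_upwards [(memLp_prodTensor (c • ξ) η).coeFn_toLp, (memLp_prodTensor ξ η).coeFn_toLp,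
        ae_fst (Lp.coeFn_smul c ξ), Lp.coeFn_smul c ((memLp_prodTensor ξ η).toLp _)]
        with p h1 h2 h3 h4
      rw [h1, h4, Pi.smul_apply, h2, h3]
      exact (tmulL K K).map_smul₂ _ _ _)
    (fun ξ η η' => by
      ext1
      filter_upwards [(memLp_prodTensor ξ (η + η')).coeFn_toLp, (memLp_prodTensor ξ η).coeFn_toLp,
        (memLp_prodTensor ξ η').coeFn_toLp, ae_snd (Lp.coeFn_add η η'),
        Lp.coeFn_add ((memLp_prodTensor ξ η).toLp _) ((memLp_prodTensor ξ η').toLp _)]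
        with p h1 h2 h3 h4 h5
      rw [h1, h5, Pi.add_apply, h2, h3, h4]
      exact map_add (tmulL K K _) _ _)
    (fun c ξ η => by
      ext1
      filter_upwards [(memLp_prodTensor ξ (c • η)).coeFn_toLp, (memLp_prodTensor ξ η).coeFn_toLp,
        ae_snd (Lp.coeFn_smul c η), Lp.coeFn_smul c ((memLp_prodTensor ξ η).toLp _)]
        with p h1 h2 h3 h4
      rw [h1, h4, Pi.smul_apply, h2, h3]
      exact map_smul (tmulL K K _) _ _)

theorem prodTensor_coeFn (ξ η : OneP K) :
    prodTensor ξ η =ᵐ[volume] fun p : ℝ × ℝ => tmul (ξ p.1) (η p.2) :=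
  (memLp_prodTensor ξ η).coeFn_toLp

theorem inner_prodTensor (ξ η ξ' η' : OneP K) :
    inner ℂ (prodTensor ξ η) (prodTensor ξ' η') = inner ℂ ξ ξ' * inner ℂ η η' := by
  rw [L2.inner_def, L2.inner_def, L2.inner_def]
  have : ∫ p : ℝ × ℝ, inner ℂ (prodTensor ξ η p) (prodTensor ξ' η' p) =
      ∫ p : ℝ × ℝ, inner ℂ (ξ p.1) (ξ' p.1) * inner ℂ (η p.2) (η' p.2) := by
    refine integral_congr_ae ?_
    filter_upwards [prodTensor_coeFn ξ η, prodTensor_coeFn ξ' η'] with p h1 h2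
    rw [h1, h2, inner_tmul]
  rw [this]
  exact integral_prod_mul (fun x => inner ℂ (ξ x) (ξ' x)) (fun x => inner ℂ (η x) (η' x))

/-- The canonical map on the algebraic tensor product. -/
def algTwoP : OneP K ⊗[ℂ] OneP K →ₗᵢ[ℂ] TwoP K :=
  (TensorProduct.lift (prodTensor (K := K))).isometryOfInner fun x y => by
    induction x using TensorProduct.induction_on with
    | zero => simp
    | add a b ha hb => simp only [map_add, inner_add_left, ha, hb]
    | tmul a b =>
      induction y using TensorProduct.induction_on with
      | zero => simp
      | add c d hc hd => simp only [map_add, inner_add_right, hc, hd]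
      | tmul c d =>
        simp only [TensorProduct.lift.tmul, TensorProduct.inner_tmul]
        exact inner_prodTensor a b c d

/-- The canonical unitary identification `L²(ℝ → K) ⊗ L²(ℝ → K) ≅ L²(ℝ² → K ⊗ K)` which sends
`ξ ⊗ η` to the function `(θ₁, θ₂) ↦ ξ(θ₁) ⊗ η(θ₂)`. -/
def twoPMap (K : Type u) [NormedAddCommGroup K] [InnerProductSpace ℂ K] :
    HTensor (OneP K) (OneP K) →L[ℂ] TwoP K :=
  extendT algTwoP.toContinuousLinearMap

/-- A measurable field of bounded operators acts on measurable functions. -/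
theorem aestronglyMeasurable_field {X E : Type*} [MeasurableSpace X] {μ : Measure X}
    [NormedAddCommGroup E] [NormedSpace ℂ E] {S : X → E →L[ℂ] E}
    (hS : ∀ x, AEStronglyMeasurable (fun t => S t x) μ) {f : X → E}
    (hf : AEStronglyMeasurable f μ) : AEStronglyMeasurable (fun t => S t (f t)) μ := by
  have key : ∀ s : SimpleFunc X E, AEStronglyMeasurable (fun t => S t (s t)) μ := by
    intro s
    induction s using SimpleFunc.induction with
    | const c hs =>
      refine ((hS c).indicator hs).congr (Eventually.of_forall fun t => ?_)
      simp only [SimpleFunc.coe_piecewise, SimpleFunc.coe_const, Set.piecewise, Set.indicator,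
        Function.const_apply]
      split_ifs <;> simp
    | add h hf hg =>
      refine (hf.add hg).congr (Eventually.of_forall fun t => ?_)
      simp
  refine AEStronglyMeasurable.congr ?_
    (f := fun t => S t (hf.mk f t)) (hf.ae_eq_mk.mono fun t ht => by simp only [ht])
  refine aestronglyMeasurable_of_tendsto_ae atTop
    (fun n => key (hf.stronglyMeasurable_mk.approx n)) (Eventually.of_forall fun t => ?_)
  exact ((S t).continuous.tendsto _).comp (hf.stronglyMeasurable_mk.tendsto_approx t)

theorem memLp_field {R : ℝ → HTensor K K →L[ℂ] HTensor K K}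
    (hm : ∀ x, AEStronglyMeasurable (fun θ => R θ x) volume)
    (hu : ∀ᵐ θ : ℝ, R θ ∈ unitary (HTensor K K →L[ℂ] HTensor K K)) (Ψ : TwoP K) :
    MemLp (fun p : ℝ × ℝ => R (p.1 - p.2) (Ψ p)) 2 volume := by
  have hq : Measure.QuasiMeasurePreserving (fun p : ℝ × ℝ => p.1 - p.2)
      (volume : Measure (ℝ × ℝ)) volume := quasiMeasurePreserving_sub volume volume
  refine (Lp.memLp Ψ).of_le (aestronglyMeasurable_field
    (fun x => (hm x).comp_quasiMeasurePreserving hq) (Lp.aestronglyMeasurable Ψ)) ?_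
  filter_upwards [hq.ae hu] with p hp
  exact (ContinuousLinearMap.norm_map_of_mem_unitary hp (Ψ p)).le

/-- The operator `(M Ψ)(θ₁, θ₂) = R(θ₁ - θ₂) Ψ(θ₂, θ₁)` on `L²(ℝ² → K ⊗ K)`, for a measurable
field `R` of unitary operators. -/
def twistedFlip {R : ℝ → HTensor K K →L[ℂ] HTensor K K}
    (hm : ∀ x, AEStronglyMeasurable (fun θ => R θ x) volume)
    (hu : ∀ᵐ θ : ℝ, R θ ∈ unitary (HTensor K K →L[ℂ] HTensor K K)) : TwoP K →L[ℂ] TwoP K :=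
  LinearMap.mkContinuous
    { toFun := fun Ψ => (memLp_field hm hu Ψ).toLp _
      map_add' := fun Ψ Φ => by
        ext1
        filter_upwards [(memLp_field hm hu (Ψ + Φ)).coeFn_toLp, (memLp_field hm hu Ψ).coeFn_toLp,
          (memLp_field hm hu Φ).coeFn_toLp, Lp.coeFn_add Ψ Φ,
          Lp.coeFn_add ((memLp_field hm hu Ψ).toLp _) ((memLp_field hm hu Φ).toLp _)]
          with p h1 h2 h3 h4 h5
        rw [h1, h5, Pi.add_apply, h2, h3, h4, Pi.add_apply, map_add]
      map_smul' := fun c Ψ => by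
        ext1
        filter_upwards [(memLp_field hm hu (c • Ψ)).coeFn_toLp, (memLp_field hm hu Ψ).coeFn_toLp,
          Lp.coeFn_smul c Ψ, Lp.coeFn_smul c ((memLp_field hm hu Ψ).toLp _)]
          with p h1 h2 h3 h4
        rw [h1, RingHom.id_apply, h4, Pi.smul_apply, h2, h3, Pi.smul_apply, map_smul] }
    1 (fun Ψ => by
      rw [one_mul]
      refine Lp.norm_le_norm_of_ae_le ?_
      have hq : Measure.QuasiMeasurePreserving (fun p : ℝ × ℝ => p.1 - p.2)
        (volume : Measure (ℝ × ℝ)) volume := quasiMeasurePreserving_sub volume volume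
      filter_upwards [(memLp_field hm hu Ψ).coeFn_toLp, hq.ae hu] with p h1 hp
      refine (congrArg norm h1).le.trans ?_
      exact (ContinuousLinearMap.norm_map_of_mem_unitary hp (Ψ p)).le) ∘L
  (Lp.compMeasurePreservingₗᵢ ℂ Prod.swap
    (Measure.measurePreserving_swap (μ := (volume : Measure ℝ)) (ν := (volume : Measure ℝ)))
    ).toContinuousLinearMap

end OneParticle

section YangBaxter

variable {K : Type u} [NormedAddCommGroup K] [InnerProductSpace ℂ K]

/-- A conjugation: an antiunitary involution. -/
structure Conjugation (K : Type u) [NormedAddCommGroup K] [InnerProductSpace ℂ K] where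
  map : K →ₗᵢ⋆[ℂ] K
  involutive : ∀ x, map (map x) = x

variable [CompleteSpace K]

/-- An invariant Yang-Baxter function for the unitary representation `V` and the conjugation `Γ`.
It is an element of `L^∞(ℝ → B(K ⊗ K))` in the sense of strong measurability of
`θ ↦ R(θ) x` for all `x`; essential boundedness follows from unitarity. -/
structure YBFunction {G : Type v} [Group G] (V : G →* (K ≃ₗᵢ[ℂ] K)) (Γ : Conjugation K) where
  toFun : ℝ → (HTensor K K →L[ℂ] HTensor K K)
  measurable : ∀ x, AEStronglyMeasurable (fun θ => toFun θ x) volume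
  isUnitary : ∀ᵐ θ : ℝ, toFun θ ∈ unitary (HTensor K K →L[ℂ] HTensor K K)
  invariant : ∀ᵐ θ : ℝ, ∀ g : G,
    toFun θ ∘L mapT (V g).toContinuousLinearEquiv.toContinuousLinearMap
        (V g).toContinuousLinearEquiv.toContinuousLinearMap =
      mapT (V g).toContinuousLinearEquiv.toContinuousLinearMap
        (V g).toContinuousLinearEquiv.toContinuousLinearMap ∘L toFun θ
  tcp : ∀ᵐ θ : ℝ, ∀ x, mapConjT Γ.map Γ.map (flipT K K (toFun (-θ)
    (flipT K K (mapConjT Γ.map Γ.map x)))) = toFun θ x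
  yang_baxter : ∀ᵐ p : ℝ × ℝ,
    leftAmp K (toFun p.1) ∘L mapT (ContinuousLinearMap.id ℂ K) (toFun (p.1 + p.2)) ∘L
        leftAmp K (toFun p.2) =
      mapT (ContinuousLinearMap.id ℂ K) (toFun p.2) ∘L leftAmp K (toFun (p.1 + p.2)) ∘L
        mapT (ContinuousLinearMap.id ℂ K) (toFun p.1)
  inverse : ∀ᵐ θ : ℝ, toFun (-θ) * toFun θ = 1 ∧ toFun θ * toFun (-θ) = 1

variable {G : Type v} [Group G] {V : G →* (K ≃ₗᵢ[ℂ] K)} {Γ : Conjugation K}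

/-- The strip `0 < Im ζ < π`. -/
def strip : Set ℂ := {ζ | 0 < ζ.im ∧ ζ.im < Real.pi}

/-- Crossing symmetry: `R` is the boundary value, in the weak operator topology almost everywhere,
of a bounded analytic function `S` on the strip `0 < Im ζ < π`, whose boundary value `R(iπ - θ)` on
the upper edge satisfies
`⟪ξ ⊗ ψ, R(iπ - θ) (φ ⊗ ξ')⟫ = ⟪ψ ⊗ Γ ξ', R(θ) (Γ ξ ⊗ φ)⟫`. -/
def YBFunction.CrossingSymmetric (R : YBFunction V Γ) : Prop :=
  ∃ S : ℂ → (HTensor K K →L[ℂ] HTensor K K),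
    DifferentiableOn ℂ S strip ∧
    (∃ C : ℝ, ∀ ζ ∈ strip, ‖S ζ‖ ≤ C) ∧
    (∀ x y : HTensor K K, ∀ᵐ θ : ℝ,
      Tendsto (fun ε : ℝ => inner ℂ x (S (θ + ε * Complex.I) y)) (𝓝[>] 0)
        (𝓝 (inner ℂ x (R.toFun θ y)))) ∧
    (∀ ξ ψ φ ξ' : K, ∀ᵐ θ : ℝ,
      Tendsto (fun ε : ℝ =>
          inner ℂ (tmul ξ ψ) (S (Real.pi * Complex.I - θ - ε * Complex.I) (tmul φ ξ')))
        (𝓝[>] 0)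
        (𝓝 (inner ℂ (tmul ψ (Γ.map ξ')) (R.toFun θ (tmul (Γ.map ξ) φ)))))

/-- The operator on `L²(ℝ → K) ⊗ L²(ℝ → K) ≅ L²(ℝ² → K ⊗ K)` given by
`Ψ ↦ ((θ₁, θ₂) ↦ R(θ₁ - θ₂) Ψ(θ₂, θ₁))`. The adjoint of the unitary identification is its
inverse. -/
def YBFunction.op (R : YBFunction V Γ) :
    HTensor (OneP K) (OneP K) →L[ℂ] HTensor (OneP K) (OneP K) :=
  ContinuousLinearMap.adjoint (twoPMap K) ∘L twistedFlip R.measurable R.isUnitary ∘L twoPMap K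

/-- The conjugation `C ⊗ Γ` on `L²(ℝ → K)`: `(Θ ξ)(θ) = Γ (ξ(θ))`. -/
def oneTCP (Γ : Conjugation K) : OneP K →ₗᵢ⋆[ℂ] OneP K where
  toLinearMap := (Γ.map.toContinuousLinearMap.compLpL 2 volume).toLinearMap
  norm_map' ξ := by
    rw [Lp.norm_def, Lp.norm_def]
    congr 1
    refine eLpNorm_congr_norm_ae ?_
    filter_upwards [Γ.map.toContinuousLinearMap.coeFn_compLpL (p := 2) (μ := volume) ξ] with θ h
    rw [ContinuousLinearMap.coe_coe, h]
    simp

end YangBaxter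

section Field

/-- The functions `f^±(θ) = ± i e^θ ∫ e^{± i u e^θ} f(u) du`, for the sign `s = ± 1`. -/
def fpm (s : ℝ) (f : 𝓢(ℝ, ℂ)) (θ : ℝ) : ℂ :=
  s * Complex.I * Real.exp θ * ∫ u : ℝ, Complex.exp (s * Complex.I * u * Real.exp θ) * f u

theorem fpm_eq (s : ℝ) (f : 𝓢(ℝ, ℂ)) (θ : ℝ) : fpm s f θ =
    s * Complex.I * Real.exp θ * FourierTransform.fourier f (-(s * Real.exp θ) / (2 * Real.pi)) := by
  rw [fpm, SchwartzMap.fourier_coe, Real.fourier_real_eq_integral_exp_smul]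
  congr 2
  ext u
  rw [smul_eq_mul]
  congr 2
  push_cast
  have : (Real.pi : ℂ) ≠ 0 := by exact_mod_cast Real.pi_ne_zero
  field_simp

theorem memLp_fpm {s : ℝ} (hs : s = 1 ∨ s = -1) (f : 𝓢(ℝ, ℂ)) : MemLp (fpm s f) 2 volume := by
  obtain ⟨C, hC⟩ := (FourierTransform.fourier f : 𝓢(ℝ, ℂ)).decay' 0 0
  obtain ⟨D, hD⟩ := (FourierTransform.fourier f : 𝓢(ℝ, ℂ)).decay' 2 0
  have hs1 : |s| = 1 := by rcases hs with rfl | rfl <;> simp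
  have hcont : Continuous (fpm s f) := by
    have : fpm s f = fun θ => s * Complex.I * Real.exp θ *
        FourierTransform.fourier f (-(s * Real.exp θ) / (2 * Real.pi)) := funext (fpm_eq s f)
    rw [this]
    have := (FourierTransform.fourier f : 𝓢(ℝ, ℂ)).continuous
    fun_prop
  have hbound : ∀ θ, ‖fpm s f θ‖ ≤ (C + D * (2 * Real.pi) ^ 2) * Real.exp (-|θ|) := by
    intro θ
    rw [fpm_eq]
    set F := ‖(FourierTransform.fourier f : 𝓢(ℝ, ℂ)) (-(s * Real.exp θ) / (2 * Real.pi))‖ with hF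
    have h0 : F ≤ C := by
      have := hC (-(s * Real.exp θ) / (2 * Real.pi))
      rw [pow_zero, one_mul, norm_iteratedFDeriv_zero] at this
      exact this
    have h2 : (Real.exp θ / (2 * Real.pi)) ^ 2 * F ≤ D := by
      have := hD (-(s * Real.exp θ) / (2 * Real.pi))
      rw [norm_iteratedFDeriv_zero, Real.norm_eq_abs, abs_div, abs_neg, abs_mul, hs1,
        one_mul, Real.abs_exp, abs_of_pos Real.two_pi_pos] at this
      exact this
    have hF0 : 0 ≤ F := norm_nonneg _
    have hD0 : 0 ≤ D := le_trans (by positivity) h2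
    have hC0 : 0 ≤ C := hF0.trans h0
    have h2' : Real.exp θ ^ 2 * F ≤ D * (2 * Real.pi) ^ 2 := by
      have := mul_le_mul_of_nonneg_right h2 (sq_nonneg (2 * Real.pi))
      calc Real.exp θ ^ 2 * F = (Real.exp θ / (2 * Real.pi)) ^ 2 * F * (2 * Real.pi) ^ 2 := by
            field_simp
        _ ≤ _ := this
    have hn : ‖(s : ℂ) * Complex.I * Real.exp θ *
        (FourierTransform.fourier f : 𝓢(ℝ, ℂ)) (-(s * Real.exp θ) / (2 * Real.pi))‖ =
        Real.exp θ * F := by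
      rw [norm_mul, norm_mul, norm_mul, Complex.norm_I, Complex.norm_real, Complex.norm_real,
        Real.norm_eq_abs, hs1, Real.norm_eq_abs, Real.abs_exp, one_mul, one_mul]
    rw [hn]
    rcases le_total θ 0 with h | h
    · rw [abs_of_nonpos h, neg_neg, mul_comm]
      gcongr
      nlinarith [sq_nonneg (2 * Real.pi)]
    · rw [abs_of_nonneg h, Real.exp_neg, ← div_eq_mul_inv, le_div_iff₀ (Real.exp_pos θ)]
      nlinarith
  have hdec : MemLp (fun θ : ℝ => (C + D * (2 * Real.pi) ^ 2) * Real.exp (-|θ|)) 2 volume := by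
    refine MemLp.const_mul ?_ _
    have hc : Continuous fun θ : ℝ => Real.exp (-|θ|) := by fun_prop
    rw [memLp_two_iff_integrable_sq hc.aestronglyMeasurable]
    refine integrable_inv_one_add_sq.mono' (hc.pow 2).aestronglyMeasurable
      (Eventually.of_forall fun θ => ?_)
    rw [Real.norm_eq_abs, abs_of_nonneg (by positivity), ← Real.exp_nat_mul, mul_neg, Real.exp_neg]
    gcongr
    have := Real.quadratic_le_exp_of_nonneg (x := ((2 : ℕ) : ℝ) * |θ|) (by positivity)
    push_cast at this ⊢
    nlinarith [abs_nonneg θ, sq_abs θ]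
  exact hdec.of_le hcont.aestronglyMeasurable (Eventually.of_forall fun θ =>
    (hbound θ).trans (le_abs_self _))

/-- `f^+` as an element of `L²(ℝ)`. -/
def fPlus (f : 𝓢(ℝ, ℂ)) : Lp ℂ 2 (volume : Measure ℝ) := (memLp_fpm (Or.inl rfl) f).toLp

/-- `f^-` as an element of `L²(ℝ)`. -/
def fMinus (f : 𝓢(ℝ, ℂ)) : Lp ℂ 2 (volume : Measure ℝ) := (memLp_fpm (Or.inr rfl) f).toLp

/-- The reflected conjugate test function `u ↦ conj (f (-u))`. -/
def tcpTest (f : 𝓢(ℝ, ℂ)) : 𝓢(ℝ, ℂ) :=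
  SchwartzMap.postcompCLM (𝕜 := ℝ) (Complex.conjCLE : ℂ →L[ℝ] ℂ)
    (SchwartzMap.compCLMOfContinuousLinearEquiv ℝ (ContinuousLinearEquiv.neg ℝ) f)

theorem tcpTest_apply (f : 𝓢(ℝ, ℂ)) (u : ℝ) : tcpTest f u = conj (f (-u)) := rfl

variable {K : Type u} [NormedAddCommGroup K] [InnerProductSpace ℂ K] [CompleteSpace K]

/-- The one-particle vector `h ⊗ k`, that is `θ ↦ h(θ) k`. -/
def tensorVec (h : Lp ℂ 2 (volume : Measure ℝ)) (k : K) : OneP K :=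
  (ContinuousLinearMap.toSpanSingleton ℂ k).compLp h

variable {G : Type v} [Group G] {V : G →* (K ≃ₗᵢ[ℂ] K)} {Γ : Conjugation K}

/-- The field operator `φ_{R,k}(f) = z†(f^+ ⊗ k) + z(conj f^- ⊗ Γ k)` on vectors of finite particle
number in the Fock space of the operator `R.op`. -/
def field (R : YBFunction V Γ) (k : K) (f : 𝓢(ℝ, ℂ)) : finPart R.op →ₗ[ℂ] finPart R.op :=
  create R.op (tensorVec (fPlus f) k) + annihilate R.op (tensorVec (star (fMinus f)) (Γ.map k))

/-- The TCP operator `Θ` of the Fock space, on vectors of finite particle number. -/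
def tcpOp (R : YBFunction V Γ) : finPart R.op →ₗ⋆[ℂ] finPart R.op :=
  secondQuantConj R.op (oneTCP Γ)

/-- The TCP conjugate field `φ'_{R,k}(f) = Θ φ_{R,Γk}(u ↦ conj (f (-u))) Θ`, on vectors of finite
particle number. -/
def tcpField (R : YBFunction V Γ) (k : K) (f : 𝓢(ℝ, ℂ)) : finPart R.op →ₗ[ℂ] finPart R.op :=
  (tcpOp R).comp ((field R (Γ.map k) (tcpTest f)).comp (tcpOp R))

end Field

end YangBaxterQFT

end

/-!
The conjugate field `φ' = Θ φ Θ` creates and annihilates particles at the right end of a tensor,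
while `φ` does so at the left end. Hence the two kinds of creation operators commute, and so do the
two kinds of annihilation operators. By the braid relation, each of the two mixed commutators of a
creation with an annihilation operator is, on `n` particles, an exchange operator: a partial inner
product of the braiding that moves one particle past `n` others. On tensors of functions its matrix
elements are integrals over the rapidity `θ` of the new particle, in which the function
`f⁺ g⁻` or `f⁻ g⁺` of `θ` multiplies a product of `n` factors `R`.

Crossing symmetry says that the products of `R` occurring in the two commutators are the two
boundary values of one bounded analytic function on the strip `0 < im θ < π`. Since every point of
the support of `f` lies to the left of every point of the support of `g`, the test function factor
also continues to the strip and decays there, `f⁺` turning into `f⁻` and `g⁻` into `g⁺` under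
`θ ↦ θ + iπ`. Shifting the contour from the lower to the upper edge therefore turns one commutator
into the negative of the other.
-/

noncomputable section

namespace YangBaxterQFT

section TensorProducts

variable {E F G E' F' : Type*}
  [NormedAddCommGroup E] [InnerProductSpace ℂ E] [NormedAddCommGroup F] [InnerProductSpace ℂ F]
  [NormedAddCommGroup G] [InnerProductSpace ℂ G]
  [NormedAddCommGroup E'] [InnerProductSpace ℂ E'] [NormedAddCommGroup F'] [InnerProductSpace ℂ F']

theorem tmulL_apply (x : E) (y : F) : tmulL E F x y = tmul x y := rfl

theorem add_tmul (x x' : E) (y : F) : tmul (x + x') y = tmul x y + tmul x' y :=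
  (tmulL E F).map_add₂ x x' y

theorem tmul_add (x : E) (y y' : F) : tmul x (y + y') = tmul x y + tmul x y' :=
  map_add (tmulL E F x) y y'

theorem smul_tmul (c : ℂ) (x : E) (y : F) : tmul (c • x) y = c • tmul x y :=
  (tmulL E F).map_smul₂ c x y

theorem tmul_smul (c : ℂ) (x : E) (y : F) : tmul x (c • y) = c • tmul x y :=
  map_smul (tmulL E F x) c y

theorem inner_tmul_tmul (x x' : E) (y y' : F) :
    inner ℂ (tmul x y) (tmul x' y') = inner ℂ x x' * inner ℂ y y' := by
  rw [tmul, tmul, LinearIsometry.inner_map_map, TensorProduct.inner_tmul]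

theorem norm_tmul_eq_mul (x : E) (y : F) : ‖tmul x y‖ = ‖x‖ * ‖y‖ := by
  rw [tmul, LinearIsometry.norm_map, TensorProduct.norm_tmul]

theorem HTensor.induction_on {p : HTensor E F → Prop} (z : HTensor E F)
    (isClosed : IsClosed {x | p x}) (add : ∀ x y, p x → p y → p (x + y))
    (tmul : ∀ x y, p (tmul x y)) : p z := by
  refine (denseRange_ofAlg E F).induction_on z isClosed fun a => ?_
  induction a using TensorProduct.induction_on with
  | zero =>
    rw [map_zero, ← map_zero (tmulL E F 0)]
    exact tmul 0 0
  | add a b ha hb => rw [map_add]; exact add _ _ ha hb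
  | tmul a b => exact tmul a b

theorem HTensor.clm_ext {W : Type*} [NormedAddCommGroup W] [NormedSpace ℂ W] {σ : ℂ →+* ℂ}
    {A B : HTensor E F →SL[σ] W} (h : ∀ x y, A (tmul x y) = B (tmul x y)) : A = B :=
  ContinuousLinearMap.ext fun z => HTensor.induction_on z (isClosed_eq A.continuous B.continuous)
    (fun x y hx hy => by rw [map_add, map_add, hx, hy]) h

theorem mapT_comp_mapT {E'' F'' : Type*} [NormedAddCommGroup E''] [InnerProductSpace ℂ E'']
    [NormedAddCommGroup F''] [InnerProductSpace ℂ F''] (A : E →L[ℂ] E') (B : F →L[ℂ] F')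
    (A' : E' →L[ℂ] E'') (B' : F' →L[ℂ] F'') :
    mapT A' B' ∘L mapT A B = mapT (A' ∘L A) (B' ∘L B) :=
  HTensor.clm_ext fun x y => by simp [mapT_tmul]

theorem mapT_id_id : mapT (ContinuousLinearMap.id ℂ E) (ContinuousLinearMap.id ℂ F) =
    ContinuousLinearMap.id ℂ (HTensor E F) :=
  HTensor.clm_ext fun x y => by simp [mapT_tmul]

theorem adjoint_mapT [CompleteSpace E] [CompleteSpace F] [CompleteSpace E'] [CompleteSpace F']
    (A : E →L[ℂ] E') (B : F →L[ℂ] F') :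
    ContinuousLinearMap.adjoint (mapT A B) =
      mapT (ContinuousLinearMap.adjoint A) (ContinuousLinearMap.adjoint B) := by
  refine HTensor.clm_ext fun x y => ext_inner_right ℂ fun v => ?_
  rw [ContinuousLinearMap.adjoint_inner_left]
  induction v using HTensor.induction_on with
  | isClosed => exact isClosed_eq (by fun_prop) (by fun_prop)
  | add a b ha hb => simp only [map_add, inner_add_right, ha, hb]
  | tmul a b => simp only [mapT_tmul, inner_tmul_tmul, ContinuousLinearMap.adjoint_inner_left]

theorem assocT_symm_tmul (x : E) (y : F) (z : G) :
    (assocT E F G).symm (tmul x (tmul y z)) = tmul (tmul x y) z := by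
  rw [← assocT_tmul, LinearIsometryEquiv.symm_apply_apply]

theorem leftAmp_assocT_tmul (T : HTensor E E →L[ℂ] HTensor E E) (w : HTensor E E) (z : G) :
    leftAmp G T (assocT E E G (tmul w z)) = assocT E E G (tmul (T w) z) := by
  simp [leftAmp, mapT_tmul]

theorem adjoint_leftAmp [CompleteSpace G] (T : HTensor E E →L[ℂ] HTensor E E) :
    ContinuousLinearMap.adjoint (leftAmp G T) = leftAmp G (ContinuousLinearMap.adjoint T) := by
  rw [leftAmp, ContinuousLinearMap.adjoint_comp, ContinuousLinearMap.adjoint_comp, adjoint_mapT,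
    ContinuousLinearMap.adjoint_id, ContinuousLinearMap.comp_assoc]
  exact congr($((assocT E E G).symm.adjoint_eq_symm) ∘L _ ∘L $((assocT E E G).adjoint_eq_symm))

end TensorProducts

section Legs

variable {H : Type u} [NormedAddCommGroup H] [InnerProductSpace ℂ H]

/-- The left creation map `x ↦ a ⊗ x` of the full Fock space. -/
def consOp (a : H) (n : ℕ) : Pow H n →L[ℂ] Pow H (n + 1) :=
  (powCons H n).toContinuousLinearEquiv.toContinuousLinearMap ∘L tmulL H (Pow H n) a

/-- The right creation map `x ↦ x ⊗ a` of the full Fock space. -/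
def snocOp (a : H) (n : ℕ) : Pow H n →L[ℂ] Pow H (n + 1) :=
  powSnoc H n ∘L (tmulL (Pow H n) H).flip a

/-- The left annihilation map of the full Fock space, the adjoint of `x ↦ a ⊗ x`. -/
def unconsOp (a : H) (n : ℕ) : Pow H (n + 1) →L[ℂ] Pow H n :=
  ContinuousLinearMap.adjoint (consOp a n)

/-- The right annihilation map of the full Fock space, the adjoint of `x ↦ x ⊗ a`. -/
def unsnocOp (a : H) (n : ℕ) : Pow H (n + 1) →L[ℂ] Pow H n :=
  ContinuousLinearMap.adjoint (snocOp a n)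

/-- The map `x ↦ w ⊗ x` for a two-particle vector `w`. -/
def consTwo (n : ℕ) : HTensor H H →L[ℂ] Pow H n →L[ℂ] Pow H (n + 2) :=
  ContinuousLinearMap.compL ℂ _ _ _ ((assocT H H (Pow H n)).trans
    (powCons H (n + 1))).toContinuousLinearEquiv.toContinuousLinearMap ∘L
      tmulL (HTensor H H) (Pow H n)

/-- The map `z ↦ z ⊗ x` for three-particle vectors `z`. -/
def consThree (n : ℕ) (x : Pow H n) : HTensor H (HTensor H H) →L[ℂ] Pow H (n + 3) :=
  (powCons H (n + 2)).toContinuousLinearEquiv.toContinuousLinearMap ∘L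
    mapT (ContinuousLinearMap.id ℂ H) ((consTwo n).flip x)

theorem consOp_apply (a : H) (n : ℕ) (x : Pow H n) : consOp a n x = powCons H n (tmul a x) := rfl

theorem snocOp_apply (a : H) (n : ℕ) (x : Pow H n) : snocOp a n x = powSnoc H n (tmul x a) := rfl

theorem consTwo_apply (n : ℕ) (w : HTensor H H) (x : Pow H n) :
    consTwo n w x = powCons H (n + 1) (assocT H H (Pow H n) (tmul w x)) := rfl

theorem consTwo_tmul (n : ℕ) (a b : H) (x : Pow H n) :
    consTwo n (tmul a b) x = consOp a (n + 1) (consOp b n x) := by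
  rw [consTwo_apply, assocT_tmul]; rfl

theorem consThree_tmul (n : ℕ) (x : Pow H n) (a : H) (w : HTensor H H) :
    consThree n x (tmul a w) = consOp a (n + 2) (consTwo n w x) := by
  simp [consThree, mapT_tmul, consOp_apply]

theorem consThree_assocT_tmul (n : ℕ) (x : Pow H n) (w : HTensor H H) (c : H) :
    consThree n x (assocT H H H (tmul w c)) = consTwo (n + 1) w (consOp c n x) := by
  have h : consThree n x ∘L
      (assocT H H H).toContinuousLinearEquiv.toContinuousLinearMap ∘L (tmulL _ H).flip c =
        (consTwo (n + 1)).flip (consOp c n x) :=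
    HTensor.clm_ext fun a b => by simp [tmulL_apply, assocT_tmul, consThree_tmul, consTwo_tmul]
  exact congr($h w)

theorem Pow.induction_cons {n : ℕ} {p : Pow H (n + 1) → Prop} (z : Pow H (n + 1))
    (isClosed : IsClosed {x | p x}) (add : ∀ x y, p x → p y → p (x + y))
    (cons : ∀ a x, p (consOp a n x)) : p z :=
  HTensor.induction_on (E := H) (F := Pow H n) z isClosed add cons

section Ext

variable {W : Type*} [NormedAddCommGroup W] [NormedSpace ℂ W] {σ : ℂ →+* ℂ} {n : ℕ}

theorem Pow.clm_ext {A B : Pow H (n + 1) →SL[σ] W}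
    (h : ∀ a x, A (consOp a n x) = B (consOp a n x)) : A = B :=
  HTensor.clm_ext (E := H) (F := Pow H n) h

theorem Pow.clm_ext_consTwo {A B : Pow H (n + 2) →SL[σ] W}
    (h : ∀ w x, A (consTwo n w x) = B (consTwo n w x)) : A = B :=
  Pow.clm_ext fun a y => by
    induction y using Pow.induction_cons with
    | isClosed => exact isClosed_eq (by fun_prop) (by fun_prop)
    | add x y hx hy => simp only [map_add, hx, hy]
    | cons b x => rw [← consTwo_tmul, h]

theorem Pow.clm_ext_consThree {A B : Pow H (n + 3) →SL[σ] W}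
    (h : ∀ x z, A (consThree n x z) = B (consThree n x z)) : A = B :=
  Pow.clm_ext_consTwo fun w y => by
    induction y using Pow.induction_cons with
    | isClosed => exact isClosed_eq (by fun_prop) (by fun_prop)
    | add x y hx hy => simp only [map_add, hx, hy]
    | cons c x => rw [← consThree_assocT_tmul, h]

end Ext

theorem snocOp_zero (a : H) : snocOp a 0 = consOp a 0 := by
  ext x
  simp [snocOp_apply, powSnoc, flipT_tmul, consOp_apply]

theorem snocOp_consOp (a b : H) (n : ℕ) (x : Pow H n) :
    snocOp b (n + 1) (consOp a n x) = consOp a (n + 1) (snocOp b n x) := by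
  rw [snocOp_apply, powSnoc, consOp_apply, consOp_apply]
  simp [mapT_tmul, assocT_tmul, snocOp_apply]

theorem snocOp_consTwo (n : ℕ) (b : H) (w : HTensor H H) (x : Pow H n) :
    snocOp b (n + 2) (consTwo n w x) = consTwo (n + 1) w (snocOp b n x) := by
  have h : snocOp b (n + 2) ∘L (consTwo n).flip x = (consTwo (n + 1)).flip (snocOp b n x) :=
    HTensor.clm_ext fun a c => by simp [consTwo_tmul, snocOp_consOp]
  exact congr($h w)

theorem inner_consOp_consOp (n : ℕ) (a b : H) (x y : Pow H n) :
    inner ℂ (consOp a n x) (consOp b n y) = inner ℂ a b * inner ℂ x y := by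
  rw [consOp_apply, consOp_apply, LinearIsometryEquiv.inner_map_map, inner_tmul_tmul]

theorem unconsOp_consOp (a b : H) (n : ℕ) (x : Pow H n) :
    unconsOp a n (consOp b n x) = inner ℂ a b • x := by
  refine ext_inner_left ℂ fun y => ?_
  rw [unconsOp, ContinuousLinearMap.adjoint_inner_right, inner_consOp_consOp, inner_smul_right]

theorem unconsOp_snocOp (a b : H) (n : ℕ) (x : Pow H (n + 1)) :
    unconsOp a (n + 1) (snocOp b (n + 1) x) = snocOp b n (unconsOp a n x) := by
  have h : unconsOp a (n + 1) ∘L snocOp b (n + 1) = snocOp b n ∘L unconsOp a n :=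
    Pow.clm_ext fun c x => by simp [snocOp_consOp, unconsOp_consOp]
  exact congr($h x)

theorem unsnocOp_consOp (a b : H) (n : ℕ) (x : Pow H (n + 1)) :
    unsnocOp a (n + 1) (consOp b (n + 1) x) = consOp b n (unsnocOp a n x) := by
  refine ext_inner_right ℂ fun y => ?_
  rw [unsnocOp, unsnocOp, ContinuousLinearMap.adjoint_inner_left,
    ← ContinuousLinearMap.adjoint_inner_right, ← unconsOp, unconsOp_snocOp,
    ← ContinuousLinearMap.adjoint_inner_right (consOp b n), ← unconsOp,
    ContinuousLinearMap.adjoint_inner_left]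

theorem unsnocOp_snocOp (a b : H) (n : ℕ) (x : Pow H n) :
    unsnocOp a n (snocOp b n x) = inner ℂ a b • x := by
  suffices unsnocOp a n ∘L snocOp b n = inner ℂ a b • ContinuousLinearMap.id ℂ (Pow H n) from
    congr($this x)
  induction n with
  | zero =>
    ext x
    rw [unsnocOp, snocOp_zero, snocOp_zero, ← unconsOp]
    simp [unconsOp_consOp]
  | succ n ih =>
    refine Pow.clm_ext fun c x => ?_
    have ihx : unsnocOp a n (snocOp b n x) = inner ℂ a b • x := congr($(ih x) x)
    simp [snocOp_consOp, unsnocOp_consOp, ihx]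

theorem unsnocOp_unconsOp (a b : H) (n : ℕ) (x : Pow H (n + 2)) :
    unsnocOp b n (unconsOp a (n + 1) x) = unconsOp a n (unsnocOp b (n + 1) x) := by
  refine ext_inner_right ℂ fun y => ?_
  simp only [unsnocOp, unconsOp, ContinuousLinearMap.adjoint_inner_left, snocOp_consOp]

variable (T : HTensor H H →L[ℂ] HTensor H H)

theorem leg_of_le {n j : ℕ} (h : n ≤ j + 1) : leg T n j = 1 := by
  induction n generalizing j with
  | zero => rfl
  | succ n ih =>
    match n, j with
    | 0, _ => rfl
    | n + 1, j + 1 =>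
      rw [leg, ih (by omega), ContinuousLinearMap.one_def, mapT_id_id]
      ext x
      simp

theorem leg_zero_consTwo (n : ℕ) (w : HTensor H H) (x : Pow H n) :
    leg T (n + 2) 0 (consTwo n w x) = consTwo n (T w) x :=
  congrArg (powCons H (n + 1)) (leftAmp_assocT_tmul T w x)

theorem leg_succ_consOp (n j : ℕ) (a : H) (x : Pow H n) :
    leg T (n + 1) (j + 1) (consOp a n x) = consOp a n (leg T n j x) := by
  cases n with
  | zero => rfl
  | succ n =>
    rw [consOp_apply, consOp_apply, leg]
    simp [mapT_tmul]

theorem leg_add_two_consTwo (n j : ℕ) (w : HTensor H H) (x : Pow H n) :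
    leg T (n + 2) (j + 2) (consTwo n w x) = consTwo n w (leg T n j x) := by
  have h : leg T (n + 2) (j + 2) ∘L (consTwo n).flip x = (consTwo n).flip (leg T n j x) :=
    HTensor.clm_ext fun a b => by simp [consTwo_tmul, leg_succ_consOp]
  exact congr($h w)

theorem leg_zero_consThree (n : ℕ) (x : Pow H n) (z : HTensor H (HTensor H H)) :
    leg T (n + 3) 0 (consThree n x z) = consThree n x (leftAmp H T z) := by
  obtain ⟨z, rfl⟩ := (assocT H H H).surjective z
  induction z using HTensor.induction_on with
  | isClosed => exact isClosed_eq (by fun_prop) (by fun_prop)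
  | add w w' h h' => simp only [map_add, h, h']
  | tmul w c =>
    rw [consThree_assocT_tmul, leg_zero_consTwo, leftAmp_assocT_tmul, consThree_assocT_tmul]

theorem leg_one_consThree (n : ℕ) (x : Pow H n) (z : HTensor H (HTensor H H)) :
    leg T (n + 3) 1 (consThree n x z) =
      consThree n x (mapT (ContinuousLinearMap.id ℂ H) T z) := by
  induction z using HTensor.induction_on with
  | isClosed => exact isClosed_eq (by fun_prop) (by fun_prop)
  | add w w' h h' => simp only [map_add, h, h']
  | tmul a w =>
    rw [consThree_tmul, mapT_tmul, consThree_tmul, leg_succ_consOp, leg_zero_consTwo,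
      ContinuousLinearMap.id_apply]

theorem leg_snocOp {n j : ℕ} (h : j + 1 < n) (b : H) (x : Pow H n) :
    leg T (n + 1) j (snocOp b n x) = snocOp b n (leg T n j x) := by
  suffices leg T (n + 1) j ∘L snocOp b n = snocOp b n ∘L leg T n j from congr($this x)
  induction n generalizing j with
  | zero => omega
  | succ n ih =>
    match n, j with
    | n + 1, 0 => exact Pow.clm_ext_consTwo fun w x => by simp [leg_zero_consTwo, snocOp_consTwo]
    | n, j + 1 =>
      refine Pow.clm_ext fun a x => ?_
      have ihx : leg T (n + 1) j (snocOp b n x) = snocOp b n (leg T n j x) :=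
        congr($(ih (by omega : j + 1 < n) x) x)
      simp [leg_succ_consOp, snocOp_consOp, ihx]

theorem commute_leg {n i j : ℕ} (h : i + 2 ≤ j) : Commute (leg T n i) (leg T n j) := by
  induction n generalizing i j with
  | zero => rw [leg_of_le T (Nat.zero_le _)]; exact Commute.one_left _
  | succ n ih =>
    match n, i, j with
    | 0, i, _ => rw [leg_of_le T (Nat.le_add_left 1 i)]; exact Commute.one_left _
    | n + 1, 0, j + 2 =>
      exact Pow.clm_ext_consTwo fun w x => by simp [leg_zero_consTwo, leg_add_two_consTwo]
    | n + 1, i + 1, j + 1 =>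
      refine Pow.clm_ext fun a x => ?_
      have ihx : leg T (n + 1) i (leg T (n + 1) j x) = leg T (n + 1) j (leg T (n + 1) i x) :=
        congr($(ih (by omega : i + 2 ≤ j)) x)
      simp [leg_succ_consOp, ihx]

theorem adjoint_leg [CompleteSpace H] (n j : ℕ) :
    ContinuousLinearMap.adjoint (leg T n j) = leg (ContinuousLinearMap.adjoint T) n j := by
  induction n generalizing j with
  | zero => exact ContinuousLinearMap.adjoint_id
  | succ n ih =>
    match n, j with
    | 0, _ => exact ContinuousLinearMap.adjoint_id
    | n + 1, 0 => exact adjoint_leftAmp (G := Pow H n) T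
    | n + 1, j + 1 =>
      refine (adjoint_mapT (ContinuousLinearMap.id ℂ H) (leg T (n + 1) j)).trans ?_
      rw [ih, ContinuousLinearMap.adjoint_id]
      rfl

theorem unconsOp_leg_succ [CompleteSpace H] (n j : ℕ) (a : H) (x : Pow H (n + 1)) :
    unconsOp a n (leg T (n + 1) (j + 1) x) = leg T n j (unconsOp a n x) := by
  have hleg (m i) : leg T m i = ContinuousLinearMap.adjoint (leg T.adjoint m i) := by
    rw [adjoint_leg, ContinuousLinearMap.adjoint_adjoint]
  refine ext_inner_right ℂ fun y => ?_
  simp only [unconsOp, hleg, ContinuousLinearMap.adjoint_inner_left, leg_succ_consOp]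

theorem unsnocOp_leg [CompleteSpace H] {n j : ℕ} (h : j + 1 < n) (a : H) (x : Pow H (n + 1)) :
    unsnocOp a n (leg T (n + 1) j x) = leg T n j (unsnocOp a n x) := by
  have hleg (m i) : leg T m i = ContinuousLinearMap.adjoint (leg T.adjoint m i) := by
    rw [adjoint_leg, ContinuousLinearMap.adjoint_adjoint]
  refine ext_inner_right ℂ fun y => ?_
  simp only [unsnocOp, hleg, ContinuousLinearMap.adjoint_inner_left, leg_snocOp _ h]

variable {T}

theorem inner_leg [CompleteSpace H] (hT : IsSelfAdjoint T) (n j : ℕ) (x y : Pow H n) :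
    inner ℂ (leg T n j x) y = inner ℂ x (leg T n j y) := by
  rw [← ContinuousLinearMap.adjoint_inner_left, adjoint_leg, hT.adjoint_eq]

theorem leg_mul_self (hT : T * T = 1) (n j : ℕ) : leg T n j * leg T n j = 1 := by
  induction n generalizing j with
  | zero => rfl
  | succ n ih =>
    match n, j with
    | 0, _ => rfl
    | n + 1, 0 =>
      have hTw (w) : T (T w) = w := congr($hT w)
      exact Pow.clm_ext_consTwo fun w x => by simp [leg_zero_consTwo, hTw]
    | n + 1, j + 1 =>
      refine Pow.clm_ext fun a x => ?_
      have ihx : leg T (n + 1) j (leg T (n + 1) j x) = x := congr($(ih j) x)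
      simp [leg_succ_consOp, ihx]

/-- The braid relation `T₁₂ T₂₃ T₁₂ = T₂₃ T₁₂ T₂₃` on `H ⊗ (H ⊗ H)`, the Yang-Baxter equation for
operators. -/
def Braided (T : HTensor H H →L[ℂ] HTensor H H) : Prop :=
  leftAmp H T ∘L mapT (ContinuousLinearMap.id ℂ H) T ∘L leftAmp H T =
    mapT (ContinuousLinearMap.id ℂ H) T ∘L leftAmp H T ∘L mapT (ContinuousLinearMap.id ℂ H) T

theorem Braided.leg_mul_leg_mul_leg (hT : Braided T) {n j : ℕ} (h : j + 2 < n) :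
    leg T n j * leg T n (j + 1) * leg T n j =
      leg T n (j + 1) * leg T n j * leg T n (j + 1) := by
  induction n generalizing j with
  | zero => omega
  | succ n ih =>
    match n, j with
    | n + 2, 0 =>
      refine Pow.clm_ext_consThree fun x z => ?_
      simp only [mul_apply_eq_comp, zero_add, leg_zero_consThree, leg_one_consThree]
      exact congr(consThree n x ($hT z))
    | n, j + 1 =>
      refine Pow.clm_ext fun a x => ?_
      have ihx : leg T n j (leg T n (j + 1) (leg T n j x)) =
          leg T n (j + 1) (leg T n j (leg T n (j + 1) x)) := congr($(ih (by omega)) x)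
      simp only [mul_apply_eq_comp, leg_succ_consOp, ihx]

end Legs

section Reversal

variable {H : Type u} [NormedAddCommGroup H] [InnerProductSpace ℂ H] (J : H →ₗᵢ⋆[ℂ] H)

/-- The antilinear map `x₁ ⊗ ⋯ ⊗ xₙ ↦ J xₙ ⊗ ⋯ ⊗ J x₁`. -/
def revConj (n : ℕ) : Pow H n →L⋆[ℂ] Pow H n :=
  (powConj J n).toContinuousLinearMap.comp (powRev H n)

theorem powRev_consOp (n : ℕ) (a : H) (x : Pow H n) :
    powRev H (n + 1) (consOp a n x) = snocOp a n (powRev H n x) := by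
  rw [powRev, consOp_apply, snocOp_apply]
  simp [flipT_tmul, mapT_tmul]

theorem powConj_consOp (n : ℕ) (a : H) (x : Pow H n) :
    powConj J (n + 1) (consOp a n x) = consOp (J a) n (powConj J n x) := by
  rw [powConj, consOp_apply, consOp_apply]
  simp [mapConjT_tmul]

theorem powConj_snocOp (n : ℕ) (a : H) (x : Pow H n) :
    powConj J (n + 1) (snocOp a n x) = snocOp (J a) n (powConj J n x) := by
  suffices (powConj J (n + 1)).toContinuousLinearMap.comp (snocOp a n) =
      (snocOp (J a) n).comp (powConj J n).toContinuousLinearMap from congr($this x)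
  induction n with
  | zero => ext x; simp [snocOp_zero, powConj_consOp]
  | succ n ih =>
    refine Pow.clm_ext fun c x => ?_
    have ihx : powConj J (n + 1) (snocOp a n x) = snocOp (J a) n (powConj J n x) :=
      congr($(ih x) x)
    simp [snocOp_consOp, powConj_consOp, ihx]

theorem revConj_consOp (n : ℕ) (a : H) (x : Pow H n) :
    revConj J (n + 1) (consOp a n x) = snocOp (J a) n (revConj J n x) := by
  simp [revConj, powRev_consOp, powConj_snocOp]

theorem revConj_snocOp (n : ℕ) (a : H) (x : Pow H n) :
    revConj J (n + 1) (snocOp a n x) = consOp (J a) n (revConj J n x) := by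
  suffices (revConj J (n + 1)).comp (snocOp a n) = (consOp (J a) n).comp (revConj J n) from
    congr($this x)
  induction n with
  | zero => ext x; simp [snocOp_zero, revConj_consOp]
  | succ n ih =>
    refine Pow.clm_ext fun c x => ?_
    have ihx : revConj J (n + 1) (snocOp a n x) = consOp (J a) n (revConj J n x) :=
      congr($(ih x) x)
    simp [snocOp_consOp, revConj_consOp, ihx]

theorem unsnocOp_revConj (n : ℕ) (a : H) (x : Pow H (n + 1)) :
    unsnocOp (J a) n (revConj J (n + 1) x) = revConj J n (unconsOp a n x) := by
  have h : (unsnocOp (J a) n).comp (revConj J (n + 1)) = (revConj J n).comp (unconsOp a n) :=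
    Pow.clm_ext fun b x => by
      simp [revConj_consOp, unsnocOp_snocOp, unconsOp_consOp, inner_conj_conj]
  exact congr($h x)

theorem inner_revConj_revConj (n : ℕ) (x y : Pow H n) :
    inner ℂ (revConj J n x) (revConj J n y) = inner ℂ y x := by
  induction n with
  | zero => exact inner_conj_conj (powConj J 0) x y
  | succ n ih =>
    induction x using Pow.induction_cons with
    | isClosed => exact isClosed_eq (by fun_prop) (by fun_prop)
    | add x x' hx hx' => simp only [map_add, inner_add_left, inner_add_right, hx, hx']
    | cons c x =>
      rw [revConj_consOp, ← ContinuousLinearMap.adjoint_inner_right, ← unsnocOp, unsnocOp_revConj,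
        ih, unconsOp, ContinuousLinearMap.adjoint_inner_left]

variable {J}

theorem revConj_involutive (hJ : Function.Involutive J) (n : ℕ) :
    Function.Involutive (revConj J n) := by
  suffices (revConj J n).comp (revConj J n) = ContinuousLinearMap.id ℂ (Pow H n) from
    fun x => congr($this x)
  induction n with
  | zero =>
    ext x
    change powZero H (euclConj (euclConj ((powZero H).symm x))) = x
    have hconj (y) : euclConj.{u} (euclConj y) = y := by ext i; simp [euclConj]
    rw [hconj, LinearIsometryEquiv.apply_symm_apply]
  | succ n ih =>
    refine Pow.clm_ext fun c x => ?_
    have ihx : revConj J n (revConj J n x) = x := congr($ih x)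
    simp [revConj_consOp, revConj_snocOp, ihx, hJ c]

/-- The map `w ↦ x ⊗ w` that appends a two-particle vector. -/
def snocTwo (n : ℕ) : Pow H n →L[ℂ] HTensor H H →L[ℂ] Pow H (n + 2) :=
  ContinuousLinearMap.compL ℂ _ _ _ (powSnoc H (n + 1) ∘L
    mapT (powSnoc H n) (ContinuousLinearMap.id ℂ H) ∘L
    (assocT (Pow H n) H H).symm.toContinuousLinearEquiv.toContinuousLinearMap) ∘L
      tmulL (Pow H n) (HTensor H H)

theorem snocTwo_tmul (n : ℕ) (x : Pow H n) (a b : H) :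
    snocTwo n x (tmul a b) = snocOp b (n + 1) (snocOp a n x) := by
  simp [snocTwo, tmulL_apply, assocT_symm_tmul, mapT_tmul, snocOp_apply]

theorem snocTwo_zero (x : Pow H 0) : snocTwo 0 x = (consTwo 0).flip x :=
  HTensor.clm_ext fun a b => by simp [snocTwo_tmul, consTwo_tmul, snocOp_zero, snocOp_consOp]

theorem snocTwo_consOp (n : ℕ) (c : H) (x : Pow H n) :
    snocTwo (n + 1) (consOp c n x) = consOp c (n + 2) ∘L snocTwo n x :=
  HTensor.clm_ext fun a b => by simp [snocTwo_tmul, snocOp_consOp]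

theorem leg_snocTwo (T : HTensor H H →L[ℂ] HTensor H H) (n : ℕ) (x : Pow H n) (w : HTensor H H) :
    leg T (n + 2) n (snocTwo n x w) = snocTwo n x (T w) := by
  suffices leg T (n + 2) n ∘L (snocTwo n).flip w = (snocTwo n).flip (T w) from congr($this x)
  induction n with
  | zero => ext x; simp [snocTwo_zero, leg_zero_consTwo]
  | succ n ih =>
    refine Pow.clm_ext fun c x => ?_
    have ihx : leg T (n + 2) n (snocTwo n x w) = snocTwo n x (T w) := congr($(ih x) x)
    simp [snocTwo_consOp, leg_succ_consOp, ihx]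

theorem revConj_consTwo (n : ℕ) (w : HTensor H H) (x : Pow H n) :
    revConj J (n + 2) (consTwo n w x) =
      snocTwo n (revConj J n x) (mapConjT J J (flipT H H w)) := by
  have h : (revConj J (n + 2)).comp ((consTwo n).flip x) = (snocTwo n (revConj J n x)).comp
      ((mapConjT J J).toContinuousLinearMap.comp (flipT H H)) :=
    HTensor.clm_ext fun a b => by
      simp [consTwo_tmul, revConj_consOp, flipT_tmul, mapConjT_tmul, snocTwo_tmul]
  exact congr($h w)

/-- `T` commutes with the antilinear map `x ⊗ y ↦ J y ⊗ J x`; this is TCP covariance of `T`. -/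
def CommutesWithReversal (J : H →ₗᵢ⋆[ℂ] H) (T : HTensor H H →L[ℂ] HTensor H H) : Prop :=
  ∀ w, mapConjT J J (flipT H H (T w)) = T (mapConjT J J (flipT H H w))

variable {T : HTensor H H →L[ℂ] HTensor H H}

theorem CommutesWithReversal.revConj_leg (hTJ : CommutesWithReversal J T) {n j : ℕ}
    (h : j + 1 < n) (x : Pow H n) :
    revConj J n (leg T n j x) = leg T n (n - 2 - j) (revConj J n x) := by
  suffices (revConj J n).comp (leg T n j) = (leg T n (n - 2 - j)).comp (revConj J n) from
    congr($this x)
  induction n generalizing j with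
  | zero => omega
  | succ n ih =>
    match n, j with
    | n + 1, 0 =>
      exact Pow.clm_ext_consTwo fun w x => by
        simp [leg_zero_consTwo, revConj_consTwo, leg_snocTwo, hTJ w]
    | n, j + 1 =>
      refine Pow.clm_ext fun a x => ?_
      have ihx : revConj J n (leg T n j x) = leg T n (n - 2 - j) (revConj J n x) :=
        congr($(ih (by omega : j + 1 < n) x) x)
      rw [show n + 1 - 2 - (j + 1) = n - 2 - j by omega]
      simp only [ContinuousLinearMap.comp_apply, leg_succ_consOp, revConj_consOp, ihx]
      rw [leg_snocOp T (by omega)]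

theorem mem_symSpace_iff {n : ℕ} {x : Pow H n} :
    x ∈ symSpace T n ↔ ∀ j, j + 1 < n → leg T n j x = x := by
  refine ⟨fun h j _ => h j, fun h j => ?_⟩
  by_cases hj : j + 1 < n
  · exact h j hj
  · rw [leg_of_le T (not_lt.1 hj), one_apply_eq_self]

theorem CommutesWithReversal.revConj_mem_symSpace (hTJ : CommutesWithReversal J T) {n : ℕ}
    {x : Pow H n} (hx : x ∈ symSpace T n) : revConj J n x ∈ symSpace T n := by
  refine mem_symSpace_iff.2 fun j hj => ?_
  rw [show j = n - 2 - (n - 2 - j) by omega, ← hTJ.revConj_leg (by omega), hx]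

end Reversal

section Projection

variable {H : Type u} [NormedAddCommGroup H] [InnerProductSpace ℂ H]
  {T : HTensor H H →L[ℂ] HTensor H H}

theorem inner_symProj {n : ℕ} {x : Pow H n} (hx : x ∈ symSpace T n) (y : Pow H n) :
    inner ℂ x (symProj T n y : Pow H n) = inner ℂ x y :=
  Submodule.inner_orthogonalProjectionOnto_eq_of_mem_left ⟨x, hx⟩ y

theorem symProj_eq {n : ℕ} {x y : Pow H n} (hx : x ∈ symSpace T n)
    (h : ∀ z ∈ symSpace T n, inner ℂ z y = inner ℂ z x) : (symProj T n y : Pow H n) = x := by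
  suffices symProj T n y = ⟨x, hx⟩ from congrArg Subtype.val this
  refine ext_inner_left ℂ fun z => ?_
  rw [Submodule.coe_inner, Submodule.coe_inner, inner_symProj z.2, h z z.2]

theorem symProj_of_mem {n : ℕ} {x : Pow H n} (hx : x ∈ symSpace T n) :
    (symProj T n x : Pow H n) = x :=
  symProj_eq hx fun _ _ => rfl

theorem adjoint_symProj (n : ℕ) :
    ContinuousLinearMap.adjoint (symProj T n) = (symSpace T n).subtypeL :=
  (symSpace T n).adjoint_orthogonalProjectionOnto

theorem adjoint_symProj_comp_comp {m n : ℕ} (A : Pow H m →L[ℂ] Pow H n) :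
    ContinuousLinearMap.adjoint (symProj T n ∘L A ∘L (symSpace T m).subtypeL) =
      symProj T m ∘L ContinuousLinearMap.adjoint A ∘L (symSpace T n).subtypeL := by
  rw [ContinuousLinearMap.adjoint_comp, ContinuousLinearMap.adjoint_comp, adjoint_symProj,
    ← adjoint_symProj, ContinuousLinearMap.adjoint_adjoint, ContinuousLinearMap.comp_assoc]

theorem unconsOp_mem_symSpace [CompleteSpace H] (ξ : H) {n : ℕ} {x : Pow H (n + 1)}
    (hx : x ∈ symSpace T (n + 1)) : unconsOp ξ n x ∈ symSpace T n := fun j => by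
  rw [← unconsOp_leg_succ, hx]

theorem unsnocOp_mem_symSpace [CompleteSpace H] (ξ : H) {n : ℕ} {x : Pow H (n + 1)}
    (hx : x ∈ symSpace T (n + 1)) : unsnocOp ξ n x ∈ symSpace T n :=
  mem_symSpace_iff.2 fun j hj => by rw [← unsnocOp_leg T hj, hx]

variable (T) in
/-- The product of the legs `k, k + 1, …, k + l - 1` on `H^{⊗N}`, which represents a cyclic
permutation of the factors `k, …, k + l`. -/
def legChain (N : ℕ) : ℕ → ℕ → (Pow H N →L[ℂ] Pow H N)
  | _, 0 => 1
  | k, l + 1 => leg T N k * legChain N (k + 1) l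

theorem legChain_succ (N k l : ℕ) :
    legChain T N k (l + 1) = leg T N k * legChain T N (k + 1) l := rfl

theorem legChain_succ_consOp (n k l : ℕ) (a : H) (x : Pow H n) :
    legChain T (n + 1) (k + 1) l (consOp a n x) = consOp a n (legChain T n k l x) := by
  induction l generalizing k with
  | zero => rfl
  | succ l ih => simp only [legChain_succ, mul_apply_eq_comp, ih, leg_succ_consOp]

theorem unconsOp_legChain_succ [CompleteSpace H] (n k l : ℕ) (a : H) (x : Pow H (n + 1)) :
    unconsOp a n (legChain T (n + 1) (k + 1) l x) = legChain T n k l (unconsOp a n x) := by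
  induction l generalizing k with
  | zero => rfl
  | succ l ih => simp only [legChain_succ, mul_apply_eq_comp, ih, unconsOp_leg_succ]

theorem inner_legChain [CompleteSpace H] (hT : IsSelfAdjoint T) {n : ℕ} (k l : ℕ)
    {z : Pow H n} (hz : z ∈ symSpace T n) (x : Pow H n) :
    inner ℂ z (legChain T n k l x) = inner ℂ z x := by
  induction l generalizing k with
  | zero => rfl
  | succ l ih => rw [legChain_succ, mul_apply_eq_comp, ← inner_leg hT, hz, ih]

theorem commute_leg_legChain {N j k : ℕ} (h : j + 1 < k) (l : ℕ) :
    Commute (leg T N j) (legChain T N k l) := by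
  induction l generalizing k with
  | zero => exact Commute.one_right _
  | succ l ih => exact (commute_leg T (by omega)).mul_right (ih (by omega))

theorem Braided.leg_succ_mul_legChain (hB : Braided T) {N j k l : ℕ} (hkj : k ≤ j)
    (hjl : j + 1 < k + l) (hjN : j + 2 < N) :
    leg T N (j + 1) * legChain T N k l = legChain T N k l * leg T N j := by
  induction l generalizing k with
  | zero => omega
  | succ l ih =>
    rcases hkj.lt_or_eq with hkj | rfl
    · rw [legChain_succ, ← mul_assoc, ← (commute_leg T (by omega)).eq, mul_assoc,
        ih (by omega) (by omega), mul_assoc]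
    · obtain ⟨l, rfl⟩ := Nat.exists_eq_succ_of_ne_zero (n := l) (by omega)
      rw [legChain_succ, legChain_succ, ← mul_assoc, ← mul_assoc, ← hB.leg_mul_leg_mul_leg hjN,
        mul_assoc, (commute_leg_legChain (by omega) l).eq]
      simp only [mul_assoc]

theorem leg_legChain_snocOp (h2 : T * T = 1) (hB : Braided T) {n k j : ℕ}
    (hk : k ≤ n) (hj : j < n) (ξ : H) {x : Pow H n} (hx : x ∈ symSpace T n) :
    leg T (n + 1) j (legChain T (n + 1) k (n - k) (snocOp ξ n x)) =
      legChain T (n + 1) (Equiv.swap j (j + 1) k) (n - Equiv.swap j (j + 1) k) (snocOp ξ n x) := by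
  have hfix {i : ℕ} (hi : i + 1 < n) : leg T (n + 1) i (snocOp ξ n x) = snocOp ξ n x := by
    rw [leg_snocOp T hi, hx]
  have hstep : legChain T (n + 1) j (n - j) =
      leg T (n + 1) j * legChain T (n + 1) (j + 1) (n - (j + 1)) := by
    rw [show n - j = n - (j + 1) + 1 by omega, legChain_succ]
  rcases eq_or_ne k j with rfl | hkj
  · rw [Equiv.swap_apply_left, hstep, ← mul_apply_eq_comp, ← mul_assoc, leg_mul_self h2, one_mul]
  rcases eq_or_ne k (j + 1) with rfl | hkj'
  · rw [Equiv.swap_apply_right, hstep, mul_apply_eq_comp]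
  rw [Equiv.swap_apply_of_ne_of_ne hkj hkj', ← mul_apply_eq_comp]
  rcases hkj.lt_or_gt with hlt | hgt
  · obtain ⟨i, rfl⟩ := Nat.exists_eq_succ_of_ne_zero (n := j) (by omega)
    rw [hB.leg_succ_mul_legChain (by omega) (by omega) (by omega), mul_apply_eq_comp,
      hfix (by omega)]
  · rw [(commute_leg_legChain (by omega) (n - k)).eq, mul_apply_eq_comp, hfix (by omega)]

theorem symProj_snocOp [CompleteSpace H] (hT : IsSelfAdjoint T) (h2 : T * T = 1) (hB : Braided T)
    (n : ℕ) (ξ : H) {x : Pow H n} (hx : x ∈ symSpace T n) :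
    ((n : ℂ) + 1) • (symProj T (n + 1) (snocOp ξ n x) : Pow H (n + 1)) =
      ∑ k ∈ Finset.range (n + 1), legChain T (n + 1) k (n - k) (snocOp ξ n x) := by
  rw [← Submodule.coe_smul, ← map_smul]
  refine symProj_eq (mem_symSpace_iff.2 fun j hj => ?_) fun z hz => ?_
  · rw [map_sum]
    refine Finset.sum_equiv (Equiv.swap j (j + 1)) (fun k => ?_) fun k hk =>
      leg_legChain_snocOp h2 hB (Finset.mem_range_succ_iff.1 hk) (by omega) ξ hx
    simp only [Finset.mem_range, Equiv.swap_apply_def]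
    split_ifs <;> omega
  · rw [inner_sum, Finset.sum_congr rfl fun k _ => inner_legChain hT k (n - k) hz _]
    simp

end Projection

section FockCommutator

variable {H : Type u} [NormedAddCommGroup H] [InnerProductSpace ℂ H]
  {T : HTensor H H →L[ℂ] HTensor H H}

theorem raiseOp_succ (A : ∀ n, symSpace T n →L[ℂ] symSpace T (n + 1)) (Ψ : finPart T) (n : ℕ) :
    (raiseOp T A Ψ : Fock T) (n + 1) = A n ((Ψ : Fock T) n) := rfl

theorem raiseOp_zero (A : ∀ n, symSpace T n →L[ℂ] symSpace T (n + 1)) (Ψ : finPart T) :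
    (raiseOp T A Ψ : Fock T) 0 = 0 := rfl

theorem lowerOp_apply (B : ∀ n, symSpace T (n + 1) →L[ℂ] symSpace T n) (Ψ : finPart T) (n : ℕ) :
    (lowerOp T B Ψ : Fock T) n = B n ((Ψ : Fock T) (n + 1)) := rfl

theorem finPart_ext {Ψ Φ : finPart T} (h : ∀ n, (Ψ : Fock T) n = (Φ : Fock T) n) : Ψ = Φ :=
  Subtype.ext (lp.ext (funext h))

theorem finPart_add_apply (Ψ Φ : finPart T) (n : ℕ) :
    ((Ψ + Φ : finPart T) : Fock T) n = (Ψ : Fock T) n + (Φ : Fock T) n := rfl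

theorem commute_raiseOp_add_lowerOp {A A' : ∀ n, symSpace T n →L[ℂ] symSpace T (n + 1)}
    {B B' : ∀ n, symSpace T (n + 1) →L[ℂ] symSpace T n}
    (hA : ∀ n, A (n + 1) ∘L A' n = A' (n + 1) ∘L A n)
    (hB : ∀ n, B n ∘L B' (n + 1) = B' n ∘L B (n + 1))
    (h0 : B 0 ∘L A' 0 = B' 0 ∘L A 0)
    (h : ∀ n, B (n + 1) ∘L A' (n + 1) + A n ∘L B' n =
      B' (n + 1) ∘L A (n + 1) + A' n ∘L B n) :
    Commute (raiseOp T A + lowerOp T B : Module.End ℂ (finPart T))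
      (raiseOp T A' + lowerOp T B') := by
  refine LinearMap.ext fun Ψ => finPart_ext fun m => ?_
  simp only [Module.End.mul_apply, LinearMap.add_apply, finPart_add_apply, lowerOp_apply,
    raiseOp_succ, map_add]
  have hB' (x) : B m (B' (m + 1) x) = B' m (B (m + 1) x) := congr($(hB m) x)
  cases m with
  | zero =>
    have h0' (x) : B 0 (A' 0 x) = B' 0 (A 0 x) := congr($h0 x)
    simp only [raiseOp_zero, zero_add, h0', hB']
  | succ n =>
    have hmixed : B (n + 1) (A' (n + 1) ((Ψ : Fock T) (n + 1))) + A n (B' n ((Ψ : Fock T) (n + 1)))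
        = B' (n + 1) (A (n + 1) ((Ψ : Fock T) (n + 1))) + A' n (B n ((Ψ : Fock T) (n + 1))) :=
      congr($(h n) _)
    have hraise : A n ((raiseOp T A' Ψ : Fock T) n) = A' n ((raiseOp T A Ψ : Fock T) n) := by
      cases n with
      | zero => simp only [raiseOp_zero, map_zero]
      | succ n => exact congr($(hA n) _)
    simp only [raiseOp_succ, lowerOp_apply, hraise, hB']
    rw [← sub_eq_zero] at hmixed ⊢
    rw [← hmixed]
    abel

/-- `Ψ_n ↦ √(n+1) P_{n+1} (Ψ_n ⊗ ξ)`. -/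
def createRightN (T : HTensor H H →L[ℂ] HTensor H H) (ξ : H) (n : ℕ) :
    symSpace T n →L[ℂ] symSpace T (n + 1) :=
  ((Real.sqrt (n + 1) : ℝ) : ℂ) • (symProj T (n + 1) ∘L snocOp ξ n ∘L (symSpace T n).subtypeL)

/-- The creation operator that adds a particle on the right, on vectors of finite particle
number. -/
def createRight (T : HTensor H H →L[ℂ] HTensor H H) (ξ : H) : finPart T →ₗ[ℂ] finPart T :=
  raiseOp T (createRightN T ξ)

/-- The adjoint of the right creation operator, on vectors of finite particle number. -/
def annihilateRight (T : HTensor H H →L[ℂ] HTensor H H) (ξ : H) : finPart T →ₗ[ℂ] finPart T :=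
  lowerOp T fun n => ContinuousLinearMap.adjoint (createRightN T ξ n)

theorem createN_apply (ξ : H) (n : ℕ) (x : symSpace T n) : createN T ξ n x =
    ((Real.sqrt (n + 1) : ℝ) : ℂ) • symProj T (n + 1) (consOp ξ n x) := rfl

theorem createRightN_apply (ξ : H) (n : ℕ) (x : symSpace T n) : createRightN T ξ n x =
    ((Real.sqrt (n + 1) : ℝ) : ℂ) • symProj T (n + 1) (snocOp ξ n x) := rfl

theorem adjoint_createN_apply [CompleteSpace H] (ξ : H) (n : ℕ) (x : symSpace T (n + 1)) :
    (ContinuousLinearMap.adjoint (createN T ξ n) x : Pow H n) =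
      ((Real.sqrt (n + 1) : ℝ) : ℂ) • unconsOp ξ n x := by
  have hcreate : createN T ξ n = ((Real.sqrt (n + 1) : ℝ) : ℂ) •
      (symProj T (n + 1) ∘L consOp ξ n ∘L (symSpace T n).subtypeL) := rfl
  rw [hcreate, map_smulₛₗ, adjoint_symProj_comp_comp, Complex.conj_ofReal, ← unconsOp]
  exact congrArg _ (symProj_of_mem (unconsOp_mem_symSpace ξ x.2))

theorem adjoint_createRightN_apply [CompleteSpace H] (ξ : H) (n : ℕ) (x : symSpace T (n + 1)) :
    (ContinuousLinearMap.adjoint (createRightN T ξ n) x : Pow H n) =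
      ((Real.sqrt (n + 1) : ℝ) : ℂ) • unsnocOp ξ n x := by
  rw [createRightN, map_smulₛₗ, adjoint_symProj_comp_comp, Complex.conj_ofReal, ← unsnocOp]
  exact congrArg _ (symProj_of_mem (unsnocOp_mem_symSpace ξ x.2))

theorem adjoint_createN_comp_adjoint_createRightN [CompleteSpace H] (η η' : H) (n : ℕ) :
    ContinuousLinearMap.adjoint (createN T η n) ∘L
        ContinuousLinearMap.adjoint (createRightN T η' (n + 1)) =
      ContinuousLinearMap.adjoint (createRightN T η' n) ∘L
        ContinuousLinearMap.adjoint (createN T η (n + 1)) := by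
  ext1 x
  refine Subtype.ext ?_
  simp only [ContinuousLinearMap.comp_apply, adjoint_createN_apply, adjoint_createRightN_apply,
    map_smul, unsnocOp_unconsOp]

theorem createN_comp_createRightN [CompleteSpace H] (ξ ξ' : H) (n : ℕ) :
    createN T ξ (n + 1) ∘L createRightN T ξ' n = createRightN T ξ' (n + 1) ∘L createN T ξ n := by
  have h := congrArg ContinuousLinearMap.adjoint
    (adjoint_createN_comp_adjoint_createRightN (T := T) ξ ξ' n)
  simpa only [ContinuousLinearMap.adjoint_comp, ContinuousLinearMap.adjoint_adjoint] using h.symm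

/-- The operator `a_l(η) T_0 ⋯ T_{n-1} a_r(ξ)^*` on `H^{⊗n}`, where `a_l` and `a_r` are the left
and right annihilation maps of the full Fock space and `T_j` is the leg `j`. It is what remains of
`z(η)` and the right creation operator of `ξ` in their commutator. -/
def exchangeOp (T : HTensor H H →L[ℂ] HTensor H H) (η ξ : H) (n : ℕ) : Pow H n →L[ℂ] Pow H n :=
  unconsOp η n ∘L legChain T (n + 1) 0 n ∘L snocOp ξ n

/-- The compression of `exchangeOp` to the symmetric `n`-particle space. -/
def exchangeN (T : HTensor H H →L[ℂ] HTensor H H) (η ξ : H) (n : ℕ) :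
    symSpace T n →L[ℂ] symSpace T n :=
  symProj T n ∘L exchangeOp T η ξ n ∘L (symSpace T n).subtypeL

theorem sqrt_smul_sqrt_smul {M : Type*} [AddCommGroup M] [Module ℂ M] (n : ℕ) (x : M) :
    ((Real.sqrt (n + 1) : ℝ) : ℂ) • ((Real.sqrt (n + 1) : ℝ) : ℂ) • x = ((n : ℂ) + 1) • x := by
  rw [smul_smul, ← Complex.ofReal_mul, Real.mul_self_sqrt (by positivity)]
  norm_cast

section

variable [CompleteSpace H] (hT : IsSelfAdjoint T) (h2 : T * T = 1) (hB : Braided T)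

include hT h2 hB

theorem coe_adjoint_createN_createRightN (η ξ : H) (n : ℕ) (x : symSpace T n) :
    (ContinuousLinearMap.adjoint (createN T η n) (createRightN T ξ n x) : Pow H n) =
      ∑ k ∈ Finset.range (n + 1), unconsOp η n (legChain T (n + 1) k (n - k) (snocOp ξ n x)) := by
  rw [adjoint_createN_apply, createRightN_apply, Submodule.coe_smul, map_smul,
    sqrt_smul_sqrt_smul, ← map_smul, symProj_snocOp hT h2 hB n ξ x.2, map_sum]

theorem adjoint_createN_comp_createRightN_zero (η ξ : H) :
    ContinuousLinearMap.adjoint (createN T η 0) ∘L createRightN T ξ 0 = exchangeN T η ξ 0 := by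
  ext1 x
  have h := coe_adjoint_createN_createRightN hT h2 hB η ξ 0 x
  rw [Finset.sum_range_one] at h
  refine Subtype.ext (h.trans (symProj_of_mem (T := T) (n := 0) ?_).symm)
  exact h ▸ Subtype.property _

theorem adjoint_createN_comp_createRightN_succ (η ξ : H) (n : ℕ) :
    ContinuousLinearMap.adjoint (createN T η (n + 1)) ∘L createRightN T ξ (n + 1) =
      exchangeN T η ξ (n + 1) +
        createRightN T ξ n ∘L ContinuousLinearMap.adjoint (createN T η n) := by
  ext1 x
  have hright : (createRightN T ξ n (ContinuousLinearMap.adjoint (createN T η n) x) :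
      Pow H (n + 1)) = ∑ k ∈ Finset.range (n + 1),
        unconsOp η (n + 1) (legChain T (n + 2) (k + 1) (n + 1 - (k + 1)) (snocOp ξ (n + 1) x)) := by
    rw [createRightN_apply, adjoint_createN_apply, map_smul, map_smul, sqrt_smul_sqrt_smul,
      Submodule.coe_smul, symProj_snocOp hT h2 hB n ξ (unconsOp_mem_symSpace η x.2)]
    simp only [unconsOp_legChain_succ, unconsOp_snocOp, Nat.add_sub_add_right]
  have hsplit : (ContinuousLinearMap.adjoint (createN T η (n + 1)) (createRightN T ξ (n + 1) x) :
      Pow H (n + 1)) = exchangeOp T η ξ (n + 1) x +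
        createRightN T ξ n (ContinuousLinearMap.adjoint (createN T η n) x) := by
    rw [coe_adjoint_createN_createRightN hT h2 hB, Finset.sum_range_succ', hright]
    exact add_comm _ _
  have hmem : exchangeOp T η ξ (n + 1) x ∈ symSpace T (n + 1) := by
    rw [← sub_eq_iff_eq_add] at hsplit
    exact hsplit ▸ sub_mem (Subtype.property _) (Subtype.property _)
  exact Subtype.ext (hsplit.trans congr($((symProj_of_mem hmem).symm) + _))

theorem commute_create_add_annihilate {ξ η ξ' η' : H}
    (h : ∀ n, exchangeOp T η ξ' n = ContinuousLinearMap.adjoint (exchangeOp T ξ η' n)) :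
    Commute (create T ξ + annihilate T η : Module.End ℂ (finPart T))
      (createRight T ξ' + annihilateRight T η') := by
  have hex (n) : exchangeN T η ξ' n = ContinuousLinearMap.adjoint (exchangeN T ξ η' n) := by
    rw [exchangeN, exchangeN, adjoint_symProj_comp_comp, h]
  refine commute_raiseOp_add_lowerOp (createN_comp_createRightN ξ ξ')
    (adjoint_createN_comp_adjoint_createRightN η η') ?_ fun n => ?_
  · have hadj := congrArg ContinuousLinearMap.adjoint
      (adjoint_createN_comp_createRightN_zero hT h2 hB ξ η')
    rw [ContinuousLinearMap.adjoint_comp, ContinuousLinearMap.adjoint_adjoint, ← hex] at hadj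
    rw [adjoint_createN_comp_createRightN_zero hT h2 hB, hadj]
  · have hadj := congrArg ContinuousLinearMap.adjoint
      (adjoint_createN_comp_createRightN_succ hT h2 hB ξ η' n)
    rw [map_add, ContinuousLinearMap.adjoint_comp, ContinuousLinearMap.adjoint_comp,
      ContinuousLinearMap.adjoint_adjoint, ContinuousLinearMap.adjoint_adjoint, ← hex] at hadj
    rw [adjoint_createN_comp_createRightN_succ hT h2 hB, hadj]
    exact add_right_comm _ _ _

end

section Conjugate

variable {J : H →ₗᵢ⋆[ℂ] H}

theorem CommutesWithReversal.secondQuantConj_apply (hTJ : CommutesWithReversal J T)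
    (Ψ : finPart T) (n : ℕ) :
    ((secondQuantConj T J Ψ : Fock T) n : Pow H n) = revConj J n ((Ψ : Fock T) n) :=
  symProj_of_mem (hTJ.revConj_mem_symSpace ((Ψ : Fock T) n).2)

variable (hJ : Function.Involutive J) (hTJ : CommutesWithReversal J T)

include hJ hTJ in
theorem revConj_symProj (n : ℕ) (x : Pow H n) :
    revConj J n (symProj T n x) = symProj T n (revConj J n x) := by
  refine (symProj_eq (hTJ.revConj_mem_symSpace (Subtype.property _)) fun z hz => ?_).symm
  rw [← revConj_involutive hJ n z, inner_revConj_revConj, inner_revConj_revConj,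
    ← inner_conj_symm, ← inner_symProj (hTJ.revConj_mem_symSpace hz) x, inner_conj_symm]

include hJ in
theorem revConj_unconsOp (n : ℕ) (a : H) (x : Pow H (n + 1)) :
    revConj J n (unconsOp a n (revConj J (n + 1) x)) = unsnocOp (J a) n x := by
  rw [← unsnocOp_revConj, revConj_involutive hJ]

include hJ hTJ in
theorem secondQuantConj_create_add_annihilate [CompleteSpace H] (ξ η : H) (Ψ : finPart T) :
    secondQuantConj T J ((create T ξ + annihilate T η) (secondQuantConj T J Ψ)) =
      (createRight T (J ξ) + annihilateRight T (J η)) Ψ := by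
  refine finPart_ext fun n => Subtype.ext ?_
  rw [hTJ.secondQuantConj_apply, LinearMap.add_apply, LinearMap.add_apply, finPart_add_apply,
    finPart_add_apply, Submodule.coe_add, Submodule.coe_add, map_add, annihilate,
    annihilateRight, lowerOp_apply, lowerOp_apply, adjoint_createN_apply,
    adjoint_createRightN_apply, hTJ.secondQuantConj_apply, map_smulₛₗ, Complex.conj_ofReal,
    revConj_unconsOp hJ]
  congr 1
  cases n with
  | zero => rw [create, createRight, raiseOp_zero, raiseOp_zero]; exact map_zero _
  | succ n =>
    rw [create, createRight, raiseOp_succ, raiseOp_succ, createN_apply, createRightN_apply,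
      Submodule.coe_smul, Submodule.coe_smul, map_smulₛₗ, Complex.conj_ofReal,
      revConj_symProj hJ hTJ, revConj_consOp, hTJ.secondQuantConj_apply, revConj_involutive hJ]

end Conjugate

end FockCommutator

section LpTensor

variable {α β : Type*} [MeasurableSpace α] [MeasurableSpace β] {μ : Measure α} {ν : Measure β}
  {E F : Type*} [NormedAddCommGroup E] [InnerProductSpace ℂ E]
  [NormedAddCommGroup F] [InnerProductSpace ℂ F]

theorem ae_prod_fst {p : α → Prop} (h : ∀ᵐ x ∂μ, p x) : ∀ᵐ z ∂μ.prod ν, p z.1 :=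
  Measure.quasiMeasurePreserving_fst.ae h

theorem ae_prod_snd {p : β → Prop} (h : ∀ᵐ x ∂ν, p x) : ∀ᵐ z ∂μ.prod ν, p z.2 :=
  Measure.quasiMeasurePreserving_snd.ae h

theorem memLp_tmul (ξ : Lp E 2 μ) (η : Lp F 2 ν) :
    MemLp (fun p : α × β => tmul (ξ p.1) (η p.2)) 2 (μ.prod ν) := by
  have hm : AEStronglyMeasurable (fun p : α × β => tmul (ξ p.1) (η p.2)) (μ.prod ν) :=
    (tmulL E F).aestronglyMeasurable_comp₂ (Lp.aestronglyMeasurable ξ).comp_fst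
      (Lp.aestronglyMeasurable η).comp_snd
  rw [memLp_two_iff_integrable_sq_norm hm]
  simp only [norm_tmul_eq_mul, mul_pow]
  exact ((memLp_two_iff_integrable_sq_norm (Lp.aestronglyMeasurable ξ)).1 (Lp.memLp ξ)).mul_prod
    ((memLp_two_iff_integrable_sq_norm (Lp.aestronglyMeasurable η)).1 (Lp.memLp η))

/-- The bilinear map that sends `ξ` and `η` to the function `(s, t) ↦ ξ(s) ⊗ η(t)`. -/
def lpTensor : Lp E 2 μ →ₗ[ℂ] Lp F 2 ν →ₗ[ℂ] Lp (HTensor E F) 2 (μ.prod ν) :=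
  LinearMap.mk₂ ℂ (fun ξ η => (memLp_tmul ξ η).toLp _)
    (fun ξ ξ' η => MemLp.toLp_congr _ ((memLp_tmul ξ η).add (memLp_tmul ξ' η)) <|
      (ae_prod_fst (Lp.coeFn_add ξ ξ')).mono fun _ h => (congr(tmul $h _)).trans (add_tmul ..))
    (fun c ξ η => MemLp.toLp_congr _ ((memLp_tmul ξ η).const_smul c) <|
      (ae_prod_fst (Lp.coeFn_smul c ξ)).mono fun _ h => (congr(tmul $h _)).trans
        (smul_tmul ..))
    (fun ξ η η' => MemLp.toLp_congr _ ((memLp_tmul ξ η).add (memLp_tmul ξ η')) <|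
      (ae_prod_snd (Lp.coeFn_add η η')).mono fun _ h => (congr(tmul _ $h)).trans (tmul_add ..))
    (fun c ξ η => MemLp.toLp_congr _ ((memLp_tmul ξ η).const_smul c) <|
      (ae_prod_snd (Lp.coeFn_smul c η)).mono fun _ h => (congr(tmul _ $h)).trans
        (tmul_smul ..))

theorem coeFn_lpTensor (ξ : Lp E 2 μ) (η : Lp F 2 ν) :
    lpTensor ξ η =ᵐ[μ.prod ν] fun p => tmul (ξ p.1) (η p.2) :=
  (memLp_tmul ξ η).coeFn_toLp

theorem lpTensor_indicatorConstLp [SFinite ν] {A : Set α} {B : Set β} (hA : MeasurableSet A)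
    (hB : MeasurableSet B) (hμA : μ A ≠ ⊤) (hνB : ν B ≠ ⊤) (hAB : μ.prod ν (A ×ˢ B) ≠ ⊤)
    (x : E) (y : F) : lpTensor (indicatorConstLp 2 hA hμA x) (indicatorConstLp 2 hB hνB y) =
      indicatorConstLp 2 (hA.prod hB) hAB (tmul x y) := by
  refine Lp.ext ?_
  filter_upwards [coeFn_lpTensor (indicatorConstLp 2 hA hμA x) (indicatorConstLp 2 hB hνB y),
    ae_prod_fst (indicatorConstLp_coeFn (p := 2) (hs := hA) (hμs := hμA) (c := x)),
    ae_prod_snd (indicatorConstLp_coeFn (p := 2) (hs := hB) (hμs := hνB) (c := y)),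
    indicatorConstLp_coeFn (p := 2) (hs := hA.prod hB) (hμs := hAB) (c := tmul x y)]
    with p h₁ hA' hB' h₂
  rw [h₁, hA', hB', h₂]
  by_cases hpA : p.1 ∈ A <;> by_cases hpB : p.2 ∈ B <;>
    simp [Set.indicator, hpA, hpB, ← tmulL_apply]

theorem ae_eq_zero_of_forall_setIntegral_prod_eq_zero {W : Type*} [NormedAddCommGroup W]
    [NormedSpace ℝ W] [CompleteSpace W] {f : α × β → W} (hf : Integrable f (μ.prod ν))
    (h : ∀ A B, MeasurableSet A → MeasurableSet B → ∫ p in A ×ˢ B, f p ∂μ.prod ν = 0) :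
    f =ᵐ[μ.prod ν] 0 := by
  suffices ∀ S, MeasurableSet S → ∫ p in S, f p ∂μ.prod ν = 0 from
    hf.ae_eq_zero_of_forall_setIntegral_eq_zero fun S hS _ => this S hS
  intro S hS
  induction S, hS using
    MeasurableSpace.induction_on_inter generateFrom_prod.symm isPiSystem_prod with
  | empty => simp
  | basic S hS =>
    obtain ⟨A, hA, B, hB, rfl⟩ := hS
    exact h A B hA hB
  | compl S hS ih =>
    have huniv := h _ _ MeasurableSet.univ MeasurableSet.univ
    rwa [Set.univ_prod_univ, setIntegral_univ, ← integral_add_compl hS hf, ih, zero_add] at huniv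
  | iUnion S hd hS ih =>
    rw [integral_iUnion hS hd hf.integrableOn]
    simp only [ih, tsum_zero]

section SFinite

variable [SFinite μ] [SFinite ν]

theorem inner_lpTensor (ξ ξ' : Lp E 2 μ) (η η' : Lp F 2 ν) :
    inner ℂ (lpTensor ξ η) (lpTensor ξ' η') = inner ℂ ξ ξ' * inner ℂ η η' := by
  rw [L2.inner_def, L2.inner_def, L2.inner_def, ← integral_prod_mul]
  refine integral_congr_ae ?_
  filter_upwards [coeFn_lpTensor ξ η, coeFn_lpTensor ξ' η'] with p h₁ h₂
  rw [h₁, h₂, inner_tmul_tmul]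

/-- `lpTensor` on the algebraic tensor product. -/
def algLpTensor : Lp E 2 μ ⊗[ℂ] Lp F 2 ν →ₗᵢ[ℂ] Lp (HTensor E F) 2 (μ.prod ν) :=
  (TensorProduct.lift lpTensor).isometryOfInner fun x y => by
    induction x using TensorProduct.induction_on with
    | zero => simp
    | add a b ha hb => simp only [map_add, inner_add_left, ha, hb]
    | tmul a b =>
      induction y using TensorProduct.induction_on with
      | zero => simp
      | add c d hc hd => simp only [map_add, inner_add_right, hc, hd]
      | tmul c d =>
        rw [TensorProduct.lift.tmul, TensorProduct.lift.tmul, TensorProduct.inner_tmul,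
          inner_lpTensor]

variable (μ ν E F) in
/-- The canonical identification `L²(μ, E) ⊗ L²(ν, F) → L²(μ × ν, E ⊗ F)`. -/
def lpTensorMap : HTensor (Lp E 2 μ) (Lp F 2 ν) →ₗᵢ[ℂ] Lp (HTensor E F) 2 (μ.prod ν) where
  toLinearMap := (extendT
    (algLpTensor (E := E) (F := F) (μ := μ) (ν := ν)).toContinuousLinearMap).toLinearMap
  norm_map' z := by
    refine (denseRange_ofAlg _ _).induction_on z (isClosed_eq (by fun_prop) (by fun_prop))
      fun a => ?_
    rw [ContinuousLinearMap.coe_coe, extendT_ofAlg]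
    simp

theorem lpTensorMap_tmul (ξ : Lp E 2 μ) (η : Lp F 2 ν) :
    lpTensorMap μ ν E F (tmul ξ η) = lpTensor ξ η :=
  extendT_ofAlg _ _

end SFinite

variable [SigmaFinite μ] [SigmaFinite ν]

theorem Lp_prod_eq_zero_of_forall_setIntegral {W : Type*} [NormedAddCommGroup W]
    [NormedSpace ℝ W] [CompleteSpace W]
    (Ψ : Lp W 2 (μ.prod ν)) (h : ∀ A B, MeasurableSet A → MeasurableSet B → μ A ≠ ⊤ → ν B ≠ ⊤ →
      ∫ p in A ×ˢ B, Ψ p ∂μ.prod ν = 0) : Ψ = 0 := by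
  have hrect (i : ℕ × ℕ) : ∀ᵐ p ∂(μ.prod ν).restrict (spanningSets μ i.1 ×ˢ spanningSets ν i.2),
      Ψ p = 0 := by
    have hμ := measure_spanningSets_lt_top μ i.1
    have hν := measure_spanningSets_lt_top ν i.2
    have : IsFiniteMeasure (μ.restrict (spanningSets μ i.1)) := ⟨by simpa using hμ⟩
    have : IsFiniteMeasure (ν.restrict (spanningSets ν i.2)) := ⟨by simpa using hν⟩
    rw [← Measure.prod_restrict]
    refine ae_eq_zero_of_forall_setIntegral_prod_eq_zero (MemLp.integrable one_le_two ?_)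
      fun A B hA hB => ?_
    · rw [Measure.prod_restrict]
      exact (Lp.memLp Ψ).restrict _
    · rw [Measure.prod_restrict, Measure.restrict_restrict (hA.prod hB), Set.prod_inter_prod]
      exact h _ _ (hA.inter (measurableSet_spanningSets μ i.1))
        (hB.inter (measurableSet_spanningSets ν i.2))
        (measure_ne_top_of_subset Set.inter_subset_right hμ.ne)
        (measure_ne_top_of_subset Set.inter_subset_right hν.ne)
  rw [← ae_restrict_iUnion_iff, Set.iUnion_prod, iUnion_spanningSets, iUnion_spanningSets,
    Set.univ_prod_univ, Measure.restrict_univ] at hrect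
  exact (Lp.eq_zero_iff_ae_eq_zero).2 hrect

theorem eq_zero_of_forall_inner_lpTensor {Ψ : Lp (HTensor E F) 2 (μ.prod ν)}
    (h : ∀ ξ η, inner ℂ (lpTensor ξ η : Lp (HTensor E F) 2 (μ.prod ν)) Ψ = 0) : Ψ = 0 := by
  refine Lp_prod_eq_zero_of_forall_setIntegral Ψ fun A B hA hB hμA hνB =>
    ext_inner_left ℂ fun v => ?_
  rw [inner_zero_right]
  induction v using HTensor.induction_on with
  | isClosed => exact isClosed_eq (by fun_prop) (by fun_prop)
  | add v w hv hw => rw [inner_add_left, hv, hw, add_zero]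
  | tmul x y =>
    have hAB : μ.prod ν (A ×ˢ B) ≠ ⊤ := by
      rw [Measure.prod_prod]
      exact ENNReal.mul_ne_top hμA hνB
    rw [← L2.inner_indicatorConstLp_eq_inner_setIntegral ℂ (hA.prod hB) hAB,
      ← lpTensor_indicatorConstLp hA hB hμA hνB hAB, h]

theorem lpTensorMap_adjoint_apply (Ψ : Lp (HTensor E F) 2 (μ.prod ν)) :
    lpTensorMap μ ν E F
      (ContinuousLinearMap.adjoint (lpTensorMap μ ν E F).toContinuousLinearMap Ψ) = Ψ := by
  rw [← sub_eq_zero]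
  refine eq_zero_of_forall_inner_lpTensor fun ξ η => ?_
  rw [← lpTensorMap_tmul, inner_sub_right, LinearIsometry.inner_map_map,
    ContinuousLinearMap.adjoint_inner_right, LinearIsometry.coe_toContinuousLinearMap, sub_self]

end LpTensor

section AEFormula

theorem coeFn_clm_ae_eq_of_tmul {α β E F W W' : Type*} [MeasurableSpace α] [MeasurableSpace β]
    {μ : Measure α} {ν : Measure β} [NormedAddCommGroup E] [InnerProductSpace ℂ E]
    [NormedAddCommGroup F] [InnerProductSpace ℂ F] [NormedAddCommGroup W] [NormedSpace ℂ W]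
    [NormedAddCommGroup W'] [NormedSpace ℂ W'] {σ : ℂ →+* ℂ} {A : HTensor E F →SL[σ] Lp W' 2 ν}
    {B : HTensor E F →L[ℂ] Lp W 2 μ} {τ : β → α} (hτ : Measure.QuasiMeasurePreserving τ ν μ)
    (U : β → W →SL[σ] W') (h : ∀ x y, A (tmul x y) =ᵐ[ν] fun p => U p (B (tmul x y) (τ p)))
    (z : HTensor E F) : A z =ᵐ[ν] fun p => U p (B z (τ p)) := by
  induction z using HTensor.induction_on with
  | isClosed =>
    refine IsSeqClosed.isClosed fun z z₀ hz hlim => ?_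
    obtain ⟨ns, hns, hA⟩ := (tendstoInMeasure_of_tendsto_Lp
      ((A.continuous.tendsto z₀).comp hlim)).exists_seq_tendsto_ae
    obtain ⟨ms, hms, hB⟩ := (tendstoInMeasure_of_tendsto_Lp
      ((B.continuous.tendsto z₀).comp (hlim.comp hns.tendsto_atTop))).exists_seq_tendsto_ae
    have hAB : ∀ᵐ p ∂ν, ∀ i, A (z i) p = U p (B (z i) (τ p)) := ae_all_iff.2 hz
    filter_upwards [hA, hτ.ae hB, hAB] with p hA hB hAB
    exact tendsto_nhds_unique (hA.comp hms.tendsto_atTop)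
      ((((U p).continuous.tendsto _).comp hB).congr fun i => (hAB _).symm)
  | add x y hx hy =>
    rw [map_add, map_add]
    filter_upwards [hx, hy, Lp.coeFn_add (A x) (A y), hτ.ae (Lp.coeFn_add (B x) (B y))]
      with p hx hy hA hB
    rw [hA, hB, Pi.add_apply, Pi.add_apply, map_add, hx, hy]
  | tmul x y => exact h x y

theorem quasiMeasurePreserving_of_surjective {E F : Type*} [NormedAddCommGroup E]
    [NormedSpace ℝ E] [MeasurableSpace E] [BorelSpace E] [LocallyCompactSpace E]
    [NormedAddCommGroup F] [NormedSpace ℝ F] [MeasurableSpace F] [BorelSpace F] (μ : Measure E)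
    (ν : Measure F) [μ.IsAddHaarMeasure] [ν.IsAddHaarMeasure] (L : E →L[ℝ] F)
    (h : Function.Surjective L) : Measure.QuasiMeasurePreserving L μ ν := by
  refine ⟨L.continuous.measurable, ?_⟩
  obtain ⟨c, -, -, hc⟩ := L.toLinearMap.exists_map_addHaar_eq_smul_addHaar' μ ν h
  rw [ContinuousLinearMap.coe_coe] at hc
  exact hc ▸ Measure.smul_absolutelyContinuous

end AEFormula

section TwoParticle

variable {K : Type u} [NormedAddCommGroup K] [InnerProductSpace ℂ K]

theorem twoPMap_eq_lpTensorMap :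
    twoPMap K = (lpTensorMap volume volume K K).toContinuousLinearMap :=
  HTensor.clm_ext fun ξ η => (extendT_ofAlg _ _).trans (lpTensorMap_tmul ξ η).symm

theorem norm_twoPMap (z : HTensor (OneP K) (OneP K)) : ‖twoPMap K z‖ = ‖z‖ := by
  rw [twoPMap_eq_lpTensorMap]
  exact (lpTensorMap volume volume K K).norm_map z

theorem inner_twoPMap (z w : HTensor (OneP K) (OneP K)) :
    inner ℂ (twoPMap K z) (twoPMap K w) = inner ℂ z w := by
  rw [twoPMap_eq_lpTensorMap]
  exact (lpTensorMap volume volume K K).inner_map_map z w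

theorem twoPMap_injective : Function.Injective (twoPMap K) :=
  (AddMonoidHomClass.isometry_of_norm (twoPMap K) norm_twoPMap).injective

theorem twoPMap_adjoint_apply (Ψ : TwoP K) :
    twoPMap K (ContinuousLinearMap.adjoint (twoPMap K) Ψ) = Ψ := by
  rw [twoPMap_eq_lpTensorMap]
  exact lpTensorMap_adjoint_apply Ψ

theorem coeFn_twoPMap_tmul (ξ η : OneP K) :
    twoPMap K (tmul ξ η) =ᵐ[volume] fun p => tmul (ξ p.1) (η p.2) := by
  have h : twoPMap K (tmul ξ η) = prodTensor ξ η := extendT_ofAlg _ _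
  exact h ▸ prodTensor_coeFn ξ η

theorem quasiMeasurePreserving_swap :
    Measure.QuasiMeasurePreserving (Prod.swap : ℝ × ℝ → ℝ × ℝ) :=
  (Measure.measurePreserving_swap (μ := volume) (ν := volume)).quasiMeasurePreserving

theorem coeFn_twistedFlip {R : ℝ → HTensor K K →L[ℂ] HTensor K K}
    (hm : ∀ x, AEStronglyMeasurable (fun θ => R θ x) volume)
    (hu : ∀ᵐ θ : ℝ, R θ ∈ unitary (HTensor K K →L[ℂ] HTensor K K)) (Ψ : TwoP K) :
    twistedFlip hm hu Ψ =ᵐ[volume] fun p => R (p.1 - p.2) (Ψ p.swap) := by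
  have hswap : MeasurePreserving Prod.swap (volume : Measure (ℝ × ℝ)) volume :=
    Measure.measurePreserving_swap
  filter_upwards [Lp.coeFn_compMeasurePreserving Ψ hswap,
    (memLp_field hm hu (Lp.compMeasurePreserving Prod.swap hswap Ψ)).coeFn_toLp] with p hΨ hR
  exact hR.trans congr(R (p.1 - p.2) $hΨ)

theorem isSelfAdjoint_of_norm_map_of_mul_self {E : Type*} [NormedAddCommGroup E]
    [InnerProductSpace ℂ E] [CompleteSpace E] {A : E →L[ℂ] E} (hA : ∀ x, ‖A x‖ = ‖x‖)
    (h2 : A * A = 1) : IsSelfAdjoint A := by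
  have hiso : star A * A = 1 := A.norm_map_iff_adjoint_comp_self.1 hA
  calc star A = star A * (A * A) := by rw [h2, mul_one]
    _ = A := by rw [← mul_assoc, hiso, one_mul]

variable {G : Type v} [Group G] {V : G →* (K ≃ₗᵢ[ℂ] K)} {Γ : Conjugation K} (R : YBFunction V Γ)

theorem coeFn_twoPMap_op (w : HTensor (OneP K) (OneP K)) :
    twoPMap K (R.op w) =ᵐ[volume] fun p => R.toFun (p.1 - p.2) (twoPMap K w p.swap) := by
  have h : twoPMap K (R.op w) = twistedFlip R.measurable R.isUnitary (twoPMap K w) :=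
    twoPMap_adjoint_apply _
  exact h ▸ coeFn_twistedFlip _ _ _

theorem op_mul_op : R.op * R.op = 1 := by
  refine ContinuousLinearMap.ext fun w => twoPMap_injective (Lp.ext ?_)
  filter_upwards [coeFn_twoPMap_op R (R.op w),
    quasiMeasurePreserving_swap.ae (coeFn_twoPMap_op R w),
    (quasiMeasurePreserving_sub volume volume).ae R.inverse] with p hRR hR hinv
  have hinv' : R.toFun (p.1 - p.2) (R.toFun (p.2 - p.1) (twoPMap K w p)) = twoPMap K w p := by
    rw [← neg_sub p.1 p.2]
    exact congr($(hinv.2) _)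
  rw [mul_apply_eq_comp, hRR, hR]
  exact hinv'

theorem norm_op (w : HTensor (OneP K) (OneP K)) : ‖R.op w‖ = ‖w‖ := by
  have hswap : eLpNorm (twoPMap K (R.op w)) 2 volume =
      eLpNorm (twoPMap K w ∘ Prod.swap) 2 volume := by
    refine eLpNorm_congr_norm_ae ?_
    filter_upwards [coeFn_twoPMap_op R w,
      (quasiMeasurePreserving_sub volume volume).ae R.isUnitary] with p hR hu
    rw [hR, ContinuousLinearMap.norm_map_of_mem_unitary hu, Function.comp_apply]
  rw [← norm_twoPMap, ← norm_twoPMap w, Lp.norm_def, Lp.norm_def, hswap]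
  exact congrArg ENNReal.toReal (eLpNorm_comp_measurePreserving
    (Lp.aestronglyMeasurable (twoPMap K w)) Measure.measurePreserving_swap)

theorem isSelfAdjoint_op : IsSelfAdjoint R.op :=
  isSelfAdjoint_of_norm_map_of_mul_self (norm_op R) (op_mul_op R)

theorem coeFn_oneTCP (ξ : OneP K) : oneTCP Γ ξ =ᵐ[volume] fun θ => Γ.map (ξ θ) :=
  Γ.map.toContinuousLinearMap.coeFn_compLpL (p := 2) (μ := volume) ξ

theorem oneTCP_involutive : Function.Involutive (oneTCP Γ) := fun ξ => by
  refine Lp.ext ?_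
  filter_upwards [coeFn_oneTCP (Γ := Γ) ξ, coeFn_oneTCP (Γ := Γ) (oneTCP Γ ξ)] with θ h₁ h₂
  rw [h₂, h₁, Γ.involutive]

theorem coeFn_twoPMap_mapConjT_flipT (w : HTensor (OneP K) (OneP K)) :
    twoPMap K (mapConjT (oneTCP Γ) (oneTCP Γ) (flipT _ _ w)) =ᵐ[volume]
      fun p => mapConjT Γ.map Γ.map (flipT K K (twoPMap K w p.swap)) := by
  refine coeFn_clm_ae_eq_of_tmul
    (A := (twoPMap K).comp ((mapConjT (oneTCP Γ) (oneTCP Γ)).toContinuousLinearMap.comp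
      (flipT _ _))) (B := twoPMap K)
    quasiMeasurePreserving_swap (fun _ => (mapConjT Γ.map Γ.map).toContinuousLinearMap.comp
      (flipT K K)) (fun ξ η => ?_) w
  change twoPMap K (mapConjT (oneTCP Γ) (oneTCP Γ) (flipT _ _ (tmul ξ η))) =ᵐ[volume]
    fun p => mapConjT Γ.map Γ.map (flipT K K (twoPMap K (tmul ξ η) p.swap))
  rw [flipT_tmul, mapConjT_tmul]
  filter_upwards [coeFn_twoPMap_tmul (oneTCP Γ η) (oneTCP Γ ξ),
    quasiMeasurePreserving_swap.ae (coeFn_twoPMap_tmul ξ η), ae_fst (coeFn_oneTCP (Γ := Γ) η),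
    ae_snd (coeFn_oneTCP (Γ := Γ) ξ)] with p hΓ h hη hξ
  rw [hΓ, h, hη, hξ, flipT_tmul, mapConjT_tmul]
  rfl

theorem flipT_mapConjT_mapConjT_flipT (x : HTensor K K) :
    flipT K K (mapConjT Γ.map Γ.map (mapConjT Γ.map Γ.map (flipT K K x))) = x := by
  induction x using HTensor.induction_on with
  | isClosed => exact isClosed_eq (by fun_prop) (by fun_prop)
  | add x y hx hy => simp only [map_add, hx, hy]
  | tmul x y => simp only [flipT_tmul, mapConjT_tmul, Γ.involutive]

theorem commutesWithReversal_op : CommutesWithReversal (oneTCP Γ) R.op := fun w => by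
  refine twoPMap_injective (Lp.ext ?_)
  filter_upwards [coeFn_twoPMap_op R (mapConjT (oneTCP Γ) (oneTCP Γ) (flipT _ _ w)),
    coeFn_twoPMap_mapConjT_flipT (Γ := Γ) (R.op w),
    quasiMeasurePreserving_swap.ae (coeFn_twoPMap_op R w),
    quasiMeasurePreserving_swap.ae (coeFn_twoPMap_mapConjT_flipT (Γ := Γ) w),
    (quasiMeasurePreserving_sub volume volume).ae R.tcp] with p hRJ hJR hR hJ htcp
  rw [hRJ, hJR, hR, hJ, ← htcp, flipT_mapConjT_mapConjT_flipT, Prod.swap_swap, Prod.fst_swap,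
    Prod.snd_swap, neg_sub]

end TwoParticle

section Braid

variable {K : Type u} [NormedAddCommGroup K] [InnerProductSpace ℂ K]

variable (K) in
/-- The canonical isometry from the three-particle space to `L²(ℝ³ → K ⊗ K ⊗ K)`. -/
def threePMap : HTensor (OneP K) (HTensor (OneP K) (OneP K)) →L[ℂ]
    Lp (HTensor K (HTensor K K)) 2 (volume : Measure (ℝ × (ℝ × ℝ))) :=
  (lpTensorMap volume volume K (HTensor K K)).toContinuousLinearMap ∘L
    mapT (ContinuousLinearMap.id ℂ _) (twoPMap K)

theorem threePMap_injective : Function.Injective (threePMap K) := by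
  have hiso : ContinuousLinearMap.adjoint (twoPMap K) ∘L twoPMap K = ContinuousLinearMap.id ℂ _ :=
    (twoPMap K).norm_map_iff_adjoint_comp_self.1 norm_twoPMap
  have hmap : mapT (ContinuousLinearMap.id ℂ (OneP K)) (ContinuousLinearMap.adjoint (twoPMap K)) ∘L
      mapT (ContinuousLinearMap.id ℂ _) (twoPMap K) = ContinuousLinearMap.id ℂ _ := by
    rw [mapT_comp_mapT, hiso, ContinuousLinearMap.id_comp, mapT_id_id]
  exact (lpTensorMap volume volume K (HTensor K K)).injective.comp
    (Function.LeftInverse.injective fun z => congr($hmap z))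

theorem coeFn_threePMap_tmul (ξ : OneP K) (w : HTensor (OneP K) (OneP K)) :
    threePMap K (tmul ξ w) =ᵐ[volume] fun p => tmul (ξ p.1) (twoPMap K w p.2) := by
  have h : threePMap K (tmul ξ w) = lpTensor ξ (twoPMap K w) :=
    congr(lpTensorMap volume volume K (HTensor K K) $(mapT_tmul ..)).trans (lpTensorMap_tmul ..)
  exact h ▸ coeFn_lpTensor ξ (twoPMap K w)

instance : (volume : Measure (ℝ × (ℝ × ℝ))).IsAddHaarMeasure :=
  inferInstanceAs ((volume : Measure ℝ).prod (volume : Measure (ℝ × ℝ))).IsAddHaarMeasure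

open ContinuousLinearMap (fst snd) in
theorem quasiMeasurePreserving_fst_fst_snd :
    Measure.QuasiMeasurePreserving (fun p : ℝ × (ℝ × ℝ) => (p.1, p.2.1)) :=
  quasiMeasurePreserving_of_surjective volume volume
    ((fst ℝ ℝ (ℝ × ℝ)).prod (fst ℝ ℝ ℝ ∘L snd ℝ ℝ (ℝ × ℝ))) fun q => ⟨(q.1, (q.2, 0)), rfl⟩

theorem quasiMeasurePreserving_snd :
    Measure.QuasiMeasurePreserving (Prod.snd : ℝ × (ℝ × ℝ) → ℝ × ℝ) :=
  Measure.quasiMeasurePreserving_snd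

open ContinuousLinearMap (fst snd) in
theorem quasiMeasurePreserving_swap_left :
    Measure.QuasiMeasurePreserving (fun p : ℝ × (ℝ × ℝ) => (p.2.1, (p.1, p.2.2))) :=
  quasiMeasurePreserving_of_surjective volume volume
    ((fst ℝ ℝ ℝ ∘L snd ℝ ℝ (ℝ × ℝ)).prod
      ((fst ℝ ℝ (ℝ × ℝ)).prod (snd ℝ ℝ ℝ ∘L snd ℝ ℝ (ℝ × ℝ))))
    fun q => ⟨(q.2.1, (q.1, q.2.2)), rfl⟩

open ContinuousLinearMap (fst snd) in
theorem quasiMeasurePreserving_swap_right :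
    Measure.QuasiMeasurePreserving (fun p : ℝ × (ℝ × ℝ) => (p.1, p.2.swap)) :=
  quasiMeasurePreserving_of_surjective volume volume
    ((fst ℝ ℝ (ℝ × ℝ)).prod
      ((snd ℝ ℝ ℝ ∘L snd ℝ ℝ (ℝ × ℝ)).prod (fst ℝ ℝ ℝ ∘L snd ℝ ℝ (ℝ × ℝ))))
    fun q => ⟨(q.1, q.2.swap), rfl⟩

open ContinuousLinearMap (fst snd) in
theorem quasiMeasurePreserving_sub_sub :
    Measure.QuasiMeasurePreserving (fun p : ℝ × (ℝ × ℝ) => (p.1 - p.2.1, p.2.1 - p.2.2)) :=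
  quasiMeasurePreserving_of_surjective volume volume
    ((fst ℝ ℝ (ℝ × ℝ) - fst ℝ ℝ ℝ ∘L snd ℝ ℝ (ℝ × ℝ)).prod
      (fst ℝ ℝ ℝ ∘L snd ℝ ℝ (ℝ × ℝ) - snd ℝ ℝ ℝ ∘L snd ℝ ℝ (ℝ × ℝ)))
    fun q => ⟨(q.1 + q.2, (q.2, 0)), by simp⟩

theorem coeFn_threePMap_assocT (w : HTensor (OneP K) (OneP K)) (ζ : OneP K) :
    threePMap K (assocT _ _ _ (tmul w ζ)) =ᵐ[volume]
      fun p => assocT K K K (tmul (twoPMap K w (p.1, p.2.1)) (ζ p.2.2)) := by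
  refine coeFn_clm_ae_eq_of_tmul
    (A := threePMap K ∘L (assocT _ _ _).toContinuousLinearEquiv.toContinuousLinearMap ∘L
      (tmulL (HTensor (OneP K) (OneP K)) (OneP K)).flip ζ) (B := twoPMap K)
    quasiMeasurePreserving_fst_fst_snd
    (fun p => (assocT K K K).toContinuousLinearEquiv.toContinuousLinearMap ∘L
      (tmulL (HTensor K K) K).flip (ζ p.2.2)) (fun ξ η => ?_) w
  change threePMap K (assocT _ _ _ (tmul (tmul ξ η) ζ)) =ᵐ[volume]
    fun p => assocT K K K (tmul (twoPMap K (tmul ξ η) (p.1, p.2.1)) (ζ p.2.2))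
  rw [assocT_tmul]
  filter_upwards [coeFn_threePMap_tmul ξ (tmul η ζ),
    quasiMeasurePreserving_fst_fst_snd.ae (coeFn_twoPMap_tmul ξ η),
    quasiMeasurePreserving_snd.ae (coeFn_twoPMap_tmul η ζ)] with p hξηζ hξη hηζ
  rw [hξηζ, hξη, hηζ, assocT_tmul]

variable {G : Type v} [Group G] {V : G →* (K ≃ₗᵢ[ℂ] K)} {Γ : Conjugation K} (R : YBFunction V Γ)

theorem coeFn_threePMap_mapT_id_op (z : HTensor (OneP K) (HTensor (OneP K) (OneP K))) :
    threePMap K (mapT (ContinuousLinearMap.id ℂ _) R.op z) =ᵐ[volume]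
      fun p => mapT (ContinuousLinearMap.id ℂ K) (R.toFun (p.2.1 - p.2.2))
        (threePMap K z (p.1, p.2.swap)) := by
  refine coeFn_clm_ae_eq_of_tmul (A := threePMap K ∘L mapT (ContinuousLinearMap.id ℂ _) R.op)
    (B := threePMap K) quasiMeasurePreserving_swap_right
    (fun p => mapT (ContinuousLinearMap.id ℂ K) (R.toFun (p.2.1 - p.2.2))) (fun ξ w => ?_) z
  rw [ContinuousLinearMap.comp_apply, mapT_tmul]
  filter_upwards [coeFn_threePMap_tmul ξ (R.op w),
    quasiMeasurePreserving_swap_right.ae (coeFn_threePMap_tmul ξ w),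
    quasiMeasurePreserving_snd.ae (coeFn_twoPMap_op R w)] with p hRw hw hR
  rw [ContinuousLinearMap.id_apply, hRw, hw, hR, mapT_tmul, ContinuousLinearMap.id_apply]

theorem coeFn_threePMap_leftAmp_op (z : HTensor (OneP K) (HTensor (OneP K) (OneP K))) :
    threePMap K (leftAmp _ R.op z) =ᵐ[volume]
      fun p => leftAmp K (R.toFun (p.1 - p.2.1)) (threePMap K z (p.2.1, (p.1, p.2.2))) := by
  obtain ⟨z, rfl⟩ := (assocT (OneP K) (OneP K) (OneP K)).surjective z
  refine coeFn_clm_ae_eq_of_tmul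
    (A := threePMap K ∘L leftAmp _ R.op ∘L
      (assocT _ _ _).toContinuousLinearEquiv.toContinuousLinearMap)
    (B := threePMap K ∘L (assocT _ _ _).toContinuousLinearEquiv.toContinuousLinearMap)
    quasiMeasurePreserving_swap_left (fun p => leftAmp K (R.toFun (p.1 - p.2.1)))
    (fun w ζ => ?_) z
  change threePMap K (leftAmp _ R.op (assocT _ _ _ (tmul w ζ))) =ᵐ[volume]
    fun p => leftAmp K (R.toFun (p.1 - p.2.1))
      (threePMap K (assocT _ _ _ (tmul w ζ)) (p.2.1, (p.1, p.2.2)))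
  rw [leftAmp_assocT_tmul]
  filter_upwards [coeFn_threePMap_assocT (R.op w) ζ,
    quasiMeasurePreserving_swap_left.ae (coeFn_threePMap_assocT w ζ),
    quasiMeasurePreserving_fst_fst_snd.ae (coeFn_twoPMap_op R w)] with p hRw hw hR
  rw [hRw, hw, hR, leftAmp_assocT_tmul]
  rfl

theorem braided_op : Braided R.op := by
  refine ContinuousLinearMap.ext fun z => threePMap_injective (Lp.ext ?_)
  simp only [ContinuousLinearMap.comp_apply]
  set T₁ := leftAmp (OneP K) R.op
  set T₂ := mapT (ContinuousLinearMap.id ℂ (OneP K)) R.op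
  filter_upwards [coeFn_threePMap_leftAmp_op R (T₂ (T₁ z)),
    quasiMeasurePreserving_swap_left.ae (coeFn_threePMap_mapT_id_op R (T₁ z)),
    quasiMeasurePreserving_swap_left.ae
      (quasiMeasurePreserving_swap_right.ae (coeFn_threePMap_leftAmp_op R z)),
    coeFn_threePMap_mapT_id_op R (T₁ (T₂ z)),
    quasiMeasurePreserving_swap_right.ae (coeFn_threePMap_leftAmp_op R (T₂ z)),
    quasiMeasurePreserving_swap_right.ae
      (quasiMeasurePreserving_swap_left.ae (coeFn_threePMap_mapT_id_op R z)),
    quasiMeasurePreserving_sub_sub.ae R.yang_baxter] with p h₁₂₁ h₂₁ h₁ h₂₁₂ h₁₂ h₂ hYB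
  simp only [Prod.swap] at h₁₂₁ h₂₁ h₁ h₂₁₂ h₁₂ h₂ hYB
  rw [h₁₂₁, h₂₁, h₁, h₂₁₂, h₁₂, h₂]
  simpa using congr($hYB (threePMap K z (p.2.2, (p.2.1, p.1))))

end Braid

section Monodromy

variable {H : Type u} [NormedAddCommGroup H] [InnerProductSpace ℂ H]

theorem inner_consTwo (n : ℕ) (w w' : HTensor H H) (x y : Pow H n) :
    inner ℂ (consTwo n w x) (consTwo n w' y) = inner ℂ w w' * inner ℂ x y := by
  rw [consTwo_apply, consTwo_apply]
  exact ((powCons H (n + 1)).inner_map_map _ _).trans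
    (((assocT H H (Pow H n)).inner_map_map _ _).trans (inner_tmul_tmul w w' x y))

theorem Pow.clm_ext_of_topologicalClosure_span {S : Set H}
    (hS : (Submodule.span ℂ S).topologicalClosure = ⊤) {n : ℕ} {W : Type*} [NormedAddCommGroup W]
    [NormedSpace ℂ W] {σ : ℂ →+* ℂ} {A B : Pow H (n + 1) →SL[σ] W}
    (h : ∀ a ∈ S, ∀ x, A (consOp a n x) = B (consOp a n x)) : A = B := by
  refine Pow.clm_ext fun a x => ?_
  let consRight : H →L[ℂ] Pow H (n + 1) :=
    (powCons H n).toContinuousLinearEquiv.toContinuousLinearMap ∘L (tmulL H (Pow H n)).flip x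
  have : A.comp consRight = B.comp consRight :=
    ContinuousLinearMap.ext_on ((Submodule.dense_iff_topologicalClosure_eq_top).2 hS)
      fun a ha => h a ha x
  exact congr($this a)

variable (T : HTensor H H →L[ℂ] HTensor H H)

theorem exchangeOp_zero (η ξ : H) (x : Pow H 0) : exchangeOp T η ξ 0 x = inner ℂ η ξ • x := by
  simp only [exchangeOp, ContinuousLinearMap.comp_apply, snocOp_zero, legChain, one_apply_eq_self,
    unconsOp_consOp]

variable [CompleteSpace H]

/-- The partial matrix element of `T` with `⟪η, partialElem T φ ψ b⟫ = ⟪η ⊗ φ, T (ψ ⊗ b)⟫`. -/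
def partialElem (φ ψ : H) : H →L[ℂ] H :=
  ContinuousLinearMap.adjoint ((tmulL H H).flip φ) ∘L T ∘L tmulL H H ψ

theorem inner_partialElem (φ ψ η b : H) :
    inner ℂ η (partialElem T φ ψ b) = inner ℂ (tmul η φ) (T (tmul ψ b)) := by
  rw [partialElem, ContinuousLinearMap.comp_apply, ContinuousLinearMap.adjoint_inner_right]
  rfl

/-- The product of the partial matrix elements of `T` at a list of pairs of vectors, with an
operator `Q` inserted after each factor. The matrix elements of the exchange operators are those of
`monodromy T id`; a finite-rank cutoff `Q` decouples the factors. -/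
def monodromy (Q : H →L[ℂ] H) : List (H × H) → (H →L[ℂ] H)
  | [] => ContinuousLinearMap.id ℂ H
  | p :: l => partialElem T p.1 p.2 ∘L Q ∘L monodromy Q l

theorem inner_leg_zero_consOp (n : ℕ) (η φ ψ : H) (z : Pow H n) (y : Pow H (n + 1)) :
    inner ℂ (consOp η (n + 1) (consOp φ n z)) (leg T (n + 2) 0 (consOp ψ (n + 1) y)) =
      inner ℂ (consOp (ContinuousLinearMap.adjoint (partialElem T φ ψ) η) n z) y := by
  induction y using Pow.induction_cons with
  | isClosed => exact isClosed_eq (by fun_prop) (by fun_prop)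
  | add a b ha hb => simp only [map_add, inner_add_right, ha, hb]
  | cons b y =>
    rw [← consTwo_tmul, ← consTwo_tmul, leg_zero_consTwo, inner_consTwo, inner_consOp_consOp,
      ContinuousLinearMap.adjoint_inner_left, inner_partialElem]

theorem inner_exchangeOp_consOp (η ξ φ ψ : H) (n : ℕ) (z x : Pow H n) :
    inner ℂ (consOp φ n z) (exchangeOp T η ξ (n + 1) (consOp ψ n x)) =
      inner ℂ z (exchangeOp T (ContinuousLinearMap.adjoint (partialElem T φ ψ) η) ξ n x) := by
  simp only [exchangeOp, ContinuousLinearMap.comp_apply, unconsOp,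
    ContinuousLinearMap.adjoint_inner_right, legChain_succ, mul_apply_eq_comp, snocOp_consOp,
    legChain_succ_consOp]
  exact inner_leg_zero_consOp T n η φ ψ z _

theorem exchangeOp_eq_adjoint {S : Set H} (hS : (Submodule.span ℂ S).topologicalClosure = ⊤)
    {η ξ ξ' η' : H}
    (h : ∀ l : List (H × H), (∀ p ∈ l, p.1 ∈ S ∧ p.2 ∈ S) →
      inner ℂ η (monodromy T (ContinuousLinearMap.id ℂ H) l ξ') =
        inner ℂ (monodromy T (ContinuousLinearMap.id ℂ H) (l.map Prod.swap) η') ξ) (n : ℕ) :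
    exchangeOp T η ξ' n = ContinuousLinearMap.adjoint (exchangeOp T ξ η' n) := by
  induction n generalizing η ξ with
  | zero =>
    refine ContinuousLinearMap.ext fun x => ext_inner_left ℂ fun y => ?_
    rw [ContinuousLinearMap.adjoint_inner_right, exchangeOp_zero, exchangeOp_zero, inner_smul_left,
      inner_smul_right, inner_conj_symm]
    exact congr($(h [] (by simp)) * _)
  | succ n ih =>
    refine Pow.clm_ext_of_topologicalClosure_span hS fun ψ hψ x => ext_inner_right ℂ fun y => ?_
    suffices innerSL ℂ (exchangeOp T η ξ' (n + 1) (consOp ψ n x)) =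
        innerSL ℂ (ContinuousLinearMap.adjoint (exchangeOp T ξ η' (n + 1)) (consOp ψ n x)) from
      congr($this y)
    refine Pow.clm_ext_of_topologicalClosure_span hS fun φ hφ z => ?_
    have hstep : exchangeOp T (ContinuousLinearMap.adjoint (partialElem T φ ψ) η) ξ' n =
        ContinuousLinearMap.adjoint
          (exchangeOp T (ContinuousLinearMap.adjoint (partialElem T ψ φ) ξ) η' n) := by
      refine ih fun l hl => ?_
      rw [ContinuousLinearMap.adjoint_inner_left, ContinuousLinearMap.adjoint_inner_right]
      exact h ((φ, ψ) :: l) (List.forall_mem_cons.2 ⟨⟨hφ, hψ⟩, hl⟩)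
    rw [innerSL_apply_apply, innerSL_apply_apply, ← inner_conj_symm, inner_exchangeOp_consOp,
      ContinuousLinearMap.adjoint_inner_left, inner_exchangeOp_consOp, hstep,
      ContinuousLinearMap.adjoint_inner_right, inner_conj_symm]

theorem tendsto_monodromy {ι : Type*} {l : Filter ι} {Q : ι → H →L[ℂ] H}
    (hQ : ∀ i x, ‖Q i x‖ ≤ ‖x‖) (hlim : ∀ x, Tendsto (fun i => Q i x) l (𝓝 x))
    (L : List (H × H)) (x : H) : Tendsto (fun i => monodromy T (Q i) L x) l
      (𝓝 (monodromy T (ContinuousLinearMap.id ℂ H) L x)) := by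
  induction L with
  | nil => exact tendsto_const_nhds
  | cons p L ih =>
    refine ((partialElem T p.1 p.2).continuous.tendsto _).comp ?_
    set y := monodromy T (ContinuousLinearMap.id ℂ H) L x
    have herr : Tendsto (fun i => Q i (monodromy T (Q i) L x - y)) l (𝓝 0) :=
      squeeze_zero_norm (fun i => hQ i _) (tendsto_iff_norm_sub_tendsto_zero.1 ih)
    simpa using herr.add (hlim y)

end Monodromy

section TensorVec

variable {α : Type*} [MeasurableSpace α] {μ : Measure α} {K : Type u} [NormedAddCommGroup K]
  [InnerProductSpace ℂ K]

variable (μ) in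
/-- The map `h ↦ h ⊗ e` from `L²(μ)` to `L²(μ, K)`, see `tensorVec`. -/
def tensorL (e : K) : Lp ℂ 2 μ →L[ℂ] Lp K 2 μ :=
  (ContinuousLinearMap.toSpanSingleton ℂ e).compLpL 2 μ

theorem coeFn_tensorL (e : K) (h : Lp ℂ 2 μ) : tensorL μ e h =ᵐ[μ] fun θ => h θ • e :=
  (ContinuousLinearMap.toSpanSingleton ℂ e).coeFn_compLpL h

theorem inner_tensorL_tensorL (e e' : K) (h h' : Lp ℂ 2 μ) :
    inner ℂ (tensorL μ e h) (tensorL μ e' h') = inner ℂ e e' * inner ℂ h h' := by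
  rw [L2.inner_def, L2.inner_def, ← integral_const_mul]
  refine integral_congr_ae ?_
  filter_upwards [coeFn_tensorL e h, coeFn_tensorL e' h'] with θ he he'
  rw [he, he', inner_smul_left, inner_smul_right, RCLike.inner_apply]
  ring

/-- The map `e ↦ h ⊗ e` from `K` to `L²(μ, K)`. -/
def tensorR (h : Lp ℂ 2 μ) : K →L[ℂ] Lp K 2 μ :=
  LinearMap.mkContinuous
    { toFun := fun e => tensorL μ e h
      map_add' := fun e e' => by
        simp only [tensorL, ContinuousLinearMap.toSpanSingleton_add,
          ContinuousLinearMap.add_compLpL, add_apply]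
      map_smul' := fun c e => by
        simp only [tensorL, ContinuousLinearMap.toSpanSingleton_smul,
          ContinuousLinearMap.smul_compLpL, smul_apply, RingHom.id_apply] }
    ‖h‖ fun e => by
      have hsq : ‖tensorL μ e h‖ ^ 2 = (‖e‖ * ‖h‖) ^ 2 := by
        have := inner_tensorL_tensorL e e h h
        simp only [inner_self_eq_norm_sq_to_K, ← mul_pow] at this
        exact_mod_cast this
      rw [mul_comm]
      exact ((pow_left_inj₀ (norm_nonneg _) (by positivity) two_ne_zero).1 hsq).le

variable (μ K) in
/-- The elementary vectors `h ⊗ e` of `L²(μ, K)`. -/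
def elementary : Set (Lp K 2 μ) := {ξ | ∃ h e, ξ = tensorL μ e h}

variable (μ K) in
theorem topologicalClosure_span_elementary :
    (Submodule.span ℂ (elementary μ K)).topologicalClosure = ⊤ := by
  refine eq_top_iff.2 fun ξ _ => Lp.induction (by simp)
    (· ∈ (Submodule.span ℂ (elementary μ K)).topologicalClosure) (fun c s hs hμ => ?_)
    (fun f g hf hg _ hf' hg' => add_mem hf' hg') (Submodule.isClosed_topologicalClosure _) ξ
  refine Submodule.le_topologicalClosure _ (Submodule.subset_span
    ⟨indicatorConstLp 2 hs hμ.ne (1 : ℂ), c, Lp.ext ?_⟩)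
  rw [Lp.simpleFunc.coe_indicatorConst]
  filter_upwards [indicatorConstLp_coeFn (p := 2) (hs := hs) (hμs := hμ.ne) (c := c),
    indicatorConstLp_coeFn (p := 2) (hs := hs) (hμs := hμ.ne) (c := (1 : ℂ)),
    coeFn_tensorL c (indicatorConstLp 2 hs hμ.ne (1 : ℂ))] with θ hc h1 ht
  rw [hc, ht, h1]
  by_cases hθ : θ ∈ s <;> simp [hθ]

variable [CompleteSpace K]

theorem adjoint_tensorL_tensorL (e e' : K) (h : Lp ℂ 2 μ) :
    ContinuousLinearMap.adjoint (tensorL μ e) (tensorL μ e' h) = inner ℂ e e' • h := by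
  refine ext_inner_left ℂ fun p => ?_
  rw [ContinuousLinearMap.adjoint_inner_right, inner_tensorL_tensorL, inner_smul_right]

variable {ι : Type*} {b : ι → K}

variable (μ b) in
/-- The fibrewise projection of `L²(μ, K)` onto the span of finitely many members of an orthonormal
family. -/
def fibreProj (s : Finset ι) : Lp K 2 μ →L[ℂ] Lp K 2 μ :=
  ∑ i ∈ s, tensorL μ (b i) ∘L ContinuousLinearMap.adjoint (tensorL μ (b i))

theorem fibreProj_apply (s : Finset ι) (ξ : Lp K 2 μ) : fibreProj μ b s ξ =
    ∑ i ∈ s, tensorL μ (b i) (ContinuousLinearMap.adjoint (tensorL μ (b i)) ξ) := by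
  simp [fibreProj]

theorem isStarProjection_fibreProj (hb : Orthonormal ℂ b) (s : Finset ι) :
    IsStarProjection (fibreProj μ b s) where
  isIdempotentElem := by
    classical
    refine ContinuousLinearMap.ext fun ξ => ?_
    have hcoord : ∀ i ∈ s, ContinuousLinearMap.adjoint (tensorL μ (b i)) (fibreProj μ b s ξ) =
        ContinuousLinearMap.adjoint (tensorL μ (b i)) ξ := fun i hi => by
      rw [fibreProj_apply, map_sum]
      simp only [adjoint_tensorL_tensorL, orthonormal_iff_ite.1 hb]
      simp [hi]
    calc fibreProj μ b s (fibreProj μ b s ξ)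
      _ = ∑ i ∈ s, tensorL μ (b i) (ContinuousLinearMap.adjoint (tensorL μ (b i)) ξ) := by
        rw [fibreProj_apply]
        exact Finset.sum_congr rfl fun i hi => congr(tensorL μ (b i) $(hcoord i hi))
      _ = fibreProj μ b s ξ := (fibreProj_apply s ξ).symm
  isSelfAdjoint := isSelfAdjoint_sum _ fun i _ => by
    rw [ContinuousLinearMap.isSelfAdjoint_iff', ContinuousLinearMap.adjoint_comp,
      ContinuousLinearMap.adjoint_adjoint]

theorem norm_fibreProj_apply_le (hb : Orthonormal ℂ b) (s : Finset ι) (ξ : Lp K 2 μ) :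
    ‖fibreProj μ b s ξ‖ ≤ ‖ξ‖ :=
  (fibreProj μ b s).le_of_opNorm_le ((isStarProjection_fibreProj hb s).norm_le _) ξ |>.trans_eq
    (one_mul _)

theorem tendsto_fibreProj (hb : Orthonormal ℂ b)
    (hsum : ∀ x, HasSum (fun i => inner ℂ (b i) x • b i) x) (ξ : Lp K 2 μ) :
    Tendsto (fun s => fibreProj μ b s ξ) atTop (𝓝 ξ) := by
  have hequi : Equicontinuous fun (s : Finset ι) ξ => fibreProj μ b s ξ :=
    (LipschitzWith.uniformEquicontinuous _ _ fun s => AddMonoidHomClass.lipschitz_of_bound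
      (fibreProj μ b s) 1 fun ξ => by
        simpa only [one_mul] using norm_fibreProj_apply_le hb s ξ).equicontinuous
  have helem (h : Lp ℂ 2 μ) (e : K) (s : Finset ι) : fibreProj μ b s (tensorL μ e h) =
      tensorR h (∑ i ∈ s, inner ℂ (b i) e • b i) := by
    rw [fibreProj_apply, map_sum]
    refine Finset.sum_congr rfl fun i _ => ?_
    rw [adjoint_tensorL_tensorL, map_smul, map_smul]
    rfl
  refine (hequi.isClosed_setOfPred_tendsto continuous_id).closure_subset_iff.2 (fun ξ hξ => ?_)
    (?_ : ξ ∈ closure (Submodule.span ℂ (elementary μ K) : Set (Lp K 2 μ)))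
  · induction hξ using Submodule.span_induction with
    | mem ξ hξ =>
      obtain ⟨h, e, rfl⟩ := hξ
      simp only [Set.mem_ofPred_eq, helem]
      exact ((tensorR h).continuous.tendsto e).comp (hsum e)
    | zero => simp
    | add ξ ζ _ _ hξ hζ => simpa using hξ.add hζ
    | smul c ξ _ hξ => simpa using hξ.const_smul c
  · rw [← Submodule.topologicalClosure_coe, topologicalClosure_span_elementary]
    trivial

end TensorVec

section StripAnalysis

theorem isOpen_strip : IsOpen strip :=
  (isOpen_lt continuous_const Complex.continuous_im).inter
    (isOpen_lt Complex.continuous_im continuous_const)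

theorem ofReal_add_mem_strip {c : ℂ} (hc : c ∈ strip) (x : ℝ) : (x : ℂ) + c ∈ strip := by
  simpa [strip] using hc

theorem ofReal_mul_I_mem_strip {y : ℝ} (h0 : 0 < y) (h1 : y < Real.pi) :
    (y : ℂ) * Complex.I ∈ strip := by
  constructor <;> simpa

theorem continuous_horizontal {M : ℂ → ℂ} (hM : DifferentiableOn ℂ M strip) {c : ℂ}
    (hc : c ∈ strip) : Continuous fun x : ℝ => M (x + c) :=
  hM.continuousOn.comp_continuous (by fun_prop) fun x => ofReal_add_mem_strip hc x

theorem eventually_lower_mem_strip : ∀ᶠ ε : ℝ in 𝓝[>] 0, (ε : ℂ) * Complex.I ∈ strip := by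
  filter_upwards [Ioo_mem_nhdsGT Real.pi_pos] with ε hε
  exact ofReal_mul_I_mem_strip hε.1 hε.2

theorem eventually_upper_mem_strip :
    ∀ᶠ ε : ℝ in 𝓝[>] 0, (Real.pi : ℂ) * Complex.I - ε * Complex.I ∈ strip := by
  filter_upwards [Ioo_mem_nhdsGT Real.pi_pos] with ε hε
  constructor <;> simp [hε.1, hε.2]

theorem integrable_horizontal {M : ℂ → ℂ} (hM : DifferentiableOn ℂ M strip) {C : ℝ}
    (hC : ∀ ζ ∈ strip, ‖M ζ‖ ≤ C * (1 + ζ.re ^ 2)⁻¹) {y : ℝ} (h0 : 0 < y) (h1 : y < Real.pi) :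
    Integrable fun x : ℝ => M (x + y * Complex.I) := by
  have hy := ofReal_mul_I_mem_strip h0 h1
  refine (integrable_inv_one_add_sq.const_mul C).mono'
    (continuous_horizontal hM hy).aestronglyMeasurable (Eventually.of_forall fun x => ?_)
  simpa using hC _ (ofReal_add_mem_strip hy x)

theorem tendsto_integral_vertical {M : ℂ → ℂ} {C : ℝ}
    (hC : ∀ ζ ∈ strip, ‖M ζ‖ ≤ C * (1 + ζ.re ^ 2)⁻¹) {y₀ y₁ : ℝ} (h0 : 0 < y₀) (h01 : y₀ ≤ y₁)
    (h1 : y₁ < Real.pi) {x : ℝ → ℝ} {l : Filter ℝ} (hx : Tendsto (fun r => x r ^ 2) l atTop) :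
    Tendsto (fun r => ∫ y in y₀..y₁, M (x r + y * Complex.I)) l (𝓝 0) := by
  refine squeeze_zero_norm (a := fun r => C * (1 + x r ^ 2)⁻¹ * |y₁ - y₀|) (fun r => ?_) ?_
  · refine intervalIntegral.norm_integral_le_of_norm_le_const fun y hy => ?_
    rw [Set.uIoc_of_le h01] at hy
    simpa using hC _ (ofReal_add_mem_strip
      (ofReal_mul_I_mem_strip (h0.trans hy.1) (hy.2.trans_lt h1)) (x r))
  · have h : Tendsto (fun r => (1 + x r ^ 2)⁻¹) l (𝓝 0) :=
      tendsto_inv_atTop_zero.comp (tendsto_atTop_add_const_left _ _ hx)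
    simpa using (h.const_mul C).mul_const |y₁ - y₀|

theorem integral_rect_sub {M : ℂ → ℂ} (hM : DifferentiableOn ℂ M strip) {y₀ y₁ : ℝ} (h0 : 0 < y₀)
    (h01 : y₀ ≤ y₁) (h1 : y₁ < Real.pi) (r : ℝ) :
    ((∫ x in (-r)..r, M (x + y₀ * Complex.I)) - ∫ x in (-r)..r, M (x + y₁ * Complex.I)) =
      Complex.I * (∫ y in y₀..y₁, M ((-r : ℝ) + y * Complex.I)) -
        Complex.I * ∫ y in y₀..y₁, M (r + y * Complex.I) := by
  have hrect := Complex.integral_boundary_rect_eq_zero_of_differentiableOn M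
    ((-r : ℝ) + y₀ * Complex.I) (r + y₁ * Complex.I) (hM.mono fun ζ hζ => by
      have hζ : ζ.im ∈ Set.Icc y₀ y₁ := by simpa [Set.uIcc_of_le h01] using hζ.2
      exact ⟨h0.trans_le hζ.1, hζ.2.trans_lt h1⟩)
  simp only [Complex.add_im, Complex.ofReal_im, Complex.mul_im, Complex.ofReal_re,
    Complex.I_im, mul_one, Complex.I_re, mul_zero, add_zero, zero_add, Complex.add_re,
    Complex.mul_re, sub_self, smul_eq_mul] at hrect
  linear_combination hrect

theorem integral_horizontal_eq {M : ℂ → ℂ} (hM : DifferentiableOn ℂ M strip) {C : ℝ}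
    (hC : ∀ ζ ∈ strip, ‖M ζ‖ ≤ C * (1 + ζ.re ^ 2)⁻¹) {y₀ y₁ : ℝ} (h0 : 0 < y₀) (h01 : y₀ ≤ y₁)
    (h1 : y₁ < Real.pi) :
    ∫ x : ℝ, M (x + y₀ * Complex.I) = ∫ x : ℝ, M (x + y₁ * Complex.I) := by
  have hhorizontal (y : ℝ) (hy0 : 0 < y) (hy1 : y < Real.pi) :=
    intervalIntegral_tendsto_integral (integrable_horizontal hM hC hy0 hy1)
      tendsto_neg_atTop_atBot tendsto_id
  have hsq : Tendsto (fun r : ℝ => r ^ 2) atTop atTop := tendsto_pow_atTop two_ne_zero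
  have hvertical :=
    ((tendsto_integral_vertical hC h0 h01 h1 (x := fun r => -r)
      (by simpa only [neg_sq] using hsq)).const_mul Complex.I).sub
    ((tendsto_integral_vertical hC h0 h01 h1 (x := fun r => r) hsq).const_mul Complex.I)
  rw [mul_zero, sub_zero] at hvertical
  exact sub_eq_zero.1 (tendsto_nhds_unique (((hhorizontal y₀ h0 (h01.trans_lt h1)).sub
    (hhorizontal y₁ (h0.trans_le h01) h1)).congr (integral_rect_sub hM h0 h01 h1)) hvertical)

theorem tendsto_integral_horizontal {M : ℂ → ℂ} (hM : DifferentiableOn ℂ M strip) {C : ℝ}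
    (hC : ∀ ζ ∈ strip, ‖M ζ‖ ≤ C * (1 + ζ.re ^ 2)⁻¹) {c : ℝ → ℂ}
    (hc : ∀ᶠ ε in 𝓝[>] 0, c ε ∈ strip) {a : ℝ → ℂ}
    (ha : ∀ θ : ℝ, Tendsto (fun ε => M (θ + c ε)) (𝓝[>] 0) (𝓝 (a θ)))
    (hre : ∀ ε, (c ε).re = 0) :
    Tendsto (fun ε => ∫ θ : ℝ, M (θ + c ε)) (𝓝[>] 0) (𝓝 (∫ θ, a θ)) := by
  refine tendsto_integral_filter_of_dominated_convergence (fun θ => C * (1 + θ ^ 2)⁻¹) ?_ ?_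
    (integrable_inv_one_add_sq.const_mul C) (Eventually.of_forall ha)
  · filter_upwards [hc] with ε hε using (continuous_horizontal hM hε).aestronglyMeasurable
  · filter_upwards [hc] with ε hε
    exact Eventually.of_forall fun θ => by simpa [hre] using hC _ (ofReal_add_mem_strip hε θ)

theorem integral_boundary_eq {M : ℂ → ℂ} (hM : DifferentiableOn ℂ M strip) {C : ℝ}
    (hC : ∀ ζ ∈ strip, ‖M ζ‖ ≤ C * (1 + ζ.re ^ 2)⁻¹) {a b : ℝ → ℂ}
    (ha : ∀ θ : ℝ, Tendsto (fun ε : ℝ => M (θ + ε * Complex.I)) (𝓝[>] 0) (𝓝 (a θ)))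
    (hb : ∀ θ : ℝ, Tendsto (fun ε : ℝ => M (θ + (Real.pi * Complex.I - ε * Complex.I))) (𝓝[>] 0)
      (𝓝 (b θ))) : ∫ θ, a θ = ∫ θ, b θ := by
  refine tendsto_nhds_unique
    (tendsto_integral_horizontal hM hC eventually_lower_mem_strip ha (by simp))
    ((tendsto_integral_horizontal hM hC eventually_upper_mem_strip hb (by simp)).congr' ?_)
  filter_upwards [Ioo_mem_nhdsGT Real.pi_div_two_pos] with ε hε
  simpa only [Complex.ofReal_sub, sub_mul] using
    (integral_horizontal_eq hM hC hε.1 (by linarith [hε.2]) (sub_lt_self _ hε.1)).symm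

/-- The functions `a`, `b` are the boundary values, on the lower and on the upper edge, of a bounded
analytic function on the strip. -/
def StripPair (a b : ℝ → ℂ) : Prop :=
  ∃ M : ℂ → ℂ, DifferentiableOn ℂ M strip ∧ (∃ C : ℝ, ∀ ζ ∈ strip, ‖M ζ‖ ≤ C) ∧
    (∀ θ : ℝ, Tendsto (fun ε : ℝ => M (θ + ε * Complex.I)) (𝓝[>] 0) (𝓝 (a θ))) ∧
    (∀ θ : ℝ, Tendsto (fun ε : ℝ => M (θ + (Real.pi * Complex.I - ε * Complex.I))) (𝓝[>] 0)
      (𝓝 (b θ)))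

namespace StripPair

theorem const (c : ℂ) : StripPair (fun _ => c) (fun _ => c) :=
  ⟨fun _ => c, differentiableOn_const c, ⟨‖c‖, fun _ _ => le_rfl⟩, fun _ => tendsto_const_nhds,
    fun _ => tendsto_const_nhds⟩

theorem add {a b a' b' : ℝ → ℂ} (h : StripPair a b) (h' : StripPair a' b') :
    StripPair (fun θ => a θ + a' θ) (fun θ => b θ + b' θ) := by
  obtain ⟨M, hM, ⟨C, hC⟩, ha, hb⟩ := h
  obtain ⟨M', hM', ⟨C', hC'⟩, ha', hb'⟩ := h'
  exact ⟨fun ζ => M ζ + M' ζ, hM.add hM', ⟨C + C', fun ζ hζ => (norm_add_le _ _).trans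
    (add_le_add (hC ζ hζ) (hC' ζ hζ))⟩, fun θ => (ha θ).add (ha' θ), fun θ => (hb θ).add (hb' θ)⟩

theorem mul {a b a' b' : ℝ → ℂ} (h : StripPair a b) (h' : StripPair a' b') :
    StripPair (fun θ => a θ * a' θ) (fun θ => b θ * b' θ) := by
  obtain ⟨M, hM, ⟨C, hC⟩, ha, hb⟩ := h
  obtain ⟨M', hM', ⟨C', hC'⟩, ha', hb'⟩ := h'
  refine ⟨fun ζ => M ζ * M' ζ, hM.mul hM', ⟨C * C', fun ζ hζ => ?_⟩, fun θ => (ha θ).mul (ha' θ),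
    fun θ => (hb θ).mul (hb' θ)⟩
  rw [norm_mul]
  exact mul_le_mul (hC ζ hζ) (hC' ζ hζ) (norm_nonneg _) ((norm_nonneg _).trans (hC ζ hζ))

theorem sum {ι : Type*} (F : Finset ι) {a b : ι → ℝ → ℂ} (h : ∀ i, StripPair (a i) (b i)) :
    StripPair (fun θ => ∑ i ∈ F, a i θ) (fun θ => ∑ i ∈ F, b i θ) := by
  classical
  induction F using Finset.induction_on with
  | empty => simpa using StripPair.const 0
  | insert i F hi ih => simpa only [Finset.sum_insert hi] using (h i).add ih

end StripPair

theorem aestronglyMeasurable_boundary {M : ℂ → ℂ} (hM : DifferentiableOn ℂ M strip) {c : ℝ → ℂ}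
    (hc : ∀ᶠ ε in 𝓝[>] 0, c ε ∈ strip) {a : ℝ → ℂ}
    (ha : ∀ θ : ℝ, Tendsto (fun ε => M (θ + c ε)) (𝓝[>] 0) (𝓝 (a θ))) :
    AEStronglyMeasurable a volume := by
  obtain ⟨ε, hε⟩ := (𝓝[>] (0 : ℝ)).exists_seq_tendsto
  obtain ⟨n₀, hn₀⟩ := eventually_atTop.1 (hε.eventually hc)
  exact aestronglyMeasurable_of_tendsto_ae atTop (f := fun n (θ : ℝ) => M (θ + c (ε (n + n₀))))
    (fun n => (continuous_horizontal hM (hn₀ _ (Nat.le_add_left n₀ n))).aestronglyMeasurable)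
    (Eventually.of_forall fun θ => ((ha θ).comp hε).comp (tendsto_add_atTop_nat n₀))

theorem norm_boundary_le {M : ℂ → ℂ} {C : ℝ} (hC : ∀ ζ ∈ strip, ‖M ζ‖ ≤ C) {c : ℝ → ℂ}
    (hc : ∀ᶠ ε in 𝓝[>] 0, c ε ∈ strip) {θ : ℝ} {a : ℂ}
    (ha : Tendsto (fun ε => M (θ + c ε)) (𝓝[>] 0) (𝓝 a)) : ‖a‖ ≤ C :=
  le_of_tendsto ha.norm (hc.mono fun _ hε => hC _ (ofReal_add_mem_strip hε θ))

theorem StripPair.bounded_left {a b : ℝ → ℂ} (h : StripPair a b) :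
    AEStronglyMeasurable a volume ∧ ∃ C, ∀ θ, ‖a θ‖ ≤ C := by
  obtain ⟨M, hM, ⟨C, hC⟩, ha, -⟩ := h
  exact ⟨aestronglyMeasurable_boundary hM eventually_lower_mem_strip ha, C,
    fun θ => norm_boundary_le hC eventually_lower_mem_strip (ha θ)⟩

theorem StripPair.bounded_right {a b : ℝ → ℂ} (h : StripPair a b) :
    AEStronglyMeasurable b volume ∧ ∃ C, ∀ θ, ‖b θ‖ ≤ C := by
  obtain ⟨M, hM, ⟨C, hC⟩, -, hb⟩ := h
  exact ⟨aestronglyMeasurable_boundary hM eventually_upper_mem_strip hb, C,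
    fun θ => norm_boundary_le hC eventually_upper_mem_strip (hb θ)⟩

theorem sub_ofReal_mem_strip {ζ : ℂ} (hζ : ζ ∈ strip) (t : ℝ) : ζ - t ∈ strip := by
  simpa [strip] using hζ

theorem aestronglyMeasurable_mul_comp_sub {c : ℝ → ℂ} (hc : AEStronglyMeasurable c volume)
    {s : ℂ → ℂ} (hs : ContinuousOn s strip) {ζ : ℂ} (hζ : ζ ∈ strip) :
    AEStronglyMeasurable (fun t : ℝ => c t * s (ζ - t)) volume :=
  hc.mul (hs.comp_continuous (by fun_prop) (sub_ofReal_mem_strip hζ)).aestronglyMeasurable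

theorem norm_mul_comp_sub_le (c : ℝ → ℂ) {s : ℂ → ℂ} {C : ℝ} (hC : ∀ ζ ∈ strip, ‖s ζ‖ ≤ C) {ζ : ℂ}
    (hζ : ζ ∈ strip) (t : ℝ) : ‖c t * s (ζ - t)‖ ≤ ‖c t‖ * C := by
  rw [norm_mul]
  exact mul_le_mul_of_nonneg_left (hC _ (sub_ofReal_mem_strip hζ t)) (norm_nonneg _)

theorem norm_deriv_le_of_ball_subset_strip {s : ℂ → ℂ} (hs : DifferentiableOn ℂ s strip) {C : ℝ}
    (hC : ∀ ζ ∈ strip, ‖s ζ‖ ≤ C) {ζ : ℂ} {δ : ℝ} (hδ : 0 < δ) (hball : Metric.ball ζ δ ⊆ strip)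
    {z : ℂ} (hz : z ∈ Metric.ball ζ (δ / 2)) (t : ℝ) :
    ‖deriv s (z - t)‖ ≤ C / (δ / 4) := by
  have hsub : Metric.closedBall (z - t) (δ / 4) ⊆ strip := fun w hw => by
    have hw' : w + t ∈ Metric.ball ζ δ := by
      rw [Metric.mem_ball, dist_eq_norm] at hz ⊢
      rw [Metric.mem_closedBall, dist_eq_norm] at hw
      calc ‖w + t - ζ‖ = ‖(w - (z - t)) + (z - ζ)‖ := by ring_nf
        _ ≤ ‖w - (z - t)‖ + ‖z - ζ‖ := norm_add_le _ _
        _ < δ := by linarith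
    simpa using sub_ofReal_mem_strip (hball hw') t
  exact Complex.norm_deriv_le_of_forall_mem_sphere_norm_le (by positivity)
    ((hs.mono hsub).diffContOnCl_ball subset_rfl)
    fun w hw => hC w (hsub (Metric.sphere_subset_closedBall hw))

theorem differentiableOn_integral_mul_comp_sub {c : ℝ → ℂ} (hc : Integrable c) {s : ℂ → ℂ}
    (hs : DifferentiableOn ℂ s strip) {C : ℝ} (hC : ∀ ζ ∈ strip, ‖s ζ‖ ≤ C) :
    DifferentiableOn ℂ (fun ζ => ∫ t : ℝ, c t * s (ζ - t)) strip := by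
  intro ζ hζ
  obtain ⟨δ, hδ, hball⟩ := Metric.isOpen_iff.1 isOpen_strip ζ hζ
  have hmeas (z : ℂ) (hz : z ∈ strip) := aestronglyMeasurable_mul_comp_sub hc.1 hs.continuousOn hz
  refine (hasDerivAt_integral_of_dominated_loc_of_deriv_le (μ := (volume : Measure ℝ))
    (F := fun (z : ℂ) (t : ℝ) => c t * s (z - t)) (F' := fun z t => c t * deriv s (z - t))
    (bound := fun t => ‖c t‖ * (C / (δ / 4))) (Metric.ball_mem_nhds ζ (half_pos hδ))
    (mem_of_superset (isOpen_strip.mem_nhds hζ) hmeas)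
    ((hc.norm.mul_const C).mono' (hmeas ζ hζ)
      (Eventually.of_forall (norm_mul_comp_sub_le c hC hζ)))
    (hc.1.mul ((measurable_deriv s).comp (by fun_prop)).aestronglyMeasurable)
    (Eventually.of_forall fun t z hz => ?_) (hc.norm.mul_const _)
    (Eventually.of_forall fun t z hz => ?_)).2.differentiableAt.differentiableWithinAt
  · rw [norm_mul]
    exact mul_le_mul_of_nonneg_left (norm_deriv_le_of_ball_subset_strip hs hC hδ hball hz t)
      (norm_nonneg _)
  · have hz' : z - t ∈ strip :=
      sub_ofReal_mem_strip (hball (Metric.ball_subset_ball (half_le_self hδ.le) hz)) t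
    exact ((hs.differentiableAt (isOpen_strip.mem_nhds hz')).hasDerivAt.comp_sub_const
      z (t : ℂ)).const_mul (c t)

theorem tendsto_integral_mul_comp_sub {c : ℝ → ℂ} (hc : Integrable c) {s : ℂ → ℂ}
    (hs : ContinuousOn s strip) {C : ℝ} (hC : ∀ ζ ∈ strip, ‖s ζ‖ ≤ C) {γ : ℝ → ℂ}
    (hγ : ∀ᶠ ε in 𝓝[>] 0, γ ε ∈ strip) {r : ℝ → ℂ}
    (hr : ∀ᵐ t : ℝ, Tendsto (fun ε => s (γ ε - t)) (𝓝[>] 0) (𝓝 (r t))) :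
    Tendsto (fun ε => ∫ t : ℝ, c t * s (γ ε - t)) (𝓝[>] 0) (𝓝 (∫ t, c t * r t)) := by
  refine tendsto_integral_filter_of_dominated_convergence (fun t => ‖c t‖ * C)
    (hγ.mono fun ε hε => aestronglyMeasurable_mul_comp_sub hc.1 hs hε)
    (hγ.mono fun ε hε => Eventually.of_forall (norm_mul_comp_sub_le c hC hε))
    (hc.norm.mul_const C) ?_
  filter_upwards [hr] with t ht using ht.const_mul (c t)

/-- The lower edge is parametrized by `θ ↦ θ` and the upper one by `θ ↦ iπ - θ`, as in the crossing
relation, which is why the second convolution has the opposite sign. -/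
theorem stripPair_convolution {c : ℝ → ℂ} (hc : Integrable c) {s : ℂ → ℂ}
    (hs : DifferentiableOn ℂ s strip) {C : ℝ} (hC : ∀ ζ ∈ strip, ‖s ζ‖ ≤ C) {r r' : ℝ → ℂ}
    (hr : ∀ᵐ θ : ℝ, Tendsto (fun ε : ℝ => s (θ + ε * Complex.I)) (𝓝[>] 0) (𝓝 (r θ)))
    (hr' : ∀ᵐ θ : ℝ, Tendsto (fun ε : ℝ => s (Real.pi * Complex.I - θ - ε * Complex.I)) (𝓝[>] 0)
      (𝓝 (r' θ))) :
    StripPair (fun θ => ∫ t, c t * r (θ - t)) (fun θ => ∫ t, c t * r' (t - θ)) := by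
  refine ⟨fun ζ => ∫ t : ℝ, c t * s (ζ - t), differentiableOn_integral_mul_comp_sub hc hs hC,
    ⟨∫ t, ‖c t‖ * C, fun ζ hζ => norm_integral_le_of_norm_le (hc.norm.mul_const C)
      (Eventually.of_forall (norm_mul_comp_sub_le c hC hζ))⟩,
    fun θ => tendsto_integral_mul_comp_sub hc hs.continuousOn hC
      (eventually_lower_mem_strip.mono fun ε hε => ofReal_add_mem_strip hε θ) ?_,
    fun θ => tendsto_integral_mul_comp_sub hc hs.continuousOn hC
      (eventually_upper_mem_strip.mono fun ε hε => ofReal_add_mem_strip hε θ) ?_⟩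
  · filter_upwards [(Measure.measurePreserving_sub_left volume θ).quasiMeasurePreserving.ae hr]
      with t ht
    refine ht.congr fun ε => congrArg s ?_
    push_cast
    ring
  · filter_upwards [(measurePreserving_sub_right volume θ).quasiMeasurePreserving.ae hr']
      with t ht
    refine ht.congr fun ε => congrArg s ?_
    push_cast
    ring

end StripAnalysis

section HalfLine

/-- The shifted Laplace transform `w ↦ ∫ exp (i (u - a) w) g(u) du`. It is bounded on the upper half
plane if `g` is supported in `[a, ∞)`. -/
def halfLaplace (a : ℝ) (g : 𝓢(ℝ, ℂ)) (w : ℂ) : ℂ :=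
  ∫ u : ℝ, Complex.exp (Complex.I * (u - a) * w) * g u

variable {a : ℝ} {g : 𝓢(ℝ, ℂ)}

theorem norm_exp_mul_le (hg : Function.support g ⊆ Set.Ici a) {w : ℂ} (hw : 0 ≤ w.im) (u : ℝ) :
    ‖Complex.exp (Complex.I * (u - a) * w) * g u‖ ≤ ‖g u‖ := by
  by_cases h : g u = 0
  · simp [h]
  · rw [norm_mul, Complex.norm_exp]
    refine mul_le_of_le_one_left (norm_nonneg _) (Real.exp_le_one_iff.2 ?_)
    have hre : (Complex.I * (u - a) * w).re = -((u - a) * w.im) := by simp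
    rw [hre, neg_nonpos]
    exact mul_nonneg (sub_nonneg.2 (hg h)) hw

theorem integrable_exp_mul (hg : Function.support g ⊆ Set.Ici a) {w : ℂ} (hw : 0 ≤ w.im) :
    Integrable fun u : ℝ => Complex.exp (Complex.I * (u - a) * w) * g u :=
  g.integrable.norm.mono' (by have := g.continuous; fun_prop)
    (Eventually.of_forall (norm_exp_mul_le hg hw))

theorem norm_halfLaplace_le (hg : Function.support g ⊆ Set.Ici a) {w : ℂ} (hw : 0 ≤ w.im) :
    ‖halfLaplace a g w‖ ≤ ∫ u, ‖g u‖ :=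
  norm_integral_le_of_norm_le g.integrable.norm (Eventually.of_forall (norm_exp_mul_le hg hw))

theorem support_derivCLM_subset (hg : Function.support g ⊆ Set.Ici a) :
    Function.support (SchwartzMap.derivCLM ℝ ℂ g) ⊆ Set.Ici a :=
  support_deriv_subset.trans (closure_minimal hg isClosed_Ici)

theorem halfLaplace_derivCLM (hg : Function.support g ⊆ Set.Ici a) {w : ℂ} (hw : 0 ≤ w.im) :
    halfLaplace a (SchwartzMap.derivCLM ℝ ℂ g) w = -(Complex.I * w) * halfLaplace a g w := by
  have hderiv (x : ℝ) : HasDerivAt (fun u : ℝ => Complex.exp (Complex.I * (u - a) * w))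
      (Complex.I * w * Complex.exp (Complex.I * (x - a) * w)) x := by
    have hexponent : HasDerivAt (fun u : ℝ => Complex.I * (u - a) * w) (Complex.I * 1 * w) x :=
      (((Complex.ofRealCLM.hasDerivAt (x := x)).sub_const (a : ℂ)).const_mul Complex.I).mul_const w
    simpa only [mul_one, mul_comm] using hexponent.cexp
  have hint := integrable_exp_mul hg hw
  have hparts := integral_mul_deriv_eq_deriv_mul_of_integrable
    (v' := SchwartzMap.derivCLM ℝ ℂ g) (fun x _ => hderiv x) (fun x _ => g.hasDerivAt x)
    (integrable_exp_mul (support_derivCLM_subset hg) hw)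
    ((hint.const_mul (Complex.I * w)).congr (Eventually.of_forall fun u => (mul_assoc ..).symm))
    hint
  rw [halfLaplace, hparts, halfLaplace, ← integral_const_mul, ← integral_neg]
  exact integral_congr_ae (Eventually.of_forall fun u => by ring)

theorem exists_bound_halfLaplace (hg : Function.support g ⊆ Set.Ici a) :
    ∃ C, 0 ≤ C ∧ ∀ w : ℂ, 0 ≤ w.im → ‖halfLaplace a g w‖ ≤ C / (1 + ‖w‖ ^ 2) := by
  set g₂ := SchwartzMap.derivCLM ℝ ℂ (SchwartzMap.derivCLM ℝ ℂ g)
  refine ⟨(∫ u, ‖g u‖) + ∫ u, ‖g₂ u‖, add_nonneg (integral_nonneg fun _ => norm_nonneg _)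
    (integral_nonneg fun _ => norm_nonneg _), fun w hw => ?_⟩
  have hg' := support_derivCLM_subset hg
  have hsecond := norm_halfLaplace_le (support_derivCLM_subset hg') hw
  rw [halfLaplace_derivCLM hg' hw, halfLaplace_derivCLM hg hw] at hsecond
  simp only [norm_mul, norm_neg, Complex.norm_I, one_mul] at hsecond
  rw [le_div_iff₀ (by positivity), mul_add, mul_one, sq, mul_comm ‖halfLaplace a g w‖, mul_assoc]
  exact add_le_add (norm_halfLaplace_le hg hw) hsecond

theorem continuousOn_halfLaplace (hg : Function.support g ⊆ Set.Ici a) :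
    ContinuousOn (halfLaplace a g) {w | 0 ≤ w.im} :=
  continuousOn_of_dominated (fun _ hw => (integrable_exp_mul hg hw).1)
    (fun _ hw => Eventually.of_forall (norm_exp_mul_le hg hw)) g.integrable.norm
    (Eventually.of_forall fun u => by fun_prop)

theorem differentiableOn_halfLaplace (hg : Function.support g ⊆ Set.Ici a) :
    DifferentiableOn ℂ (halfLaplace a g) {w | 0 < w.im} := by
  intro w hw
  have hnhds := (isOpen_lt continuous_const Complex.continuous_im).mem_nhds hw
  have hcont := g.continuous
  refine (hasDerivAt_integral_of_dominated_loc_of_deriv_le (μ := (volume : Measure ℝ))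
    (F := fun (z : ℂ) (u : ℝ) => Complex.exp (Complex.I * (u - a) * z) * g u)
    (F' := fun (z : ℂ) (u : ℝ) => Complex.I * (u - a) *
      (Complex.exp (Complex.I * (u - a) * z) * g u))
    (bound := fun u => ‖u‖ ^ 1 * ‖g u‖ + |a| * ‖g u‖) hnhds
    (mem_of_superset hnhds fun z hz => (integrable_exp_mul hg (le_of_lt hz)).1)
    (integrable_exp_mul hg (le_of_lt hw)) (by fun_prop)
    (Eventually.of_forall fun u z hz => ?_)
    ((g.integrable_pow_mul volume 1).add (g.integrable.norm.const_mul _))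
    (Eventually.of_forall fun u z _ => ?_)).2.differentiableAt.differentiableWithinAt
  · rw [norm_mul, norm_mul, Complex.norm_I, one_mul, ← add_mul, pow_one]
    refine mul_le_mul ?_ (norm_exp_mul_le hg (le_of_lt hz) u) (norm_nonneg _) (by positivity)
    rw [← Complex.ofReal_sub, Complex.norm_real]
    exact norm_sub_le u a
  · have hexponent : HasDerivAt (fun z : ℂ => Complex.I * (u - a) * z)
        (Complex.I * (u - a) * 1) z := (hasDerivAt_id z).const_mul _
    exact (hexponent.cexp.mul_const (g u)).congr_deriv (by ring)

/-- The reflected test function `u ↦ f(-u)`. -/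
def reflect (f : 𝓢(ℝ, ℂ)) : 𝓢(ℝ, ℂ) :=
  SchwartzMap.compCLMOfContinuousLinearEquiv ℝ (ContinuousLinearEquiv.neg ℝ) f

theorem reflect_apply (f : 𝓢(ℝ, ℂ)) (u : ℝ) : reflect f u = f (-u) := rfl

theorem support_reflect_subset {f : 𝓢(ℝ, ℂ)} (hf : Function.support f ⊆ Set.Iic a) :
    Function.support (reflect f) ⊆ Set.Ici (-a) :=
  fun _ hu => neg_le.1 (Set.mem_Iic.1 (hf hu))

/-- For `f` supported to the left of `a` and `g` to the right of `a`, an analytic function on the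
upper half plane whose boundary values at `e^θ` and `-e^θ` are the products `f⁻ g⁺` and `f⁺ g⁻`. -/
def rapidityProd (a : ℝ) (f g : 𝓢(ℝ, ℂ)) (w : ℂ) : ℂ :=
  w ^ 2 * (halfLaplace (-a) (reflect f) w * halfLaplace a g w)

theorem halfLaplace_reflect_mul_halfLaplace (a : ℝ) (f g : 𝓢(ℝ, ℂ)) (w : ℂ) :
    halfLaplace (-a) (reflect f) w * halfLaplace a g w =
      (∫ u : ℝ, Complex.exp (-(Complex.I * u * w)) * f u) *
        ∫ u : ℝ, Complex.exp (Complex.I * u * w) * g u := by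
  have hf : halfLaplace (-a) (reflect f) w =
      Complex.exp (Complex.I * a * w) * ∫ u : ℝ, Complex.exp (-(Complex.I * u * w)) * f u := by
    rw [halfLaplace, ← integral_neg_eq_self, ← integral_const_mul]
    refine integral_congr_ae (Eventually.of_forall fun u => ?_)
    simp only [reflect_apply, neg_neg, ← mul_assoc, ← Complex.exp_add]
    congr 2
    push_cast
    ring
  have hg : halfLaplace a g w =
      Complex.exp (-(Complex.I * a * w)) * ∫ u : ℝ, Complex.exp (Complex.I * u * w) * g u := by
    rw [halfLaplace, ← integral_const_mul]
    refine integral_congr_ae (Eventually.of_forall fun u => ?_)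
    simp only [← mul_assoc, ← Complex.exp_add]
    congr 2
    ring
  rw [hf, hg, mul_mul_mul_comm, ← Complex.exp_add, add_neg_cancel, Complex.exp_zero, one_mul]

theorem rapidityProd_neg_mul_exp (a : ℝ) (f g : 𝓢(ℝ, ℂ)) (s θ : ℝ) :
    rapidityProd a f g (-(s * Real.exp θ)) = fpm s f θ * fpm (-s) g θ := by
  have hf (u : ℝ) : -(Complex.I * u * -(s * (Real.exp θ : ℂ))) =
    s * Complex.I * u * Real.exp θ := by ring
  have hg (u : ℝ) : Complex.I * u * -(s * (Real.exp θ : ℂ)) =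
    ((-s : ℝ) : ℂ) * Complex.I * u * Real.exp θ := by push_cast; ring
  simp only [rapidityProd, halfLaplace_reflect_mul_halfLaplace, fpm, hf]
  simp only [hg]
  set A := ∫ u : ℝ, Complex.exp (s * Complex.I * u * Real.exp θ) * f u
  set B := ∫ u : ℝ, Complex.exp (((-s : ℝ) : ℂ) * Complex.I * u * Real.exp θ) * g u
  push_cast
  linear_combination ((s : ℂ) ^ 2 * (Complex.exp θ) ^ 2 * A * B) * Complex.I_sq

theorem exp_im_pos_of_mem_strip {ζ : ℂ} (hζ : ζ ∈ strip) : 0 < (Complex.exp ζ).im := by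
  rw [Complex.exp_im]
  exact mul_pos (Real.exp_pos _) (Real.sin_pos_of_pos_of_lt_pi hζ.1 hζ.2)

theorem exp_sq_div_le (x : ℝ) :
    Real.exp x ^ 2 / (1 + Real.exp x ^ 2) ^ 2 ≤ (1 + x ^ 2)⁻¹ := by
  have hfactor : 1 + Real.exp x ^ 2 = Real.exp x * (Real.exp x + Real.exp (-x)) := by
    rw [mul_add, ← Real.exp_add x (-x), add_neg_cancel, Real.exp_zero]
    ring
  have hquadratic : 1 + x ^ 2 ≤ Real.exp |x| ^ 2 := by
    have := Real.quadratic_le_exp_of_nonneg (abs_nonneg x)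
    rw [sq_abs] at this
    nlinarith [abs_nonneg x, sq_nonneg x, sq_abs x]
  rw [← one_div, div_le_div_iff₀ (by positivity) (by positivity), one_mul, hfactor, mul_pow]
  exact mul_le_mul_of_nonneg_left (hquadratic.trans
    (pow_le_pow_left₀ (Real.exp_pos _).le (Real.exp_abs_le x) 2)) (by positivity)

section Separated

variable {f : 𝓢(ℝ, ℂ)} (hf : Function.support f ⊆ Set.Iic a)
  (hg : Function.support g ⊆ Set.Ici a)

include hf hg

theorem differentiableOn_rapidityProd_exp :
    DifferentiableOn ℂ (fun ζ => rapidityProd a f g (Complex.exp ζ)) strip := by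
  have hupper : DifferentiableOn ℂ (rapidityProd a f g) {w | 0 < w.im} :=
    (differentiableOn_id.pow 2).mul
      ((differentiableOn_halfLaplace (support_reflect_subset hf)).mul
        (differentiableOn_halfLaplace hg))
  exact hupper.comp Complex.differentiable_exp.differentiableOn fun _ => exp_im_pos_of_mem_strip

theorem exists_bound_rapidityProd_exp :
    ∃ C, 0 ≤ C ∧ ∀ ζ ∈ strip, ‖rapidityProd a f g (Complex.exp ζ)‖ ≤ C * (1 + ζ.re ^ 2)⁻¹ := by
  obtain ⟨C₁, hC₁, hbound₁⟩ := exists_bound_halfLaplace (support_reflect_subset hf)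
  obtain ⟨C₂, hC₂, hbound₂⟩ := exists_bound_halfLaplace hg
  refine ⟨C₁ * C₂, by positivity, fun ζ hζ => ?_⟩
  have h₁ := hbound₁ _ (exp_im_pos_of_mem_strip hζ).le
  have h₂ := hbound₂ _ (exp_im_pos_of_mem_strip hζ).le
  rw [Complex.norm_exp] at h₁ h₂
  rw [rapidityProd, norm_mul, norm_mul, norm_pow, Complex.norm_exp]
  set e := Real.exp ζ.re
  calc e ^ 2 * (‖halfLaplace (-a) (reflect f) (Complex.exp ζ)‖ *
        ‖halfLaplace a g (Complex.exp ζ)‖)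
    _ ≤ e ^ 2 * (C₁ / (1 + e ^ 2) * (C₂ / (1 + e ^ 2))) := by gcongr
    _ = C₁ * C₂ * (e ^ 2 / (1 + e ^ 2) ^ 2) := by field_simp
    _ ≤ _ := mul_le_mul_of_nonneg_left (exp_sq_div_le ζ.re) (by positivity)

theorem tendsto_rapidityProd_exp {ι : Type*} {l : Filter ι} [l.NeBot] {z : ι → ℂ} {z₀ : ℂ}
    (hz : ∀ᶠ i in l, z i ∈ strip) (hlim : Tendsto z l (𝓝 z₀)) :
    Tendsto (fun i => rapidityProd a f g (Complex.exp (z i))) l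
      (𝓝 (rapidityProd a f g (Complex.exp z₀))) := by
  have hcont : ContinuousOn (rapidityProd a f g) {w | 0 ≤ w.im} :=
    (continuousOn_id.pow 2).mul ((continuousOn_halfLaplace (support_reflect_subset hf)).mul
      (continuousOn_halfLaplace hg))
  have hexp := (Complex.continuous_exp.tendsto z₀).comp hlim
  have hmem : ∀ᶠ i in l, Complex.exp (z i) ∈ {w : ℂ | 0 ≤ w.im} :=
    hz.mono fun i hi => (exp_im_pos_of_mem_strip hi).le
  have hmem₀ : Complex.exp z₀ ∈ {w : ℂ | 0 ≤ w.im} :=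
    (isClosed_le continuous_const Complex.continuous_im).mem_of_tendsto hexp hmem
  exact (hcont _ hmem₀).tendsto.comp (tendsto_nhdsWithin_iff.2 ⟨hexp, hmem⟩)

theorem tendsto_rapidityProd_lower (θ : ℝ) :
    Tendsto (fun ε : ℝ => rapidityProd a f g (Complex.exp (θ + ε * Complex.I))) (𝓝[>] 0)
      (𝓝 (fpm (-1) f θ * fpm 1 g θ)) := by
  have hlim : Tendsto (fun ε : ℝ => (θ : ℂ) + ε * Complex.I) (𝓝[>] 0)
      (𝓝 (θ + (0 : ℝ) * Complex.I)) :=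
    tendsto_nhdsWithin_of_tendsto_nhds (Continuous.tendsto (by fun_prop) 0)
  have hexp : Complex.exp (θ + (0 : ℝ) * Complex.I) = -((-1 : ℝ) * Real.exp θ) := by simp
  have hvalue := rapidityProd_neg_mul_exp a f g (-1) θ
  rw [neg_neg] at hvalue
  rw [← hvalue, ← hexp]
  exact tendsto_rapidityProd_exp hf hg
    (eventually_lower_mem_strip.mono fun _ hε => ofReal_add_mem_strip hε θ) hlim

theorem tendsto_rapidityProd_upper (θ : ℝ) :
    Tendsto (fun ε : ℝ =>
        rapidityProd a f g (Complex.exp (θ + (Real.pi * Complex.I - ε * Complex.I)))) (𝓝[>] 0)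
      (𝓝 (fpm 1 f θ * fpm (-1) g θ)) := by
  have hlim : Tendsto (fun ε : ℝ => (θ : ℂ) + (Real.pi * Complex.I - ε * Complex.I)) (𝓝[>] 0)
      (𝓝 (θ + (Real.pi * Complex.I - (0 : ℝ) * Complex.I))) :=
    tendsto_nhdsWithin_of_tendsto_nhds (Continuous.tendsto (by fun_prop) 0)
  have hexp : Complex.exp (θ + (Real.pi * Complex.I - (0 : ℝ) * Complex.I)) =
      -((1 : ℝ) * Real.exp θ) := by simp [Complex.exp_add, Complex.exp_pi_mul_I]
  rw [← rapidityProd_neg_mul_exp a f g 1 θ, ← hexp]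
  exact tendsto_rapidityProd_exp hf hg
    (eventually_upper_mem_strip.mono fun _ hε => ofReal_add_mem_strip hε θ) hlim

theorem integral_fpm_mul_of_support_subset {m m' : ℝ → ℂ} (hm : StripPair m m') :
    ∫ θ, fpm (-1) f θ * fpm 1 g θ * m θ = ∫ θ, fpm 1 f θ * fpm (-1) g θ * m' θ := by
  obtain ⟨M, hM, ⟨C, hC⟩, hlower, hupper⟩ := hm
  obtain ⟨D, hD, hdecay⟩ := exists_bound_rapidityProd_exp hf hg
  refine integral_boundary_eq (M := fun ζ => rapidityProd a f g (Complex.exp ζ) * M ζ) (C := D * C)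
    ((differentiableOn_rapidityProd_exp hf hg).mul hM) (fun ζ hζ => ?_)
    (fun θ => (tendsto_rapidityProd_lower hf hg θ).mul (hlower θ))
    (fun θ => (tendsto_rapidityProd_upper hf hg θ).mul (hupper θ))
  rw [norm_mul, mul_right_comm]
  exact mul_le_mul (hdecay ζ hζ) (hC ζ hζ) (norm_nonneg _) (by positivity)

end Separated

theorem integral_fpm_mul {f : 𝓢(ℝ, ℂ)}
    (hfg : ∀ u ∈ Function.support f, ∀ u' ∈ Function.support g, u < u') {m m' : ℝ → ℂ}
    (hm : StripPair m m') :
    ∫ θ, fpm (-1) f θ * fpm 1 g θ * m θ = ∫ θ, fpm 1 f θ * fpm (-1) g θ * m' θ := by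
  rcases (Function.support f).eq_empty_or_nonempty with hf | hf
  · simp [fpm, Function.support_eq_empty_iff.1 hf]
  rcases (Function.support g).eq_empty_or_nonempty with hg | hg
  · simp [fpm, Function.support_eq_empty_iff.1 hg]
  obtain ⟨a, hfa, hga⟩ := exists_between_of_forall_le hf hg fun u hu u' hu' => (hfg u hu u' hu').le
  exact integral_fpm_mul_of_support_subset hfa hga hm

end HalfLine

section Multiplication

variable {α : Type*} [MeasurableSpace α] {μ : Measure α}

theorem coeFn_eq_mul_of_forall_inner_eq {Y q : Lp ℂ 2 μ} {m : α → ℂ}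
    (hm : AEStronglyMeasurable m μ) {C : ℝ} (hC : ∀ θ, ‖m θ‖ ≤ C)
    (h : ∀ p : Lp ℂ 2 μ, inner ℂ p Y = ∫ θ, inner ℂ (p θ) (q θ) * m θ ∂μ) :
    Y =ᵐ[μ] fun θ => m θ * q θ := by
  have hmem : MemLp (fun θ => m θ * q θ) 2 μ :=
    (Lp.memLp q).of_le_mul (c := C) (hm.mul (Lp.aestronglyMeasurable q))
      (Eventually.of_forall fun θ => (norm_mul _ _).trans_le <| by gcongr; exact hC θ)
  suffices Y = hmem.toLp _ from this ▸ hmem.coeFn_toLp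
  refine ext_inner_left ℂ fun p => ?_
  rw [h, L2.inner_def]
  refine integral_congr_ae ?_
  filter_upwards [hmem.coeFn_toLp] with θ hθ
  simp only [hθ, RCLike.inner_apply]
  ring

theorem coeFn_sum {E ι : Type*} [NormedAddCommGroup E] (F : Finset ι) {q : ι → Lp E 2 μ}
    {w : ι → α → E} (h : ∀ i, q i =ᵐ[μ] w i) :
    (∑ i ∈ F, q i : Lp E 2 μ) =ᵐ[μ] fun θ => ∑ i ∈ F, w i θ := by
  classical
  induction F using Finset.induction_on with
  | empty =>
    simp only [Finset.sum_empty]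
    exact Lp.coeFn_zero E 2 μ
  | insert i F hi ih =>
    simp only [Finset.sum_insert hi]
    exact (Lp.coeFn_add _ _).trans ((h i).add ih)

end Multiplication

section Conjugation

variable {K : Type u} [NormedAddCommGroup K] [InnerProductSpace ℂ K] {Γ : Conjugation K}
  {ι : Type*} {b : ι → K}

theorem Conjugation.orthonormal_comp (Γ : Conjugation K) (hb : Orthonormal ℂ b) :
    Orthonormal ℂ fun i => Γ.map (b i) :=
  ⟨fun i => (Γ.map.norm_map _).trans (hb.1 i), fun _ _ hij =>
    (inner_conj_conj Γ.map _ _).trans (hb.2 hij.symm)⟩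

theorem Conjugation.hasSum_inner_smul (Γ : Conjugation K)
    (hb : ∀ x, HasSum (fun i => inner ℂ (b i) x • b i) x) (x : K) :
    HasSum (fun i => inner ℂ (Γ.map (b i)) x • Γ.map (b i)) x := by
  have h := (hb (Γ.map x)).mapL Γ.map.toContinuousLinearMap
  simp only [LinearIsometry.coe_toContinuousLinearMap, Γ.involutive] at h
  convert h using 2 with i
  rw [map_smulₛₗ, inner_conj_symm, ← inner_conj_conj Γ.map (b i), Γ.involutive]

theorem oneTCP_tensorL (e : K) (h : Lp ℂ 2 volume) :
    oneTCP Γ (tensorL volume e h) = tensorL volume (Γ.map e) (star h) := by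
  refine Lp.ext ?_
  filter_upwards [coeFn_oneTCP (Γ := Γ) (tensorL volume e h), coeFn_tensorL e h,
    coeFn_tensorL (Γ.map e) (star h), Lp.coeFn_star h] with θ hΓ he hstar hh
  rw [hΓ, he, hstar, hh, map_smulₛₗ]
  rfl

end Conjugation

section TestFunctions

variable (f g : 𝓢(ℝ, ℂ))

theorem coeFn_fPlus : fPlus f =ᵐ[volume] fpm 1 f := (memLp_fpm (Or.inl rfl) f).coeFn_toLp

theorem coeFn_fMinus : fMinus f =ᵐ[volume] fpm (-1) f := (memLp_fpm (Or.inr rfl) f).coeFn_toLp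

theorem coeFn_star_fMinus :
    (star (fMinus f) : Lp ℂ 2 (volume : Measure ℝ)) =ᵐ[volume] fun θ => conj (fpm (-1) f θ) := by
  filter_upwards [Lp.coeFn_star (fMinus f), coeFn_fMinus f] with θ hstar hf
  rw [hstar, Pi.star_apply, hf, RCLike.star_def]

theorem conj_fpm_tcpTest (s θ : ℝ) : conj (fpm s (tcpTest g) θ) = -fpm s g θ := by
  have hphase (u : ℝ) : (s : ℂ) * -Complex.I * -u * Real.exp θ = s * Complex.I * u * Real.exp θ :=
    by ring
  simp only [fpm, map_mul, ← integral_conj, Complex.conj_ofReal, Complex.conj_I, tcpTest_apply,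
    Complex.conj_conj, ← Complex.exp_conj]
  rw [← integral_neg_eq_self]
  simp only [neg_neg, Complex.ofReal_neg, hphase]
  ring

theorem star_fPlus_tcpTest : star (fPlus (tcpTest g)) = -fPlus g := by
  refine Lp.ext ?_
  filter_upwards [Lp.coeFn_star (fPlus (tcpTest g)), Lp.coeFn_neg (fPlus g), coeFn_fPlus g,
    coeFn_fPlus (tcpTest g)] with θ hstar hneg hg htcp
  rw [hstar, hneg, Pi.star_apply, Pi.neg_apply, hg, htcp]
  exact conj_fpm_tcpTest g 1 θ

theorem fMinus_tcpTest : fMinus (tcpTest g) = -star (fMinus g) := by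
  refine Lp.ext ?_
  filter_upwards [coeFn_star_fMinus g, Lp.coeFn_neg (star (fMinus g)), coeFn_fMinus (tcpTest g)]
    with θ hstar hneg htcp
  rw [hneg, Pi.neg_apply, hstar, htcp, ← map_neg, ← conj_fpm_tcpTest, Complex.conj_conj]

variable {f g} {Y : Lp ℂ 2 (volume : Measure ℝ)} {m : ℝ → ℂ}

theorem inner_star_fMinus_eq (hY : Y =ᵐ[volume] fun θ => m θ * fPlus g θ) :
    inner ℂ (star (fMinus f)) Y = ∫ θ, fpm (-1) f θ * fpm 1 g θ * m θ := by
  rw [L2.inner_def]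
  refine integral_congr_ae ?_
  filter_upwards [hY, coeFn_star_fMinus f, coeFn_fPlus g] with θ hY hf hg
  simp only [hY, hf, hg, RCLike.inner_apply, Complex.conj_conj]
  ring

theorem inner_fPlus_eq
    (hY : Y =ᵐ[volume] fun θ => conj (m θ) * (star (fMinus g) : Lp ℂ 2 (volume : Measure ℝ)) θ) :
    inner ℂ Y (fPlus f) = ∫ θ, fpm 1 f θ * fpm (-1) g θ * m θ := by
  rw [L2.inner_def]
  refine integral_congr_ae ?_
  filter_upwards [hY, coeFn_star_fMinus g, coeFn_fPlus f] with θ hY hg hf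
  simp only [hY, hg, hf, RCLike.inner_apply, map_mul, Complex.conj_conj]
  ring

end TestFunctions

section Crossing

variable {K : Type u} [NormedAddCommGroup K] [InnerProductSpace ℂ K]
  {G : Type v} [Group G] {V : G →* (K ≃ₗᵢ[ℂ] K)} {Γ : Conjugation K} (R : YBFunction V Γ)

theorem ae_inner_toFun_neg : ∀ᵐ θ : ℝ, ∀ v w : HTensor K K,
    inner ℂ v (R.toFun (-θ) w) = inner ℂ (R.toFun θ v) w := by
  filter_upwards [R.isUnitary, R.inverse] with θ hunit hinv v w
  rw [left_inv_eq_right_inv hinv.1 (Unitary.mul_star_self_of_mem hunit),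
    ContinuousLinearMap.star_eq_adjoint, ContinuousLinearMap.adjoint_inner_right]

theorem conj_integral_inner_toFun (h h' : ℝ → ℂ) (v w : HTensor K K) (θ : ℝ) :
    conj (∫ t, inner ℂ (h t) (h' t) * inner ℂ v (R.toFun (t - θ) w)) =
      ∫ t, inner ℂ (h' t) (h t) * inner ℂ w (R.toFun (θ - t) v) := by
  rw [← integral_conj]
  refine integral_congr_ae ?_
  filter_upwards [(Measure.measurePreserving_sub_left volume θ).quasiMeasurePreserving.ae
    (ae_inner_toFun_neg R)] with t ht
  rw [map_mul, inner_conj_symm, ← neg_sub θ t, ht, inner_conj_symm]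

variable [CompleteSpace K]

theorem inner_adjoint_tensorL_partialElem (e e' x y : K)
    (h h' p q : Lp ℂ 2 (volume : Measure ℝ)) :
    inner ℂ p (ContinuousLinearMap.adjoint (tensorL volume e)
      (partialElem R.op (tensorL volume x h) (tensorL volume y h') (tensorL volume e' q))) =
    ∫ θ, inner ℂ (p θ) (q θ) * ∫ t, inner ℂ (h t) (h' t) *
      inner ℂ (tmul e x) (R.toFun (θ - t) (tmul y e')) := by
  set Φ := twoPMap K (tmul (tensorL volume e p) (tensorL volume x h))
  set Ψ := twoPMap K (R.op (tmul (tensorL volume y h') (tensorL volume e' q)))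
  have hfibre : (fun z : ℝ × ℝ => inner ℂ (Φ z) (Ψ z)) =ᵐ[volume] fun z =>
      inner ℂ (p z.1) (q z.1) * (inner ℂ (h z.2) (h' z.2) *
        inner ℂ (tmul e x) (R.toFun (z.1 - z.2) (tmul y e'))) := by
    filter_upwards [coeFn_twoPMap_op R (tmul (tensorL volume y h') (tensorL volume e' q)),
      coeFn_twoPMap_tmul (tensorL volume e p) (tensorL volume x h),
      quasiMeasurePreserving_swap.ae
        (coeFn_twoPMap_tmul (tensorL volume y h') (tensorL volume e' q)),
      ae_prod_fst (coeFn_tensorL e p), ae_prod_snd (coeFn_tensorL x h),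
      ae_prod_snd (coeFn_tensorL y h'), ae_prod_fst (coeFn_tensorL e' q)]
      with z hΨ hΦ hswap hp hh hh' hq
    rw [hΨ, hΦ, hswap, Prod.fst_swap, Prod.snd_swap, hp, hh, hh', hq]
    simp only [smul_tmul, tmul_smul, map_smul, inner_smul_left, inner_smul_right,
      RCLike.inner_apply]
    ring
  calc _
    _ = inner ℂ Φ Ψ := by
      rw [ContinuousLinearMap.adjoint_inner_right, inner_partialElem]
      exact (inner_twoPMap _ _).symm
    _ = ∫ z : ℝ × ℝ, inner ℂ (p z.1) (q z.1) * (inner ℂ (h z.2) (h' z.2) *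
        inner ℂ (tmul e x) (R.toFun (z.1 - z.2) (tmul y e'))) :=
      (L2.inner_def _ _).trans (integral_congr_ae hfibre)
    _ = _ := (integral_prod _ ((L2.integrable_inner Φ Ψ).congr hfibre)).trans <| by
      simp only [integral_const_mul]

theorem coeFn_adjoint_tensorL_partialElem (e e' x y : K) (h h' q : Lp ℂ 2 (volume : Measure ℝ))
    {m : ℝ → ℂ} (hm : ∀ θ, m θ = ∫ t, inner ℂ (h t) (h' t) *
      inner ℂ (tmul e x) (R.toFun (θ - t) (tmul y e')))
    (hmeas : AEStronglyMeasurable m volume) {C : ℝ} (hC : ∀ θ, ‖m θ‖ ≤ C) :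
    ContinuousLinearMap.adjoint (tensorL volume e)
      (partialElem R.op (tensorL volume x h) (tensorL volume y h') (tensorL volume e' q)) =ᵐ[volume]
        fun θ => m θ * q θ :=
  coeFn_eq_mul_of_forall_inner_eq hmeas hC fun p => by
    simp only [inner_adjoint_tensorL_partialElem, hm]

variable {R}

theorem exists_stripPair_partialElem (hR : R.CrossingSymmetric) (e e' x y : K)
    (h h' : Lp ℂ 2 (volume : Measure ℝ)) :
    ∃ m m' : ℝ → ℂ, StripPair m m' ∧
      (∀ q, ContinuousLinearMap.adjoint (tensorL volume e)
        (partialElem R.op (tensorL volume x h) (tensorL volume y h') (tensorL volume e' q))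
          =ᵐ[volume] fun θ => m θ * q θ) ∧
      ∀ q, ContinuousLinearMap.adjoint (tensorL volume (Γ.map e))
        (partialElem R.op (tensorL volume y h') (tensorL volume x h)
          (tensorL volume (Γ.map e') q)) =ᵐ[volume] fun θ => conj (m' θ) * q θ := by
  obtain ⟨S, hS, ⟨C, hC⟩, hlower, hupper⟩ := hR
  have hdiff : DifferentiableOn ℂ (fun ζ => inner ℂ (tmul e x) (S ζ (tmul y e'))) strip :=
    (innerSL ℂ (tmul e x)).differentiable.comp_differentiableOn
      (hS.clm_apply (differentiableOn_const _))
  have hbound (ζ) (hζ : ζ ∈ strip) : ‖(inner ℂ (tmul e x) (S ζ (tmul y e')) : ℂ)‖ ≤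
      ‖tmul e x‖ * (C * ‖tmul y e'‖) :=
    (norm_inner_le_norm _ _).trans (by gcongr; exact (S ζ).le_of_opNorm_le (hC ζ hζ) _)
  have hpair := stripPair_convolution (L2.integrable_inner (𝕜 := ℂ) h h') hdiff hbound
    (hlower (tmul e x) (tmul y e')) (hupper e x y e')
  obtain ⟨hmeas, D, hD⟩ := hpair.bounded_left
  obtain ⟨hmeas', D', hD'⟩ := hpair.bounded_right
  refine ⟨_, _, hpair, fun q => coeFn_adjoint_tensorL_partialElem R e e' x y h h' q
    (fun _ => rfl) hmeas hD, fun q => coeFn_adjoint_tensorL_partialElem R _ _ y x h' h q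
    (fun θ => conj_integral_inner_toFun R h h' _ _ θ)
    (Complex.continuous_conj.comp_aestronglyMeasurable hmeas')
    fun θ => (RCLike.norm_conj _).trans_le (hD' θ)⟩

theorem exists_stripPair_monodromy (hR : R.CrossingSymmetric) {ι : Type*} (b : ι → K)
    (F : Finset ι) (k : K) (g g' : Lp ℂ 2 (volume : Measure ℝ)) (l : List (OneP K × OneP K))
    (hl : ∀ p ∈ l, p.1 ∈ elementary volume K ∧ p.2 ∈ elementary volume K) (e : K) :
    ∃ m m' : ℝ → ℂ, StripPair m m' ∧
      (ContinuousLinearMap.adjoint (tensorL volume e)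
        (monodromy R.op (fibreProj volume b F) l (tensorL volume k g))
          =ᵐ[volume] fun θ => m θ * g θ) ∧
      (ContinuousLinearMap.adjoint (tensorL volume (Γ.map e))
        (monodromy R.op (fibreProj volume (fun i => Γ.map (b i)) F) (l.map Prod.swap)
          (tensorL volume (Γ.map k) g')) =ᵐ[volume] fun θ => conj (m' θ) * g' θ) := by
  induction l generalizing e with
  | nil =>
    refine ⟨_, _, StripPair.const (inner ℂ e k), ?_, ?_⟩
    · simp only [monodromy, ContinuousLinearMap.id_apply, adjoint_tensorL_tensorL]
      exact Lp.coeFn_smul _ _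
    · simp only [monodromy, List.map_nil, ContinuousLinearMap.id_apply, adjoint_tensorL_tensorL,
        inner_conj_conj, inner_conj_symm]
      exact Lp.coeFn_smul _ _
  | cons p l ih =>
    obtain ⟨⟨⟨h, x, hx⟩, ⟨h', y, hy⟩⟩, hl⟩ := List.forall_mem_cons.1 hl
    choose m m' hm htail htail' using fun i => ih hl (b i)
    choose c c' hc hhead hhead' using fun i =>
      exists_stripPair_partialElem hR e (b i) x y h h'
    refine ⟨_, _, StripPair.sum F fun i => (hc i).mul (hm i), ?_, ?_⟩
    · simp only [monodromy, ContinuousLinearMap.comp_apply, fibreProj_apply, map_sum, hx, hy,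
        Finset.sum_mul]
      refine coeFn_sum F fun i => ?_
      filter_upwards [hhead i _, htail i] with θ h₁ h₂
      rw [h₁, h₂, mul_assoc]
    · simp only [monodromy, List.map_cons, Prod.fst_swap, Prod.snd_swap,
        ContinuousLinearMap.comp_apply, fibreProj_apply, map_sum, map_mul, hx, hy, Finset.sum_mul]
      refine coeFn_sum F fun i => ?_
      filter_upwards [hhead' i _, htail' i] with θ h₁ h₂
      rw [h₁, h₂, mul_assoc]

theorem inner_monodromy_fibreProj_eq (hR : R.CrossingSymmetric) {f g : 𝓢(ℝ, ℂ)}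
    (hfg : ∀ u ∈ Function.support f, ∀ u' ∈ Function.support g, u < u') (k k' : K)
    {l : List (OneP K × OneP K)}
    (hl : ∀ p ∈ l, p.1 ∈ elementary volume K ∧ p.2 ∈ elementary volume K)
    {ι : Type*} (b : ι → K) (F : Finset ι) :
    inner ℂ (tensorL volume (Γ.map k) (star (fMinus f)))
      (monodromy R.op (fibreProj volume b F) l (tensorL volume k' (fPlus g))) =
    inner ℂ (monodromy R.op (fibreProj volume (fun i => Γ.map (b i)) F) (l.map Prod.swap)
      (tensorL volume (Γ.map k') (star (fMinus g)))) (tensorL volume k (fPlus f)) := by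
  obtain ⟨m, m', hm, hleft, hright⟩ :=
    exists_stripPair_monodromy hR b F k' (fPlus g) (star (fMinus g)) l hl (Γ.map k)
  rw [Γ.involutive] at hright
  rw [← ContinuousLinearMap.adjoint_inner_right (tensorL volume (Γ.map k)),
    ← ContinuousLinearMap.adjoint_inner_left (tensorL volume k), inner_star_fMinus_eq hleft,
    inner_fPlus_eq hright, integral_fpm_mul hfg hm]

theorem inner_monodromy_eq (hR : R.CrossingSymmetric) {f g : 𝓢(ℝ, ℂ)}
    (hfg : ∀ u ∈ Function.support f, ∀ u' ∈ Function.support g, u < u') (k k' : K)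
    {l : List (OneP K × OneP K)}
    (hl : ∀ p ∈ l, p.1 ∈ elementary volume K ∧ p.2 ∈ elementary volume K) :
    inner ℂ (tensorL volume (Γ.map k) (star (fMinus f)))
      (monodromy R.op (ContinuousLinearMap.id ℂ _) l (tensorL volume k' (fPlus g))) =
    inner ℂ (monodromy R.op (ContinuousLinearMap.id ℂ _) (l.map Prod.swap)
      (tensorL volume (Γ.map k') (star (fMinus g)))) (tensorL volume k (fPlus f)) := by
  obtain ⟨_, b, -⟩ := exists_hilbertBasis ℂ K
  have hsum (x : K) : HasSum (fun i => inner ℂ (b i) x • b i) x := by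
    simpa only [b.repr_apply_apply] using b.hasSum_repr x
  have hlim {ι : Type _} {c : ι → K} (hc : Orthonormal ℂ c)
      (hc' : ∀ x, HasSum (fun i => inner ℂ (c i) x • c i) x) (L) (ξ) :=
    tendsto_monodromy R.op (norm_fibreProj_apply_le (μ := volume) hc)
      (tendsto_fibreProj hc hc') L ξ
  exact tendsto_nhds_unique (tendsto_const_nhds.inner (hlim b.orthonormal hsum _ _)) <|
    ((hlim (Γ.orthonormal_comp b.orthonormal) (Γ.hasSum_inner_smul hsum) _ _).inner
      tendsto_const_nhds).congr fun F => (inner_monodromy_fibreProj_eq hR hfg k k' hl b F).symm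

theorem exchangeOp_eq_adjoint_of_crossingSymmetric (hR : R.CrossingSymmetric) {f g : 𝓢(ℝ, ℂ)}
    (hfg : ∀ u ∈ Function.support f, ∀ u' ∈ Function.support g, u < u') (k k' : K) (n : ℕ) :
    exchangeOp R.op (tensorVec (star (fMinus f)) (Γ.map k)) (-tensorVec (fPlus g) k') n =
      ContinuousLinearMap.adjoint (exchangeOp R.op (tensorVec (fPlus f) k)
        (-tensorVec (star (fMinus g)) (Γ.map k')) n) := by
  refine exchangeOp_eq_adjoint R.op (topologicalClosure_span_elementary volume K) (fun l hl => ?_) n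
  rw [map_neg, map_neg, inner_neg_left, inner_neg_right]
  exact congr(-$(inner_monodromy_eq hR hfg k k' hl))

theorem tcpField_eq (R : YBFunction V Γ) (k : K) (g : 𝓢(ℝ, ℂ)) :
    tcpField R k g = createRight R.op (-tensorVec (fPlus g) k) +
      annihilateRight R.op (-tensorVec (star (fMinus g)) (Γ.map k)) := by
  have hcreate : oneTCP Γ (tensorVec (fPlus (tcpTest g)) (Γ.map k)) = -tensorVec (fPlus g) k :=
    (oneTCP_tensorL _ _).trans <| by rw [star_fPlus_tcpTest, Γ.involutive, map_neg]; rfl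
  have hannihilate : oneTCP Γ (tensorVec (star (fMinus (tcpTest g))) (Γ.map (Γ.map k))) =
      -tensorVec (star (fMinus g)) (Γ.map k) :=
    (oneTCP_tensorL _ _).trans <| by
      rw [star_star, fMinus_tcpTest, Γ.involutive, map_neg]; rfl
  rw [← hcreate, ← hannihilate]
  exact LinearMap.ext (secondQuantConj_create_add_annihilate oneTCP_involutive
    (commutesWithReversal_op R) (tensorVec (fPlus (tcpTest g)) (Γ.map k))
    (tensorVec (star (fMinus (tcpTest g))) (Γ.map (Γ.map k))))

end Crossing

end YangBaxterQFT

end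

theorem mainTheorem3 {G : Type v} [Group G]
    {K : Type u} [NormedAddCommGroup K] [InnerProductSpace ℂ K] [CompleteSpace K]
    (V : G →* (K ≃ₗᵢ[ℂ] K)) (Γ : YangBaxterQFT.Conjugation K)
    (R : YangBaxterQFT.YBFunction V Γ) (hR : R.CrossingSymmetric)
    (k k' : K) (f g : 𝓢(ℝ, ℂ))
    (hfg : ∀ u ∈ Function.support f, ∀ u' ∈ Function.support g, u < u')
    (Ψ : YangBaxterQFT.finPart R.op) :
    YangBaxterQFT.field R k f (YangBaxterQFT.tcpField R k' g Ψ) -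
      YangBaxterQFT.tcpField R k' g (YangBaxterQFT.field R k f Ψ) = 0 := by
  have hexchange := YangBaxterQFT.exchangeOp_eq_adjoint_of_crossingSymmetric hR hfg k k'
  have hcommute := YangBaxterQFT.commute_create_add_annihilate (YangBaxterQFT.isSelfAdjoint_op R)
    (YangBaxterQFT.op_mul_op R) (YangBaxterQFT.braided_op R) hexchange
  rw [YangBaxterQFT.tcpField_eq, sub_eq_zero]
  exact LinearMap.congr_fun hcommute Ψ
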